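/- Let $m\ge 1$, $n\ge 0$, $\ell\ge 1$ be integers and let $\underline{\boldsymbol z}=(z_1,\dots,z_\ell)\in\mathbb C^\ell$ have pairwise distinct coordinates. **Notation.** Let $\mathbb I_{m|n}=\{1<\dots<m<\tfrac12<\dots<n-\tfrac12\}$, where integers are even and half-integers are odd indices; $E_{i,j}$ $(i,j\in\mathbb I_{m|n})$ are the matrix units of the Lie superalgebra $\mathfrak{gl}_{m|n}$, and $\pi:\{1,\dots,m+n\}\to\mathbb I_{m|n}$ is the order-preserving bijection. In the superalgebra $U(\mathfrak{gl}_{m|n})^{\otimes\ell}$ let $E_{i,j}^{(a)}$ be $E_{i,j}$ placed in the $a$-th tensor factor, and let $E_{i,j}(z)=\sum_{a=1}^{\ell}E_{i,j}^{(a)}/(z-z_a)$, expanded at $z=\infty$. Over the algebra $U(\mathfrak{gl}_{m|n})^{\otimes \ell}((z^{-1},\partial_z^{-1}))$ of pseudo-differential operators put $$\mathcal L_{m|n}(\underline{\boldsymbol z})=\bigl[\delta_{r,s}\partial_z-(-1)^{2\pi(r)}E_{\pi(r),\pi(s)}(z)\bigr]_{r,s=1}^{m+n}.$$ For a matrix $A$,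 let $A_{(i)}$ be its leading principal $i\times i$ submatrix and $d_i(A)=\bigl(((A_{(i)})^{-1})_{i,i}\bigr)^{-1}$; $A$ is sufficiently invertible if all these inverses exist. Set $\mathrm{Ber}(A)=d_1(A)\cdots d_m(A)\,d_{m+1}(A)^{-1}\cdots d_{m+n}(A)^{-1}$ for $A$ of size $m+n$ attached to $m|n$. Write $\mathrm{Ber}(1+u\mathcal L_{m|n}(\underline{\boldsymbol z}))=\sum_{i\ge0}\sum_{j=0}^{i}b_{ij}(z)\partial_z^{i-j}u^i$; the Gaudin algebra $\mathfrak B_{m|n}(\underline{\boldsymbol z})\subseteq U(\mathfrak{gl}_{m|n})^{\otimes\ell}$ is the subalgebra generated by all coefficients of the series $b_{ij}(z)$. A polynomial $\mathfrak{gl}_{m|n}$-module is a module that is the direct sum of its weight spaces and all of whose weights $\mu$ satisfy $\mu(E_{i,i})\in\mathbb Z_{\ge0}$ for all $i$; it is $\mathbb Z/2$-graded by the parity of $\sum_{i\text{ odd}}\mu(E_{i,i})$. Let $M_1,\dots,M_\ell$ be polynomial $\mathfrak{gl}_{m|n}$-modules and $\boldsymbol M=M_1\otimes\cdots\otimes M_\ell$,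 with the usual sign rule for the action of $U(\mathfrak{gl}_{m|n})^{\otimes\ell}$. A pseudo-differential operator acts by $\bigl(\sum a_{ij}z^i\partial_z^j\bigr)v=\sum (a_{ij}v)z^i\partial_z^j$. For a permutation $\sigma$ of $\{1,\dots,m+n\}$, write $i<_\sigma j$ if $\sigma(\pi^{-1}(i))<\sigma(\pi^{-1}(j))$, and let $\boldsymbol M^{\sigma\text{-sing}}_\mu$ be the space of vectors $v$ of weight $\mu$ with $E_{i,j}v=0$ whenever $i<_\sigma j$; $\mu$ is a $\sigma$-singular weight if this space is nonzero. For $\sigma=\mathrm{id}$ one omits $\sigma$. For $1\le p\le m$ let $\sigma_p$ be the permutation with $\sigma_p(i)=i$ for $i\le p$, $\sigma_p(i)=i+n$ for $p<i\le m$, and $\sigma_p(i)=i-(m-p)$ for $i>m$. For $1\le p\le m$ and $0\le k\le n$ regard $\mathbb I_{p|k}\subseteq\mathbb I_{m|n}$ and $\mathfrak{gl}_{p|k}\subseteq\mathfrak{gl}_{m|n}$, so that $U(\mathfrak{gl}_{p|k})^{\otimes \ell}$ acts on $\boldsymbol M$; let $\overline{\mathfrak{tr}}_{p|k}(\boldsymbol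 M)$ be the sum of the weight spaces $\boldsymbol M_\nu$ with $\nu(E_{i,i})=0$ for all $i\notin\mathbb I_{p|k}$, and let $\overline{\mathfrak{tr}}_{p|k}(\boldsymbol M)^{\rm sing}_\mu$ be the space of its $\mathfrak{gl}_{p|k}$-singular vectors whose $\mathfrak{gl}_{p|k}$-weight is the restriction of $\mu$. **Statement.** Let $1\le p\le m$ and $0\le k\le n$. For $(a,b)\in\{(m,n),(p,n),(m,k)\}$, the matrices $\mathcal L_{a|b}(\underline{\boldsymbol z})$ and $1+u\mathcal L_{a|b}(\underline{\boldsymbol z})$ are sufficiently invertible (so the Berezinians below are well defined), and the following hold. (i) A $\sigma_p$-singular weight $\mu$ of $\boldsymbol M$ satisfies $\mu(E_{i,i})=0$ for $i=p+1,\dots,m$ if and only if there is a partition $\lambda$ with $\lambda_{p+1}\le n$ such that $$\mu(E_{i,i})=\lambda_i\ (i\le p),\qquad \mu(E_{j-\frac12,j-\frac12})=\max(\lambda'_j-p,0)\ (1\le j\le n),\qquad \mu(E_{i,i})=\max(\lambda_i-n,0)\ (p<i\le m),$$ where $\lambda'$ is the conjugate partition. For every such $\mu$, $\overline{\mathfrak{tr}}_{p|n}(\boldsymbol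 M)^{\rm sing}_\mu=\boldsymbol M^{\sigma_p\text{-sing}}_\mu$ and $$\mathrm{Ber}(\mathcal L_{m|n}(\underline{\boldsymbol z}))\,v=\mathrm{Ber}(\mathcal L_{p|n}(\underline{\boldsymbol z}))\,\partial_z^{m-p}\,v\qquad\text{for all } v\in \boldsymbol M^{\sigma_p\text{-sing}}_\mu .$$ Consequently, if $N=\bigoplus_\mu\overline{\mathfrak{tr}}_{p|n}(\boldsymbol M)^{\rm sing}_\mu=\bigoplus_\mu \boldsymbol M^{\sigma_p\text{-sing}}_\mu$, summed over all such $\mu$, then $N$ is stable under $\mathfrak B_{m|n}(\underline{\boldsymbol z})$ and $\mathfrak B_{p|n}(\underline{\boldsymbol z})$, and these two algebras have the same image in $\mathrm{End}(N)$. (ii) For every singular weight $\mu$ of $\boldsymbol M$ with $\mu(E_{k+\frac12,k+\frac12})=0$ (no condition if $k=n$), $\overline{\mathfrak{tr}}_{m|k}(\boldsymbol M)^{\rm sing}_\mu=\boldsymbol M^{\rm sing}_\mu$ and $$\mathrm{Ber}(\mathcal L_{m|n}(\underline{\boldsymbol z}))\,v=\mathrm{Ber}(\mathcal L_{m|k}(\underline{\boldsymbol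 z}))\,\partial_z^{k-n}\,v\qquad\text{for all } v\in \boldsymbol M^{\rm sing}_\mu .$$ Consequently, if $N'=\bigoplus_\mu\overline{\mathfrak{tr}}_{m|k}(\boldsymbol M)^{\rm sing}_\mu=\bigoplus_\mu\boldsymbol M^{\rm sing}_\mu$, summed over all such $\mu$, then $N'$ is stable under $\mathfrak B_{m|n}(\underline{\boldsymbol z})$ and $\mathfrak B_{m|k}(\underline{\boldsymbol z})$, and these two algebras have the same image in $\mathrm{End}(N')$. -/

import Mathlib

noncomputable section
namespace Gaudin

section PseudoDiff

variable (A : Type*) [Ring A] [Algebra ℂ A]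

/-- The supports allowed for Hahn series over `ℤ × ℤ` are exactly the sets bounded below in both
coordinates. -/
theorem isPWO_iff (s : Set (ℤ × ℤ)) : s.IsPWO ↔ ∃ a b : ℤ, ∀ x ∈ s, a ≤ x.1 ∧ b ≤ x.2 := by
  constructor
  · intro h
    have key : ∀ t : Set ℤ, t.IsPWO → ∃ a : ℤ, ∀ x ∈ t, a ≤ x := by
      intro t ht
      rcases t.eq_empty_or_nonempty with rfl | hne
      · exact ⟨0, by simp⟩
      · exact ⟨ht.isWF.min hne, fun x hx => ht.isWF.min_le hne hx⟩
    obtain ⟨a, ha⟩ := key _ (h.image_of_monotone monotone_fst)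
    obtain ⟨b, hb⟩ := key _ (h.image_of_monotone monotone_snd)
    exact ⟨a, b, fun x hx => ⟨ha _ ⟨x, hx, rfl⟩, hb _ ⟨x, hx, rfl⟩⟩⟩
  · rintro ⟨a, b, h⟩
    have : (Set.range fun x : ℕ × ℕ => ((a + x.1, b + x.2) : ℤ × ℤ)).IsPWO := by
      rw [← Set.image_univ]
      refine (Set.isPWO_of_wellQuasiOrderedLE _).image_of_monotone ?_
      intro x y hxy
      have h1 := hxy.1
      have h2 := hxy.2
      constructor <;> simp <;> assumption
    refine this.mono fun x hx => ⟨((x.1 - a).toNat, (x.2 - b).toNat), ?_⟩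
    have := h x hx
    ext <;> simp <;> omega

/-- Series `∑_{j ≤ s} ∑_{i ≤ r} a_ij z^i ∂^j` over `A`; the coefficient of `z^i ∂^j` is placed at
`(-i, -j)`. -/
abbrev Symb := HahnSeries (ℤ × ℤ) A

variable {A}

/-- The operator that scales the coefficient at `x` by `w x`. -/
def theta (w : ℤ × ℤ → ℤ) : Symb A →ₗ[ℂ] Symb A where
  toFun f :=
    { coeff := fun x => (w x : ℂ) • f.coeff x
      isPWO_support' := f.isPWO_support.mono fun x hx hf => hx (by simp [hf]) }
  map_add' f g := by ext x; simp
  map_smul' c f := by ext x; exact smul_comm _ _ _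

theorem theta_coeff (w : ℤ × ℤ → ℤ) (f : Symb A) (x : ℤ × ℤ) :
    (theta w f).coeff x = (w x : ℂ) • f.coeff x := rfl

theorem theta_mul (w : ℤ × ℤ → ℤ) (hw : ∀ x y, w (x + y) = w x + w y) (f g : Symb A) :
    theta w (f * g) = theta w f * g + f * theta w g := by
  ext x
  have h1 : (theta w f).support ⊆ f.support := fun y hy hf => hy (by simp [theta_coeff, hf])
  have h2 : (theta w g).support ⊆ g.support := fun y hy hf => hy (by simp [theta_coeff, hf])
  rw [HahnSeries.coeff_add, theta_coeff, HahnSeries.coeff_mul,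
    HahnSeries.coeff_mul_left' f.isPWO_support h1, HahnSeries.coeff_mul_right' g.isPWO_support h2,
    Finset.smul_sum, ← Finset.sum_add_distrib]
  refine Finset.sum_congr rfl fun ij hij => ?_
  rw [Finset.mem_antidiagonal] at hij
  rw [← hij.2.2, hw, theta_coeff, theta_coeff]
  push_cast
  rw [add_smul, smul_mul_assoc, mul_smul_comm]

/-- Multiplication by the monomial of exponent `e`. -/
def shiftMul (e : ℤ × ℤ) : Symb A →ₗ[ℂ] Symb A :=
  LinearMap.mulLeft ℂ (HahnSeries.single e (1 : A))

theorem single_comm (e : ℤ × ℤ) (f : Symb A) :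
    HahnSeries.single e (1 : A) * f = f * HahnSeries.single e (1 : A) := by
  ext x; simp [HahnSeries.coeff_single_mul, HahnSeries.coeff_mul_single]

/-- The derivative of a symbol with respect to `∂`: `a z^i ∂^j ↦ j a z^i ∂^{j-1}`. -/
def dXi : Symb A →ₗ[ℂ] Symb A := shiftMul (0, 1) ∘ₗ theta fun x => -x.2

/-- The derivative of a symbol with respect to `z`: `a z^i ∂^j ↦ i a z^{i-1} ∂^j`. -/
def dZ : Symb A →ₗ[ℂ] Symb A := shiftMul (1, 0) ∘ₗ theta fun x => -x.1

theorem dXi_coeff (f : Symb A) (x : ℤ × ℤ) :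
    (dXi f).coeff x = ((1 - x.2 : ℤ) : ℂ) • f.coeff (x.1, x.2 - 1) := by
  obtain ⟨a, b⟩ := x
  simp [dXi, shiftMul, HahnSeries.coeff_single_mul, theta_coeff]

theorem dZ_coeff (f : Symb A) (x : ℤ × ℤ) :
    (dZ f).coeff x = ((1 - x.1 : ℤ) : ℂ) • f.coeff (x.1 - 1, x.2) := by
  obtain ⟨a, b⟩ := x
  simp [dZ, shiftMul, HahnSeries.coeff_single_mul, theta_coeff]

theorem shift_leibniz (e : ℤ × ℤ) (u v f g : Symb A) :
    shiftMul e (u * g + f * v) = shiftMul e u * g + f * shiftMul e v := by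
  simp only [shiftMul, LinearMap.mulLeft_apply]
  rw [mul_add, ← mul_assoc, ← mul_assoc, single_comm e f, mul_assoc f]

theorem dXi_mul (f g : Symb A) : dXi (f * g) = dXi f * g + f * dXi g := by
  simp only [dXi, LinearMap.comp_apply]
  rw [theta_mul _ (fun x y => by simp; ring), shift_leibniz]

theorem dZ_mul (f g : Symb A) : dZ (f * g) = dZ f * g + f * dZ g := by
  simp only [dZ, LinearMap.comp_apply]
  rw [theta_mul _ (fun x y => by simp; ring), shift_leibniz]

theorem dXi_dZ : (dXi * dZ : Module.End ℂ (Symb A)) = dZ * dXi := by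
  ext f x
  simp only [Module.End.mul_apply, dXi_coeff, dZ_coeff]
  exact smul_comm _ _ _

theorem leibniz_pow (D : Module.End ℂ (Symb A)) (hD : ∀ f g, D (f * g) = D f * g + f * D g)
    (t : ℕ) (f g : Symb A) :
    (D ^ t) (f * g) = ∑ ab ∈ Finset.HasAntidiagonal.antidiagonal t,
      (t.choose ab.1 : ℂ) • ((D ^ ab.1) f * (D ^ ab.2) g) := by
  induction t with
  | zero => simp
  | succ t ih =>
    have h1 : (D ^ (t + 1)) (f * g) = ∑ ab ∈ Finset.HasAntidiagonal.antidiagonal t,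
        (t.choose ab.1 : ℂ) • ((D ^ (ab.1 + 1)) f * (D ^ ab.2) g
          + (D ^ ab.1) f * (D ^ (ab.2 + 1)) g) := by
      rw [pow_succ', Module.End.mul_apply, ih, map_sum]
      refine Finset.sum_congr rfl fun ab _ => ?_
      rw [map_smul, hD, pow_succ', pow_succ']; rfl
    rw [h1]
    simp only [smul_add, Finset.sum_add_distrib]
    have h2 := Finset.sum_antidiagonal_choose_succ_nsmul
      (fun a b => (D ^ a) f * (D ^ b) g) t
    simp only [← Nat.cast_smul_eq_nsmul ℂ] at h2
    rw [h2, add_comm]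
    congr 1
    refine Finset.sum_congr rfl fun ab hab => ?_
    rw [Finset.HasAntidiagonal.mem_antidiagonal] at hab
    rw [← hab, Nat.choose_symm_add]

/-- The symbols of order at most `-n` in `∂`. -/
def fil (n : ℤ) : Submodule ℂ (Symb A) where
  carrier := {f | ∀ x : ℤ × ℤ, x.2 < n → f.coeff x = 0}
  add_mem' hf hg x hx := by simp [hf x hx, hg x hx]
  zero_mem' x hx := by simp
  smul_mem' c f hf x hx := by simp [hf x hx]

theorem exists_fil (f : Symb A) : ∃ n, f ∈ fil n := by
  obtain ⟨a, b, h⟩ := (isPWO_iff _).1 f.isPWO_support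
  refine ⟨b, fun x hx => ?_⟩
  by_contra hf
  exact absurd (h x hf).2 (by omega)

theorem fil_mono {n m : ℤ} (h : m ≤ n) {f : Symb A} (hf : f ∈ fil n) : f ∈ fil m :=
  fun x hx => hf x (by omega)

theorem fil_mul {n m : ℤ} {f g : Symb A} (hf : f ∈ fil n) (hg : g ∈ fil m) :
    f * g ∈ fil (n + m) := by
  intro x hx
  rw [HahnSeries.coeff_mul]
  refine Finset.sum_eq_zero fun ij hij => ?_
  rw [Finset.mem_antidiagonal] at hij
  have := congrArg Prod.snd hij.2.2
  simp at this
  by_cases h : ij.1.2 < n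
  · rw [hf _ h, zero_mul]
  · rw [hg ij.2 (by omega), mul_zero]

theorem fil_dXi {n : ℤ} {f : Symb A} (hf : f ∈ fil n) (t : ℕ) : (dXi ^ t) f ∈ fil (n + t) := by
  induction t with
  | zero => simpa using hf
  | succ t ih =>
    intro x hx
    rw [pow_succ', Module.End.mul_apply, dXi_coeff, ih _ (by push_cast at hx; simp; omega),
      smul_zero]

theorem fil_dZ {n : ℤ} {f : Symb A} (hf : f ∈ fil n) (t : ℕ) : (dZ ^ t) f ∈ fil n := by
  induction t with
  | zero => simpa using hf
  | succ t ih =>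
    intro x hx
    rw [pow_succ', Module.End.mul_apply, dZ_coeff, ih _ (by simpa using hx), smul_zero]

theorem eq_of_fil {f g : Symb A} (c : ℤ) (h : ∀ T : ℕ, f - g ∈ fil (c + T)) : f = g := by
  ext x
  have := h (x.2 - c + 1).toNat x (by omega)
  rwa [HahnSeries.coeff_sub, sub_eq_zero] at this

/-- The `t`-th term of the composition of two symbols. -/
def starTerm (f g : Symb A) (t : ℕ) : Symb A :=
  ((t.factorial : ℂ)⁻¹) • ((dXi ^ t) f * (dZ ^ t) g)

theorem starTerm_mem {n m : ℤ} {f g : Symb A} (hf : f ∈ fil n) (hg : g ∈ fil m) (t : ℕ) :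
    starTerm f g t ∈ fil (n + m + t) :=
  Submodule.smul_mem _ _ (fil_mono (by omega) (fil_mul (fil_dXi hf t) (fil_dZ hg t)))

theorem fst_bound (f : Symb A) : ∃ a : ℤ, ∀ t : ℕ, ∀ x : ℤ × ℤ, x.1 < a →
    ((dXi ^ t) f).coeff x = 0 ∧ ((dZ ^ t) f).coeff x = 0 := by
  obtain ⟨a, b, h⟩ := (isPWO_iff _).1 f.isPWO_support
  refine ⟨a, fun t => ?_⟩
  induction t with
  | zero =>
    intro x hx
    have : f.coeff x = 0 := by
      by_contra hf
      exact absurd (h x hf).1 (by omega)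
    simp [this]
  | succ t ih =>
    intro x hx
    constructor
    · rw [pow_succ', Module.End.mul_apply, dXi_coeff, (ih _ (by simpa using hx)).1, smul_zero]
    · rw [pow_succ', Module.End.mul_apply, dZ_coeff, (ih _ (by simp; omega)).2, smul_zero]

def starFam (f g : Symb A) : HahnSeries.SummableFamily (ℤ × ℤ) A ℕ where
  toFun := starTerm f g
  isPWO_iUnion_support' := by
    obtain ⟨n, hf⟩ := exists_fil f
    obtain ⟨m, hg⟩ := exists_fil g
    obtain ⟨a, ha⟩ := fst_bound f
    obtain ⟨b, hb⟩ := fst_bound g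
    rw [isPWO_iff]
    refine ⟨a + b, n + m, fun x hx => ?_⟩
    simp only [Set.mem_iUnion] at hx
    obtain ⟨t, ht⟩ := hx
    constructor
    · by_contra hlt
      apply ht
      rw [starTerm, HahnSeries.coeff_smul, HahnSeries.coeff_mul, Finset.sum_eq_zero, smul_zero]
      intro ij hij
      rw [Finset.mem_antidiagonal] at hij
      have := congrArg Prod.fst hij.2.2
      simp at this
      by_cases h : ij.1.1 < a
      · rw [(ha t _ h).1, zero_mul]
      · rw [(hb t ij.2 (by omega)).2, mul_zero]
    · by_contra hlt
      exact ht (starTerm_mem hf hg t x (by omega))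
  finite_co_support' x := by
    obtain ⟨n, hf⟩ := exists_fil f
    obtain ⟨m, hg⟩ := exists_fil g
    refine (Set.finite_Iio (x.2 - (n + m) + 1).toNat).subset fun t ht => ?_
    by_contra hlt
    simp only [Set.mem_Iio] at hlt
    exact ht (starTerm_mem hf hg t x (by omega))

/-- The composition `∑_t (1/t!) (∂_ξ^t f) (∂_z^t g)` of two symbols (`ξ` is the symbol of `∂`). -/
def symbMul (f g : Symb A) : Symb A := (starFam f g).hsum

def starSum (f g : Symb A) (T : ℕ) : Symb A := ∑ t ∈ Finset.range T, starTerm f g t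

theorem symbMul_sub_mem {n m : ℤ} {f g : Symb A} (hf : f ∈ fil n) (hg : g ∈ fil m) (T : ℕ) :
    symbMul f g - starSum f g T ∈ fil (n + m + T) := by
  intro x hx
  rw [HahnSeries.coeff_sub, sub_eq_zero, symbMul,
    HahnSeries.SummableFamily.coeff_hsum_eq_sum_of_subset (t := Finset.range T), starSum,
    HahnSeries.coeff_sum]
  · rfl
  · intro t ht
    by_contra hlt
    simp only [Finset.coe_range, Set.mem_Iio] at hlt
    exact ht (starTerm_mem hf hg t x (by omega))

theorem symbMul_mem {n m : ℤ} {f g : Symb A} (hf : f ∈ fil n) (hg : g ∈ fil m) :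
    symbMul f g ∈ fil (n + m) := by
  simpa [starSum] using symbMul_sub_mem hf hg 0

def tri (f g h : Symb A) (a b s : ℕ) : Symb A :=
  ((a.factorial : ℂ)⁻¹ * (b.factorial : ℂ)⁻¹ * (s.factorial : ℂ)⁻¹) •
    ((dXi ^ (a + s)) f * (dXi ^ b) ((dZ ^ s) g) * (dZ ^ (a + b)) h)

theorem starTerm_left (f g h : Symb A) (s t : ℕ) :
    starTerm (starTerm f g s) h t = ∑ ab ∈ Finset.HasAntidiagonal.antidiagonal t, tri f g h ab.1 ab.2 s := by
  rw [starTerm, starTerm, map_smul, leibniz_pow _ dXi_mul, Finset.smul_sum, Finset.sum_mul,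
    Finset.smul_sum]
  refine Finset.sum_congr rfl fun ab hab => ?_
  rw [Finset.HasAntidiagonal.mem_antidiagonal] at hab
  rw [tri, pow_add dXi, Module.End.mul_apply, smul_mul_assoc, smul_mul_assoc, smul_smul, smul_smul,
    hab]
  congr 1
  subst hab
  rw [Nat.choose_symm_add, Nat.add_choose, Nat.cast_div_charZero (Nat.factorial_mul_factorial_dvd_factorial_add _ _)]
  have h1 := Nat.cast_ne_zero (R := ℂ).2 (Nat.factorial_ne_zero ab.1)
  have h2 := Nat.cast_ne_zero (R := ℂ).2 (Nat.factorial_ne_zero ab.2)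
  have h3 := Nat.cast_ne_zero (R := ℂ).2 (Nat.factorial_ne_zero s)
  have h4 := Nat.cast_ne_zero (R := ℂ).2 (Nat.factorial_ne_zero (ab.1 + ab.2))
  push_cast
  field_simp

theorem starTerm_right (f g h : Symb A) (s t : ℕ) :
    starTerm f (starTerm g h s) t = ∑ ab ∈ Finset.HasAntidiagonal.antidiagonal t, tri f g h ab.2 s ab.1 := by
  rw [starTerm, starTerm, map_smul, leibniz_pow _ dZ_mul, Finset.smul_sum, Finset.mul_sum,
    Finset.smul_sum]
  refine Finset.sum_congr rfl fun ab hab => ?_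
  rw [Finset.HasAntidiagonal.mem_antidiagonal] at hab
  have hc : (dZ ^ ab.1) ((dXi ^ s) g) = (dXi ^ s) ((dZ ^ ab.1) g) := by
    have : Commute (dZ : Module.End ℂ (Symb A)) dXi := dXi_dZ.symm
    exact LinearMap.congr_fun (this.pow_pow ab.1 s) g
  rw [tri, pow_add dZ, Module.End.mul_apply, mul_smul_comm, mul_smul_comm, smul_smul, smul_smul,
    add_comm ab.2 ab.1, hab, hc, mul_assoc ((dXi ^ t) f)]
  congr 1
  · subst hab
    rw [Nat.choose_symm_add, Nat.add_choose, Nat.cast_div_charZero (Nat.factorial_mul_factorial_dvd_factorial_add _ _)]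
    have h1 := Nat.cast_ne_zero (R := ℂ).2 (Nat.factorial_ne_zero ab.1)
    have h2 := Nat.cast_ne_zero (R := ℂ).2 (Nat.factorial_ne_zero ab.2)
    have h3 := Nat.cast_ne_zero (R := ℂ).2 (Nat.factorial_ne_zero s)
    have h4 := Nat.cast_ne_zero (R := ℂ).2 (Nat.factorial_ne_zero (ab.1 + ab.2))
    push_cast
    field_simp

theorem starTerm_sub_left (f f' g : Symb A) (t : ℕ) :
    starTerm f g t - starTerm f' g t = starTerm (f - f') g t := by
  simp [starTerm, sub_mul, smul_sub]

theorem starTerm_sub_right (f g g' : Symb A) (t : ℕ) :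
    starTerm f g t - starTerm f g' t = starTerm f (g - g') t := by
  simp [starTerm, mul_sub, smul_sub]

theorem starTerm_sum_left {ι : Type*} (s : Finset ι) (f : ι → Symb A) (g : Symb A) (t : ℕ) :
    starTerm (∑ i ∈ s, f i) g t = ∑ i ∈ s, starTerm (f i) g t := by
  simp [starTerm, Finset.sum_mul, Finset.smul_sum]

theorem starTerm_sum_right {ι : Type*} (s : Finset ι) (f : Symb A) (g : ι → Symb A) (t : ℕ) :
    starTerm f (∑ i ∈ s, g i) t = ∑ i ∈ s, starTerm f (g i) t := by
  simp [starTerm, Finset.mul_sum, Finset.smul_sum]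

theorem tri_sum (f g h : Symb A) (T : ℕ) :
    ∑ t ∈ Finset.range T, ∑ s ∈ Finset.range (T - t), ∑ ab ∈ Finset.HasAntidiagonal.antidiagonal t,
        tri f g h ab.1 ab.2 s =
      ∑ t ∈ Finset.range T, ∑ s ∈ Finset.range (T - t), ∑ ab ∈ Finset.HasAntidiagonal.antidiagonal t,
        tri f g h ab.2 s ab.1 := by
  simp only [Finset.sum_sigma']
  refine Finset.sum_bij'
    (fun x _ => ⟨x.2.1 + x.2.2.1, x.2.2.2, (x.2.1, x.2.2.1)⟩)
    (fun x _ => ⟨x.2.2.2 + x.2.1, x.2.2.1, (x.2.2.2, x.2.1)⟩) ?_ ?_ ?_ ?_ ?_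
  all_goals
    rintro ⟨t, s, ⟨a, b⟩⟩ hx
    simp only [Finset.mem_sigma, Finset.mem_range, Finset.HasAntidiagonal.mem_antidiagonal] at hx ⊢
  · refine ⟨?_, ?_, trivial⟩ <;> omega
  · refine ⟨?_, ?_, ?_⟩ <;> first | trivial | omega
  · obtain ⟨_, _, rfl⟩ := hx
    rfl
  · obtain ⟨_, _, rfl⟩ := hx
    rfl

theorem symbMul_assoc (f g h : Symb A) : symbMul (symbMul f g) h = symbMul f (symbMul g h) := by
  obtain ⟨n, hf⟩ := exists_fil f
  obtain ⟨m, hg⟩ := exists_fil g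
  obtain ⟨k, hh⟩ := exists_fil h
  refine eq_of_fil (n + m + k) fun T => ?_
  have e1 : symbMul (symbMul f g) h - ∑ t ∈ Finset.range T, ∑ s ∈ Finset.range (T - t),
      ∑ ab ∈ Finset.HasAntidiagonal.antidiagonal t, tri f g h ab.1 ab.2 s ∈ fil (n + m + k + T) := by
    have h1 := symbMul_sub_mem (symbMul_mem hf hg) hh T
    have h2 : starSum (symbMul f g) h T - ∑ t ∈ Finset.range T, ∑ s ∈ Finset.range (T - t),
        ∑ ab ∈ Finset.HasAntidiagonal.antidiagonal t, tri f g h ab.1 ab.2 s ∈ fil (n + m + k + T) := by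
      rw [starSum, ← Finset.sum_sub_distrib]
      refine Submodule.sum_mem _ fun t ht => ?_
      rw [Finset.mem_range] at ht
      simp only [← starTerm_left]
      rw [← starTerm_sum_left, starTerm_sub_left]
      exact fil_mono (by omega) (starTerm_mem (symbMul_sub_mem hf hg (T - t)) hh t)
    simpa using Submodule.add_mem _ h1 h2
  have e2 : symbMul f (symbMul g h) - ∑ t ∈ Finset.range T, ∑ s ∈ Finset.range (T - t),
      ∑ ab ∈ Finset.HasAntidiagonal.antidiagonal t, tri f g h ab.2 s ab.1 ∈ fil (n + m + k + T) := by
    have h1 := fil_mono (m := n + m + k + T) (by omega) (symbMul_sub_mem hf (symbMul_mem hg hh) T)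
    have h2 : starSum f (symbMul g h) T - ∑ t ∈ Finset.range T, ∑ s ∈ Finset.range (T - t),
        ∑ ab ∈ Finset.HasAntidiagonal.antidiagonal t, tri f g h ab.2 s ab.1 ∈ fil (n + m + k + T) := by
      rw [starSum, ← Finset.sum_sub_distrib]
      refine Submodule.sum_mem _ fun t ht => ?_
      rw [Finset.mem_range] at ht
      simp only [← starTerm_right]
      rw [← starTerm_sum_right, starTerm_sub_right]
      exact fil_mono (by omega) (starTerm_mem hf (symbMul_sub_mem hg hh (T - t)) t)
    simpa using Submodule.add_mem _ h1 h2
  rw [tri_sum] at e1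
  simpa using Submodule.sub_mem _ e1 e2

theorem symbMul_add (f g h : Symb A) : symbMul f (g + h) = symbMul f g + symbMul f h := by
  rw [symbMul, symbMul, symbMul, ← HahnSeries.SummableFamily.hsum_add]
  congr 1
  ext1 t
  show starTerm f (g + h) t = starTerm f g t + starTerm f h t
  simp [starTerm, mul_add]

theorem add_symbMul (f g h : Symb A) : symbMul (f + g) h = symbMul f h + symbMul g h := by
  rw [symbMul, symbMul, symbMul, ← HahnSeries.SummableFamily.hsum_add]
  congr 1
  ext1 t
  show starTerm (f + g) h t = starTerm f h t + starTerm g h t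
  simp [starTerm, add_mul]

theorem symbMul_eq_mul (f g : Symb A) (h : dXi f = 0 ∨ dZ g = 0) : symbMul f g = f * g := by
  ext x
  rw [symbMul, HahnSeries.SummableFamily.coeff_hsum, finsum_eq_single _ 0]
  · show (starTerm f g 0).coeff x = _
    simp [starTerm]
  · intro t ht
    obtain ⟨t, rfl⟩ := Nat.exists_eq_succ_of_ne_zero ht
    show (starTerm f g (t + 1)).coeff x = _
    rcases h with h | h <;> simp [starTerm, pow_succ, h]

theorem dXi_one : dXi (1 : Symb A) = 0 := by
  have := dXi_mul (1 : Symb A) 1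
  simpa using this

theorem dZ_one : dZ (1 : Symb A) = 0 := by
  have := dZ_mul (1 : Symb A) 1
  simpa using this

end PseudoDiff

/-- The algebra `A((z⁻¹, ∂⁻¹))` of pseudo-differential operators over `A`. -/
def PDO (A : Type*) [Ring A] [Algebra ℂ A] : Type _ := HahnSeries (ℤ × ℤ) A

section PDORing

variable {A : Type*} [Ring A] [Algebra ℂ A]

instance : AddCommGroup (PDO A) := inferInstanceAs (AddCommGroup (HahnSeries (ℤ × ℤ) A))

instance : Ring (PDO A) :=
  { (inferInstance : AddCommGroup (PDO A)) with
    mul := fun f g => symbMul (A := A) f g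
    one := (1 : HahnSeries (ℤ × ℤ) A)
    mul_assoc := symbMul_assoc
    one_mul := fun f => (symbMul_eq_mul _ _ (Or.inl dXi_one)).trans (one_mul _)
    mul_one := fun f => (symbMul_eq_mul _ _ (Or.inr dZ_one)).trans (mul_one _)
    left_distrib := symbMul_add
    right_distrib := add_symbMul
    zero_mul := fun f => by
      have := add_symbMul (0 : Symb A) 0 f
      rw [add_zero, left_eq_add] at this
      exact this
    mul_zero := fun f => by
      have := symbMul_add f (0 : Symb A) 0
      rw [add_zero, left_eq_add] at this
      exact this }

/-- The coefficient of `z^i ∂^j`. -/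
def PDO.coeff (f : PDO A) (i j : ℤ) : A := HahnSeries.coeff (Γ := ℤ × ℤ) f (-i, -j)

/-- The operator `a z^i ∂^j`. -/
def PDO.mono (a : A) (i j : ℤ) : PDO A := HahnSeries.single (Γ := ℤ × ℤ) (-i, -j) a

/-- The operator `∂^j`. -/
def PDO.dpow (A : Type*) [Ring A] [Algebra ℂ A] (j : ℤ) : PDO A := PDO.mono (1 : A) 0 j

theorem dXi_pow_single (a : A) (i j : ℤ) (t : ℕ) :
    (dXi ^ t) (HahnSeries.single (-i, -j) a : Symb A) =
      HahnSeries.single (-i, -(j - t)) (((t.factorial * Ring.choose j t : ℤ) : ℂ) • a) := by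
  rw [← nsmul_eq_mul, ← Ring.descPochhammer_eq_factorial_smul_choose]
  induction t with
  | zero => simp
  | succ t ih =>
    rw [pow_succ', Module.End.mul_apply, ih]
    ext x
    rw [dXi_coeff, descPochhammer_succ_right]
    simp only [HahnSeries.coeff_single]
    by_cases h : x = (-i, -(j - (t + 1 : ℕ)))
    · rw [if_pos (by rw [h]; ext <;> simp; ring), if_pos h, smul_smul, h]
      congr 1
      simp [Polynomial.smeval_mul, Polynomial.smeval_sub, Polynomial.smeval_natCast]
      ring
    · rw [if_neg h, if_neg, smul_zero]
      intro h'
      apply h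
      rw [Prod.ext_iff] at h' ⊢
      simp at h' ⊢
      omega

theorem dZ_pow_single (a : A) (i j : ℤ) (t : ℕ) :
    (dZ ^ t) (HahnSeries.single (-i, -j) a : Symb A) =
      HahnSeries.single (-(i - t), -j) (((t.factorial * Ring.choose i t : ℤ) : ℂ) • a) := by
  rw [← nsmul_eq_mul, ← Ring.descPochhammer_eq_factorial_smul_choose]
  induction t with
  | zero => simp
  | succ t ih =>
    rw [pow_succ', Module.End.mul_apply, ih]
    ext x
    rw [dZ_coeff, descPochhammer_succ_right]
    simp only [HahnSeries.coeff_single]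
    by_cases h : x = (-(i - (t + 1 : ℕ)), -j)
    · rw [if_pos (by rw [h]; ext <;> simp; ring), if_pos h, smul_smul, h]
      congr 1
      simp [Polynomial.smeval_mul, Polynomial.smeval_sub, Polynomial.smeval_natCast]
      ring
    · rw [if_neg h, if_neg, smul_zero]
      intro h'
      apply h
      rw [Prod.ext_iff] at h' ⊢
      simp at h' ⊢
      omega

theorem smul_single' (c : ℂ) (e : ℤ × ℤ) (a : A) :
    c • (HahnSeries.single e a : Symb A) = HahnSeries.single e (c • a) := by
  ext x
  by_cases h : x = e
  · subst h; simp
  · simp [HahnSeries.coeff_single_of_ne h]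

theorem starTerm_single (a b : A) (i j k l : ℤ) (t : ℕ) :
    starTerm (HahnSeries.single (-i, -j) a : Symb A) (HahnSeries.single (-k, -l) b) t =
      HahnSeries.single (-(i + k - t), -(j + l - t))
        (((t.factorial * Ring.choose j t * Ring.choose k t : ℤ) : ℂ) • (a * b)) := by
  have h1 := Nat.cast_ne_zero (R := ℂ).2 (Nat.factorial_ne_zero t)
  rw [starTerm, dXi_pow_single, dZ_pow_single, HahnSeries.single_mul_single, smul_single',
    smul_mul_assoc, mul_smul_comm, smul_smul, smul_smul]
  have e : ((-i, -(j - t)) + (-(k - t), -l) : ℤ × ℤ) = (-(i + k - t), -(j + l - t)) :=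
    Prod.ext (by simp only [Prod.fst_add]; ring) (by simp only [Prod.snd_add]; ring)
  rw [e]
  congr 1
  · congr 1
    push_cast
    field_simp

/-- The product of `a z^i ∂^j` and `b z^k ∂^l` is
`∑_t (j choose t) (k choose t) t! a b z^{i+k-t} ∂^{j+l-t}`. -/
theorem PDO.coeff_mono_mul_mono (a b : A) (i j k l : ℤ) (t : ℕ) :
    (PDO.mono a i j * PDO.mono b k l).coeff (i + k - t) (j + l - t) =
      ((t.factorial * Ring.choose j t * Ring.choose k t : ℤ) : ℂ) • (a * b) := by
  show (symbMul (HahnSeries.single (-i, -j) a : Symb A) (HahnSeries.single (-k, -l) b)).coeff _ = _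
  rw [symbMul, HahnSeries.SummableFamily.coeff_hsum, finsum_eq_single _ t]
  · show (starTerm _ _ t).coeff _ = _
    rw [starTerm_single, HahnSeries.coeff_single_same]
  · intro s hs
    show (starTerm _ _ s).coeff _ = _
    rw [starTerm_single, HahnSeries.coeff_single_of_ne]
    intro h
    rw [Prod.ext_iff] at h
    simp at h
    omega

theorem PDO.dpow_mul (i j : ℤ) : PDO.dpow A i * PDO.dpow A j = PDO.dpow A (i + j) := by
  have h := symbMul_eq_mul (HahnSeries.single (-0, -i) 1 : Symb A) (HahnSeries.single (-0, -j) 1)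
    (Or.inr (by simpa using dZ_pow_single (1 : A) 0 j 1))
  refine h.trans ?_
  rw [HahnSeries.single_mul_single]
  rw [one_mul, Prod.mk_add_mk, ← neg_add, ← neg_add, add_zero]
  rfl

end PDORing


/-- The index set `I_{m|n}`: `inl i` (`i < m`) is the even index `i + 1`, `inr j` (`j < n`) is the
odd index `j + 1/2`. -/
abbrev Idx (m n : ℕ) : Type := Fin m ⊕ Fin n

section Super

variable {m n : ℕ}

/-- The parity `|i|`. -/
def par : Idx m n → ℕ
  | Sum.inl _ => 0
  | Sum.inr _ => 1

/-- The sign `(-1)^{|E_ij| |E_kl|}`. -/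
def sgn (i j k l : Idx m n) : ℂ := (-1) ^ ((par i + par j) * (par k + par l))

theorem sgn_comm (i j k l : Idx m n) : sgn k l i j = sgn i j k l := by
  rw [sgn, sgn, mul_comm]

theorem sgn_mul_self (i j k l : Idx m n) : sgn i j k l * sgn i j k l = 1 := by
  rw [sgn, ← mul_pow]; simp

section Action

variable {V : Type*} [AddCommGroup V] [Module ℂ V]

/-- The weight space of weight `μ`, where `μ i` is the value of the weight at `E_ii`. -/
def weightSpace (E : Idx m n → Idx m n → Module.End ℂ V) (μ : Idx m n → ℂ) : Submodule ℂ V :=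
  ⨅ i, Module.End.eigenspace (E i i) (μ i)

theorem mem_weightSpace {E : Idx m n → Idx m n → Module.End ℂ V} {μ : Idx m n → ℂ} {v : V} :
    v ∈ weightSpace E μ ↔ ∀ i, E i i v = μ i • v := by
  simp [weightSpace, Submodule.mem_iInf]

/-- The operators `E i j` satisfy the supercommutation relations of the matrix units of
`gl_{m|n}`. -/
def IsGLAction (E : Idx m n → Idx m n → Module.End ℂ V) : Prop :=
  ∀ i j k l, E i j * E k l - sgn i j k l • (E k l * E i j) =
    (if j = k then E i l else 0) - sgn i j k l • (if l = i then E k j else 0)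

/-- A sum of weight spaces with distinct weights is direct. -/
theorem iSupIndep_weightSpace {E : Idx m n → Idx m n → Module.End ℂ V}
    (hE : ∀ i j, Commute (E i i) (E j j)) : iSupIndep (weightSpace E) := by
  refine (Module.End.independent_iInf_maxGenEigenspace_of_forall_mapsTo (fun i => E i i)
    fun i j φ => ?_).mono fun χ => ?_
  · exact Module.End.mapsTo_maxGenEigenspace_of_comm (hE j i) φ
  · exact iInf_mono fun i => (Module.End.genEigenspace (E i i) (χ i)).monotone le_top

end Action

/-- A polynomial `gl_{m|n}`-module structure on `V`: `V` is the sum of its weight spaces, and the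
values of every weight at the `E_ii` are nonnegative integers. -/
structure PolyModule (m n : ℕ) (V : Type*) [AddCommGroup V] [Module ℂ V] where
  E : Idx m n → Idx m n → Module.End ℂ V
  bracket : IsGLAction E
  semisimple : ⨆ μ, weightSpace E μ = ⊤
  weights : ∀ μ, weightSpace E μ ≠ ⊥ → ∃ ν : Idx m n → ℕ, ∀ i, μ i = ν i

namespace PolyModule

variable {V : Type*} [AddCommGroup V] [Module ℂ V] (R : PolyModule m n V)

/-- The weight space of a weight with natural number coordinates. -/
def natWt (ν : Idx m n → ℕ) : Submodule ℂ V := weightSpace R.E fun i => (ν i : ℂ)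

theorem comm_diag (i j k : Idx m n) :
    R.E i i * R.E j k - R.E j k * R.E i i =
      (if i = j then R.E j k else 0) - (if k = i then R.E j k else 0) := by
  have h := R.bracket i i j k
  have hs : sgn i i j k = 1 := by
    rw [sgn, ← two_mul, mul_assoc, pow_mul]; simp
  rw [hs, one_smul, one_smul] at h
  rw [h]
  congr 1
  · split_ifs with h1
    · rw [h1]
    · rfl
  · split_ifs with h1
    · rw [h1]
    · rfl

theorem commute_diag (i j : Idx m n) : Commute (R.E i i) (R.E j j) := by
  have h := R.comm_diag i j j
  rw [Commute, SemiconjBy, ← sub_eq_zero, h]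
  by_cases hij : i = j
  · simp [hij]
  · simp [hij, Ne.symm hij]

theorem isInternal : DirectSum.IsInternal R.natWt := by
  refine DirectSum.isInternal_submodule_of_iSupIndep_of_iSup_eq_top ?_ ?_
  · refine (iSupIndep_weightSpace R.commute_diag).comp
      (f := fun (ν : Idx m n → ℕ) i => (ν i : ℂ)) fun ν ν' h => ?_
    funext i
    have := congrFun h i
    simpa using this
  · rw [eq_top_iff, ← R.semisimple]
    refine iSup_le fun μ => ?_
    by_cases h : weightSpace R.E μ = ⊥
    · rw [h]; exact bot_le
    · obtain ⟨ν, hν⟩ := R.weights μ h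
      have : μ = fun i => (ν i : ℂ) := funext hν
      rw [this]
      exact le_iSup R.natWt ν

theorem bijective : Function.Bijective (DirectSum.coeLinearMap R.natWt) := R.isInternal

/-- The parity operator `v ↦ (-1)^{|v|} v` of the natural `ℤ/2`-grading: a vector of weight `ν`
has parity the sum of the coordinates of `ν` at the odd indices. -/
def parity : Module.End ℂ V :=
  DirectSum.coeLinearMap R.natWt ∘ₗ
    DirectSum.lmap (fun ν => ((-1 : ℂ) ^ (∑ j : Fin n, ν (Sum.inr j))) • LinearMap.id) ∘ₗ
    (LinearEquiv.ofBijective (DirectSum.coeLinearMap R.natWt) R.bijective).symm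

theorem parity_apply {ν : Idx m n → ℕ} {v : V} (hv : v ∈ R.natWt ν) :
    R.parity v = ((-1 : ℂ) ^ (∑ j : Fin n, ν (Sum.inr j))) • v := by
  have : (LinearEquiv.ofBijective (DirectSum.coeLinearMap R.natWt) R.bijective).symm v =
      DirectSum.lof ℂ _ (fun ν => R.natWt ν) ν ⟨v, hv⟩ := by
    rw [LinearEquiv.symm_apply_eq]
    simp
  simp only [parity, LinearMap.comp_apply, LinearEquiv.coe_coe]
  rw [this]
  simp

theorem ext_natWt {f g : Module.End ℂ V} (h : ∀ ν, ∀ v ∈ R.natWt ν, f v = g v) : f = g := by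
  have htop : ⨆ ν, R.natWt ν = ⊤ := R.isInternal.submodule_iSup_eq_top
  ext v
  have hv : v ∈ ⨆ ν, R.natWt ν := by rw [htop]; trivial
  induction hv using Submodule.iSup_induction' with
  | mem ν v hv => exact h ν v hv
  | zero => simp
  | add x y _ _ hx hy => rw [map_add, map_add, hx, hy]

theorem parity_sq : R.parity * R.parity = 1 := by
  refine R.ext_natWt fun ν v hv => ?_
  rw [Module.End.mul_apply, R.parity_apply hv, map_smul, R.parity_apply hv, smul_smul, ← mul_pow]
  simp

theorem parity_comm (i j : Idx m n) :
    R.parity * R.E i j = ((-1 : ℂ) ^ (par i + par j)) • (R.E i j * R.parity) := by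
  refine R.ext_natWt fun ν v hv => ?_
  rw [LinearMap.smul_apply, Module.End.mul_apply, Module.End.mul_apply, R.parity_apply hv,
    map_smul, smul_smul]
  by_cases h0 : R.E i j v = 0
  · simp [h0]
  have hw : R.E i j v ∈ weightSpace R.E fun k => (ν k : ℂ) + (if k = i then 1 else 0)
      - (if j = k then 1 else 0) := by
    rw [mem_weightSpace]
    intro k
    have h1 := LinearMap.congr_fun (R.comm_diag k i j) v
    have h2 := mem_weightSpace.1 hv k
    simp only [LinearMap.sub_apply, Module.End.mul_apply, h2, map_smul] at h1
    rw [sub_eq_iff_eq_add] at h1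
    rw [h1, sub_smul, add_smul]
    split_ifs <;> simp <;> abel
  obtain ⟨ν', hν'⟩ := R.weights _ fun hb => h0 (by rw [hb] at hw; simpa using hw)
  have hw' : R.E i j v ∈ R.natWt ν' := by
    rw [natWt, ← funext hν']; exact hw
  rw [R.parity_apply hw']
  congr 1
  have hsum : ((∑ k : Fin n, ν' (Sum.inr k) : ℕ) : ℂ) + par j
      = ((∑ k : Fin n, ν (Sum.inr k) : ℕ) : ℂ) + par i := by
    push_cast
    simp only [← hν', Finset.sum_sub_distrib, Finset.sum_add_distrib]
    rcases i with i | i <;> rcases j with j | j <;> simp [par]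
  have hsum' : (∑ k : Fin n, ν' (Sum.inr k)) + par j = (∑ k : Fin n, ν (Sum.inr k)) + par i := by
    exact_mod_cast hsum
  have h2 : ((-1 : ℂ) ^ par j) * (-1) ^ par j = 1 := by rw [← mul_pow]; simp
  calc ((-1 : ℂ) ^ (∑ k : Fin n, ν' (Sum.inr k)))
      = (-1) ^ ((∑ k : Fin n, ν' (Sum.inr k)) + par j) * (-1) ^ par j := by
        rw [pow_add, mul_assoc, h2, mul_one]
    _ = _ := by rw [hsum']; ring

theorem parity_pow_comm (i j : Idx m n) (q : ℕ) :
    R.parity ^ q * R.E i j = ((-1 : ℂ) ^ ((par i + par j) * q)) • (R.E i j * R.parity ^ q) := by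
  induction q with
  | zero => simp
  | succ q ih =>
    rw [pow_succ, mul_assoc, parity_comm, mul_smul_comm, ← mul_assoc, ih, smul_mul_assoc, smul_smul,
      mul_assoc, ← pow_add]
    congr 2
    ring

theorem parity_pow_add_two (q r : ℕ) : R.parity ^ (q + 2 * r) = R.parity ^ q := by
  rw [pow_add, pow_mul, pow_two, parity_sq, one_pow, mul_one]

end PolyModule

section Tensor

variable {ℓ : ℕ} {M : Fin ℓ → Type*} [∀ a, AddCommGroup (M a)] [∀ a, Module ℂ (M a)]

open TensorProduct

/-- `P^q ⊗ ⋯ ⊗ P^q ⊗ X ⊗ 1 ⊗ ⋯ ⊗ 1` with `X` in position `a` and `P` the parity operators. -/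
def siteOp (R : ∀ a, PolyModule m n (M a)) (q : ℕ) (a : Fin ℓ) (X : Module.End ℂ (M a)) :
    Module.End ℂ (⨂[ℂ] a, M a) :=
  PiTensorProduct.map
    (Function.update (fun b => if b < a then (R b).parity ^ q else 1) a X)

/-- The operator of `E_ij^{(a)}` on the tensor product, with the usual sign rule:
`v₁ ⊗ ⋯ ⊗ v_ℓ ↦ (-1)^{|E_ij| (|v₁| + ⋯ + |v_{a-1}|)} v₁ ⊗ ⋯ ⊗ E_ij v_a ⊗ ⋯ ⊗ v_ℓ`. -/
def tensorE (R : ∀ a, PolyModule m n (M a)) (a : Fin ℓ) (i j : Idx m n) :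
    Module.End ℂ (⨂[ℂ] a, M a) :=
  siteOp R (par i + par j) a ((R a).E i j)

variable (R : ∀ a, PolyModule m n (M a))

theorem siteOp_add (q : ℕ) (a : Fin ℓ) (X Y : Module.End ℂ (M a)) :
    siteOp R q a (X + Y) = siteOp R q a X + siteOp R q a Y :=
  PiTensorProduct.map_update_add ..

theorem siteOp_smul (q : ℕ) (a : Fin ℓ) (c : ℂ) (X : Module.End ℂ (M a)) :
    siteOp R q a (c • X) = c • siteOp R q a X :=
  PiTensorProduct.map_update_smul ..

theorem siteOp_zero (q : ℕ) (a : Fin ℓ) : siteOp R q a 0 = 0 := by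
  simpa using siteOp_smul R q a 0 0

theorem siteOp_sub (q : ℕ) (a : Fin ℓ) (X Y : Module.End ℂ (M a)) :
    siteOp R q a (X - Y) = siteOp R q a X - siteOp R q a Y := by
  rw [eq_sub_iff_add_eq, ← siteOp_add, sub_add_cancel]

theorem siteOp_mul (q r : ℕ) (a : Fin ℓ) (X Y : Module.End ℂ (M a)) :
    siteOp R q a X * siteOp R r a Y = siteOp R (q + r) a (X * Y) := by
  rw [siteOp, siteOp, siteOp, ← PiTensorProduct.map_mul]
  congr 1
  funext b
  by_cases h : b = a
  · subst h; simp
  · by_cases hb : b < a <;> simp [h, hb, pow_add]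

theorem siteOp_parity (q r : ℕ) (a : Fin ℓ) (X : Module.End ℂ (M a)) :
    siteOp R (q + 2 * r) a X = siteOp R q a X := by
  simp only [siteOp, PolyModule.parity_pow_add_two]

theorem tensorE_same (a : Fin ℓ) (i j k l : Idx m n) :
    tensorE R a i j * tensorE R a k l - sgn i j k l • (tensorE R a k l * tensorE R a i j) =
      (if j = k then tensorE R a i l else 0)
        - sgn i j k l • (if l = i then tensorE R a k j else 0) := by
  simp only [tensorE, siteOp_mul]
  rw [add_comm (par k + par l), ← siteOp_smul, ← siteOp_sub, (R a).bracket, siteOp_sub, siteOp_smul]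
  congr 1
  · split_ifs with h
    · rw [h, show par i + par k + (par k + par l) = par i + par l + 2 * par k by ring,
        siteOp_parity]
    · exact siteOp_zero ..
  · congr 1
    split_ifs with h
    · rw [h, show par i + par j + (par k + par i) = par k + par j + 2 * par i by ring,
        siteOp_parity]
    · exact siteOp_zero ..

theorem tensorE_lt (a b : Fin ℓ) (hab : a < b) (i j k l : Idx m n) :
    tensorE R b k l * tensorE R a i j = sgn i j k l • (tensorE R a i j * tensorE R b k l) := by
  rw [tensorE, tensorE, siteOp, siteOp, ← PiTensorProduct.map_mul, ← PiTensorProduct.map_mul]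
  have h1 : (fun c => Function.update (fun c => if c < b then (R c).parity ^ (par k + par l) else 1)
        b ((R b).E k l) c *
      Function.update (fun c => if c < a then (R c).parity ^ (par i + par j) else 1)
        a ((R a).E i j) c) =
      Function.update (Function.update
      (fun c => if c < a then (R c).parity ^ (par i + par j + (par k + par l)) else
        if c < b then (R c).parity ^ (par k + par l) else 1) b ((R b).E k l)) a
        ((R a).parity ^ (par k + par l) * (R a).E i j) := by
    funext c
    by_cases hca : c = a
    · subst hca
      simp [hab.ne, hab]
    · by_cases hcb : c = b
      · subst hcb
        simp [hca, hab.not_gt]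
      · by_cases h : c < a
        · have : c < b := h.trans hab
          simp [hca, hcb, h, this, ← pow_add, add_comm]
        · simp [hca, hcb, h]
  have h2 : (fun c => Function.update (fun c => if c < a then (R c).parity ^ (par i + par j) else 1)
        a ((R a).E i j) c *
      Function.update (fun c => if c < b then (R c).parity ^ (par k + par l) else 1)
        b ((R b).E k l) c) =
      Function.update (Function.update
      (fun c => if c < a then (R c).parity ^ (par i + par j + (par k + par l)) else
        if c < b then (R c).parity ^ (par k + par l) else 1) b ((R b).E k l)) a
        ((R a).E i j * (R a).parity ^ (par k + par l)) := by
    funext c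
    by_cases hca : c = a
    · subst hca
      simp [hab.ne, hab]
    · by_cases hcb : c = b
      · subst hcb
        simp [hca, hab.not_gt]
      · by_cases h : c < a
        · have : c < b := h.trans hab
          simp [hca, hcb, h, this, ← pow_add]
        · simp [hca, hcb, h]
  rw [h1, h2, (R a).parity_pow_comm, PiTensorProduct.map_update_smul]
  rfl

theorem tensorE_diff (a b : Fin ℓ) (hab : a ≠ b) (i j k l : Idx m n) :
    tensorE R a i j * tensorE R b k l = sgn i j k l • (tensorE R b k l * tensorE R a i j) := by
  rcases lt_or_gt_of_ne hab with h | h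
  · rw [tensorE_lt R a b h, smul_smul, sgn_mul_self, one_smul]
  · rw [tensorE_lt R b a h, sgn_comm]

end Tensor

end Super
section Envelope

variable (m n ℓ : ℕ)

/-- The defining relations of the `ℓ`-fold tensor power `U(gl_{m|n})^{⊗ℓ}` of superalgebras, in
the generators `E_ij^{(a)} = 1 ⊗ ⋯ ⊗ E_ij ⊗ ⋯ ⊗ 1`: the relations of `U(gl_{m|n})` in each tensor
factor, and supercommutativity of distinct tensor factors. -/
inductive EnvRel : FreeAlgebra ℂ (Fin ℓ × Idx m n × Idx m n) →
    FreeAlgebra ℂ (Fin ℓ × Idx m n × Idx m n) → Prop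
  | same (a : Fin ℓ) (i j k l : Idx m n) : EnvRel
      (FreeAlgebra.ι ℂ (a, i, j) * FreeAlgebra.ι ℂ (a, k, l)
        - sgn i j k l • (FreeAlgebra.ι ℂ (a, k, l) * FreeAlgebra.ι ℂ (a, i, j)))
      ((if j = k then FreeAlgebra.ι ℂ (a, i, l) else 0)
        - sgn i j k l • (if l = i then FreeAlgebra.ι ℂ (a, k, j) else 0))
  | diff (a b : Fin ℓ) (hab : a ≠ b) (i j k l : Idx m n) : EnvRel
      (FreeAlgebra.ι ℂ (a, i, j) * FreeAlgebra.ι ℂ (b, k, l))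
      (sgn i j k l • (FreeAlgebra.ι ℂ (b, k, l) * FreeAlgebra.ι ℂ (a, i, j)))

/-- The superalgebra `U(gl_{m|n})^{⊗ℓ}`. -/
def Env : Type := RingQuot (EnvRel m n ℓ)

instance : Ring (Env m n ℓ) := inferInstanceAs (Ring (RingQuot (EnvRel m n ℓ)))

instance : Algebra ℂ (Env m n ℓ) := inferInstanceAs (Algebra ℂ (RingQuot (EnvRel m n ℓ)))

variable {m n ℓ}

/-- The generator `E_ij^{(a)}`. -/
def Env.gen (a : Fin ℓ) (i j : Idx m n) : Env m n ℓ :=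
  RingQuot.mkAlgHom ℂ (EnvRel m n ℓ) (FreeAlgebra.ι ℂ (a, i, j))

theorem Env.gen_same (a : Fin ℓ) (i j k l : Idx m n) :
    Env.gen a i j * Env.gen a k l - sgn i j k l • (Env.gen a k l * Env.gen a i j) =
      (if j = k then Env.gen a i l else 0) - sgn i j k l • (if l = i then Env.gen a k j else 0) := by
  have h := RingQuot.mkAlgHom_rel ℂ (EnvRel.same (ℓ := ℓ) a i j k l)
  simp only [map_sub, map_mul, map_smul, apply_ite (RingQuot.mkAlgHom ℂ (EnvRel m n ℓ)),
    map_zero] at h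
  exact h

theorem Env.gen_diff (a b : Fin ℓ) (hab : a ≠ b) (i j k l : Idx m n) :
    Env.gen a i j * Env.gen b k l = sgn i j k l • (Env.gen b k l * Env.gen a i j) := by
  have h := RingQuot.mkAlgHom_rel ℂ (EnvRel.diff a b hab i j k l)
  simp only [map_mul, map_smul] at h
  exact h

/-- The homomorphism given by a family that satisfies the defining relations. -/
def Env.lift {B : Type*} [Ring B] [Algebra ℂ B] (f : Fin ℓ → Idx m n → Idx m n → B)
    (h₁ : ∀ a i j k l, f a i j * f a k l - sgn i j k l • (f a k l * f a i j) =
      (if j = k then f a i l else 0) - sgn i j k l • (if l = i then f a k j else 0))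
    (h₂ : ∀ a b, a ≠ b → ∀ i j k l, f a i j * f b k l = sgn i j k l • (f b k l * f a i j)) :
    Env m n ℓ →ₐ[ℂ] B :=
  RingQuot.liftAlgHom ℂ ⟨FreeAlgebra.lift ℂ fun x => f x.1 x.2.1 x.2.2, by
    intro x y hxy
    cases hxy with
    | same a i j k l =>
      have h := h₁ a i j k l
      simp only [map_sub, map_mul, map_smul, FreeAlgebra.lift_ι_apply,
        apply_ite (FreeAlgebra.lift ℂ fun x : Fin ℓ × Idx m n × Idx m n => f x.1 x.2.1 x.2.2),
        map_zero]
      exact h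
    | diff a b hab i j k l =>
      have h := h₂ a b hab i j k l
      simpa only [map_mul, map_smul, FreeAlgebra.lift_ι_apply] using h⟩

theorem Env.lift_gen {B : Type*} [Ring B] [Algebra ℂ B] (f : Fin ℓ → Idx m n → Idx m n → B)
    (h₁ h₂) (a : Fin ℓ) (i j : Idx m n) : Env.lift f h₁ h₂ (Env.gen a i j) = f a i j := by
  refine (RingQuot.liftAlgHom_mkAlgHom_apply ℂ _ _ _).trans ?_
  rw [FreeAlgebra.lift_ι_apply]

/-- The action of `U(gl_{m|n})^{⊗ℓ}` on a tensor product of polynomial modules. -/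
def tensorAct {M : Fin ℓ → Type*} [∀ a, AddCommGroup (M a)] [∀ a, Module ℂ (M a)]
    (R : ∀ a, PolyModule m n (M a)) :
    Env m n ℓ →ₐ[ℂ] Module.End ℂ (PiTensorProduct ℂ M) :=
  Env.lift (tensorE R) (tensorE_same R) (tensorE_diff R)

/-- The action of the matrix units of `gl_{m|n}` on a tensor product of polynomial modules. -/
def totalE {M : Fin ℓ → Type*} [∀ a, AddCommGroup (M a)] [∀ a, Module ℂ (M a)]
    (R : ∀ a, PolyModule m n (M a)) (i j : Idx m n) : Module.End ℂ (PiTensorProduct ℂ M) :=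
  ∑ a, tensorE R a i j

theorem totalE_commute {M : Fin ℓ → Type*} [∀ a, AddCommGroup (M a)] [∀ a, Module ℂ (M a)]
    (R : ∀ a, PolyModule m n (M a)) (i j : Idx m n) :
    Commute (totalE R i i) (totalE R j j) := by
  have hs : sgn i i j j = 1 := by
    rw [sgn, ← two_mul, mul_assoc, pow_mul]; simp
  refine Commute.sum_left _ _ _ fun a _ => Commute.sum_right _ _ _ fun b _ => ?_
  rw [Commute, SemiconjBy]
  by_cases hab : a = b
  · subst hab
    have h := tensorE_same R a i i j j
    rw [hs, one_smul, one_smul] at h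
    rw [← sub_eq_zero, h]
    by_cases hij : i = j
    · simp [hij]
    · simp [hij, Ne.symm hij]
  · rw [tensorE_diff R a b hab, hs, one_smul]

/-- The inclusion `I_{p|k} ⊆ I_{m|n}`. -/
def emb {p k : ℕ} (hp : p ≤ m) (hk : k ≤ n) : Idx p k → Idx m n :=
  Sum.map (Fin.castLE hp) (Fin.castLE hk)

theorem par_emb {p k : ℕ} (hp : p ≤ m) (hk : k ≤ n) (i : Idx p k) : par (emb hp hk i) = par i := by
  rcases i with i | i <;> rfl

theorem emb_injective {p k : ℕ} (hp : p ≤ m) (hk : k ≤ n) : Function.Injective (emb hp hk) :=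
  Function.Injective.sumMap (Fin.castLE_injective hp) (Fin.castLE_injective hk)

/-- The homomorphism `U(gl_{p|k})^{⊗ℓ} → U(gl_{m|n})^{⊗ℓ}` induced by `gl_{p|k} ⊆ gl_{m|n}`. -/
def envIncl (ℓ : ℕ) {p k : ℕ} (hp : p ≤ m) (hk : k ≤ n) : Env p k ℓ →ₐ[ℂ] Env m n ℓ :=
  Env.lift (fun a i j => Env.gen a (emb hp hk i) (emb hp hk j))
    (fun a i j k l => by
      have h := Env.gen_same a (emb hp hk i) (emb hp hk j) (emb hp hk k) (emb hp hk l)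
      simpa only [sgn, par_emb, (emb_injective hp hk).eq_iff] using h)
    (fun a b hab i j k l => by
      have h := Env.gen_diff a b hab (emb hp hk i) (emb hp hk j) (emb hp hk k) (emb hp hk l)
      simpa only [sgn, par_emb] using h)

end Envelope

section Berezinian

variable {B : Type*} [Ring B] {N : ℕ}

/-- The leading principal submatrix on the first `i + 1` rows and columns. -/
def lead (A : Matrix (Fin N) (Fin N) B) (i : Fin N) :
    Matrix (Fin (i + 1)) (Fin (i + 1)) B :=
  A.submatrix (Fin.castLE i.isLt) (Fin.castLE i.isLt)

/-- Every principal quasiminor of `A` is well defined. -/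
def SufficientlyInvertible (A : Matrix (Fin N) (Fin N) B) : Prop :=
  ∀ i, IsUnit (lead A i) ∧ IsUnit (Ring.inverse (lead A i) (Fin.last i) (Fin.last i))

/-- The principal quasiminor `d_i(A)`: the inverse of the last diagonal entry of the inverse of the
leading principal submatrix. -/
def quasiminor (A : Matrix (Fin N) (Fin N) B) (i : Fin N) : B :=
  Ring.inverse (Ring.inverse (lead A i) (Fin.last i) (Fin.last i))

/-- The Berezinian of type `s`: the ordered product of the `d_i(A)^{(-1)^{s_i}}`. -/
def Ber (s : Fin N → ℕ) (A : Matrix (Fin N) (Fin N) B) : B :=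
  (List.ofFn fun i =>
    if s i = 0 then quasiminor A i else Ring.inverse (quasiminor A i)).prod

end Berezinian

section Gaudin

variable {m n ℓ : ℕ}

/-- The bijection from positions to `I_{m|n}`. -/
def idx (r : Fin (m + n)) : Idx m n := finSumFinEquiv.symm r

/-- The position of an element of `I_{m|n}` in the standard order. -/
def pos (i : Idx m n) : Fin (m + n) := finSumFinEquiv i

/-- The sequence `(0^m, 1^n)`. -/
def stdType (m n : ℕ) (r : Fin (m + n)) : ℕ := par (idx r : Idx m n)

/-- The expansion `∑_{s ≥ 0} c^s a z^{-s-1}` at infinity of `a / (z - c)`. -/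
def pole {A : Type*} [Ring A] [Algebra ℂ A] (a : A) (c : ℂ) : PDO A :=
  show HahnSeries (ℤ × ℤ) A from
  { coeff := fun x => if 1 ≤ x.1 ∧ x.2 = 0 then c ^ (x.1 - 1).toNat • a else 0
    isPWO_support' := by
      rw [isPWO_iff]
      refine ⟨1, 0, fun x hx => ?_⟩
      by_contra h
      exact hx (if_neg fun h' => h ⟨h'.1, h'.2.ge⟩) }

/-- `E_ij(z) = ∑_a E_ij^{(a)} / (z - z_a)`. -/
def current (z : Fin ℓ → ℂ) (i j : Idx m n) : PDO (Env m n ℓ) :=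
  ∑ a, pole (Env.gen a i j) (z a)

/-- The matrix `L_{m|n}(z)`, with entries `δ_ij ∂ - (-1)^{|i|} E_ij(z)`. -/
def gaudinL (m n : ℕ) (z : Fin ℓ → ℂ) :
    Matrix (Fin (m + n)) (Fin (m + n)) (PDO (Env m n ℓ)) :=
  Matrix.of fun r s => (if r = s then PDO.dpow (Env m n ℓ) 1 else 0)
    - (-1) ^ par (idx r : Idx m n) * current z (idx r) (idx s)

/-- The matrix `1 + u L_{m|n}(z)` over the power series in `u`. -/
def gaudinLu (m n : ℕ) (z : Fin ℓ → ℂ) :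
    Matrix (Fin (m + n)) (Fin (m + n)) (PowerSeries (PDO (Env m n ℓ))) :=
  Matrix.of fun r s => (if r = s then 1 else 0)
    + PowerSeries.X * PowerSeries.C (gaudinL m n z r s)

/-- `Ber (L_{m|n}(z))`. -/
def gaudinBer (m n : ℕ) (z : Fin ℓ → ℂ) : PDO (Env m n ℓ) :=
  Ber (stdType m n) (gaudinL m n z)

/-- The coefficient of `u^i z^s ∂^{i-j}` in `Ber (1 + u L_{m|n}(z))`, i.e. the coefficient of `z^s`
in the Gaudin Hamiltonian `b_ij(z)`. -/
def hamiltonian (m n : ℕ) (z : Fin ℓ → ℂ) (i j : ℕ) (s : ℤ) : Env m n ℓ :=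
  (PowerSeries.coeff i (Ber (stdType m n) (gaudinLu m n z))).coeff s ((i : ℤ) - j)

/-- The Gaudin algebra of `gl_{m|n}`. -/
def gaudinAlgebra (m n : ℕ) (z : Fin ℓ → ℂ) : Subalgebra ℂ (Env m n ℓ) :=
  Algebra.adjoin ℂ {x | ∃ (i j : ℕ) (s : ℤ), j ≤ i ∧ x = hamiltonian m n z i j s}

end Gaudin

section OnModules

variable {A V : Type*} [Ring A] [Algebra ℂ A] [AddCommGroup V] [Module ℂ V]

/-- The action `f(v) = ∑ a_ij(v) z^i ∂^j` of `f = ∑ a_ij z^i ∂^j`; the result lies in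
`V((z⁻¹, ∂⁻¹))`, with the coefficient of `z^i ∂^j` placed at `(-i, -j)`. -/
def PDO.apply (ρ : A →ₐ[ℂ] Module.End ℂ V) (f : PDO A) (v : V) : HahnSeries (ℤ × ℤ) V where
  coeff x := ρ (f.coeff (-x.1) (-x.2)) v
  isPWO_support' := (HahnSeries.isPWO_support (Γ := ℤ × ℤ) (R := A) f).mono fun x hx h => hx (by
    simp only [PDO.coeff, neg_neg]
    rw [h, map_zero, LinearMap.zero_apply])

/-- `N` is stable under the action of the subalgebra `B`. -/
def IsStable (ρ : A →ₐ[ℂ] Module.End ℂ V) (B : Subalgebra ℂ A) (N : Submodule ℂ V) : Prop :=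
  ∀ b ∈ B, ∀ v ∈ N, ρ b v ∈ N

/-- The image of the subalgebra `B` in `End(N)`, for a `B`-stable subspace `N`. -/
def imageOn (ρ : A →ₐ[ℂ] Module.End ℂ V) (B : Subalgebra ℂ A) (N : Submodule ℂ V) :
    Subalgebra ℂ (Module.End ℂ N) where
  carrier := {f | ∃ b ∈ B, ∀ v : N, (f v : V) = ρ b v}
  mul_mem' := by
    rintro f g ⟨b, hb, hf⟩ ⟨c, hc, hg⟩
    exact ⟨b * c, B.mul_mem hb hc, fun v => by
      rw [Module.End.mul_apply, hf, hg, map_mul, Module.End.mul_apply]⟩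
  add_mem' := by
    rintro f g ⟨b, hb, hf⟩ ⟨c, hc, hg⟩
    exact ⟨b + c, B.add_mem hb hc, fun v => by
      rw [LinearMap.add_apply, Submodule.coe_add, hf, hg, map_add, LinearMap.add_apply]⟩
  algebraMap_mem' := fun c => ⟨algebraMap ℂ A c, B.algebraMap_mem c, fun v => by
    rw [AlgHom.commutes, Module.algebraMap_end_apply, Module.algebraMap_end_apply,
      Submodule.coe_smul]⟩

variable {m n : ℕ}

/-- The `σ`-singular space: the vectors killed by all `E_ij` with `i <_σ j`, where `i <_σ j` means
that `σ` maps the position of `i` below the position of `j`. -/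
def singSpace (E : Idx m n → Idx m n → Module.End ℂ V) (σ : Equiv.Perm (Fin (m + n))) :
    Submodule ℂ V :=
  ⨅ (i : Idx m n) (j : Idx m n) (_ : σ (pos i) < σ (pos j)), LinearMap.ker (E i j)

/-- The vectors of weight `μ` in the `σ`-singular space. -/
def singWt (E : Idx m n → Idx m n → Module.End ℂ V) (σ : Equiv.Perm (Fin (m + n)))
    (μ : Idx m n → ℂ) : Submodule ℂ V :=
  weightSpace E μ ⊓ singSpace E σ

/-- `μ` is a `σ`-singular weight. -/
def IsSingularWeight (E : Idx m n → Idx m n → Module.End ℂ V) (σ : Equiv.Perm (Fin (m + n)))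
    (μ : Idx m n → ℂ) : Prop :=
  singWt E σ μ ≠ ⊥

/-- The sum of the spaces of `σ`-singular vectors of weight `μ`, over the `σ`-singular weights `μ`
with the property `S`. (The sum is direct, see `iSupIndep_singWt`.) -/
def singSum (E : Idx m n → Idx m n → Module.End ℂ V) (σ : Equiv.Perm (Fin (m + n)))
    (S : (Idx m n → ℂ) → Prop) : Submodule ℂ V :=
  ⨆ (μ : Idx m n → ℂ) (_ : IsSingularWeight E σ μ ∧ S μ), singWt E σ μ

theorem iSupIndep_singWt {ℓ : ℕ} {M : Fin ℓ → Type*} [∀ a, AddCommGroup (M a)]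
    [∀ a, Module ℂ (M a)] (R : ∀ a, PolyModule m n (M a)) (σ : Equiv.Perm (Fin (m + n))) :
    iSupIndep (singWt (totalE R) σ) :=
  (iSupIndep_weightSpace (totalE_commute R)).mono fun _ => inf_le_left

/-- The operators of the matrix units of `gl_{p|k} ⊆ gl_{m|n}`. -/
def restrictE (E : Idx m n → Idx m n → Module.End ℂ V) {p k : ℕ} (hp : p ≤ m) (hk : k ≤ n) :
    Idx p k → Idx p k → Module.End ℂ V :=
  fun i j => E (emb hp hk i) (emb hp hk j)

/-- The truncation: the sum of the weight spaces with weights in the `ℤ_{≥0}`-span of the `ε_i`,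
`i ∈ I_{p|k}`. -/
def truncation (E : Idx m n → Idx m n → Module.End ℂ V) {p k : ℕ} (hp : p ≤ m) (hk : k ≤ n) :
    Submodule ℂ V :=
  ⨆ ν : Idx p k → ℕ, weightSpace E (Function.extend (emb hp hk) (fun i => (ν i : ℂ)) 0)

/-- The `gl_{p|k}`-singular vectors in the truncation, of `gl_{p|k}`-weight `η`. -/
def truncSingWt (E : Idx m n → Idx m n → Module.End ℂ V) {p k : ℕ} (hp : p ≤ m) (hk : k ≤ n)
    (η : Idx p k → ℂ) : Submodule ℂ V :=
  truncation E hp hk ⊓ singWt (restrictE E hp hk) 1 η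

end OnModules

/-- The permutation that moves the positions `p + 1, …, m` behind the positions
`m + 1, …, m + n`. -/
def sigmaP {m : ℕ} (n : ℕ) {p : ℕ} (hp : p ≤ m) : Equiv.Perm (Fin (m + n)) where
  toFun r := ⟨if r < p then r else if (r : ℕ) < m then r + n else r - (m - p), by
    have := r.isLt; split_ifs <;> omega⟩
  invFun r := ⟨if r < p then r else if (r : ℕ) < p + n then r + (m - p) else r - n, by
    have := r.isLt; split_ifs <;> omega⟩
  left_inv r := by
    have := r.isLt
    ext
    simp only
    split_ifs <;> omega
  right_inv r := by
    have := r.isLt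
    ext
    simp only
    split_ifs <;> omega

/-- The weight `∑_{i ≤ p} λ_i ε_i + ∑_{j ≤ n} ⟨λ'_j - p⟩ ε_{j-1/2} + ∑_{p < i ≤ m} ⟨λ_i - n⟩ ε_i`,
where `λ'` is the conjugate partition and `⟨r⟩ = max(r, 0)` (truncated subtraction below). -/
def sigmaWeight (m n p : ℕ) (lam : YoungDiagram) : Idx m n → ℂ
  | Sum.inl i => if (i : ℕ) < p then (lam.rowLen i : ℂ) else ((lam.rowLen i - n : ℕ) : ℂ)
  | Sum.inr j => ((lam.colLen j - p : ℕ) : ℂ)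

/-- `μ(E_ii) = 0` for `i = p + 1, …, m`. -/
def VanishesAfter {m n : ℕ} (p : ℕ) (μ : Idx m n → ℂ) : Prop :=
  ∀ i : Fin m, p ≤ (i : ℕ) → μ (Sum.inl i) = 0

/-- `μ(E_{k+1/2,k+1/2}) = 0`; no condition if `k = n`, when there is no such index. -/
def VanishesAtOdd {m n : ℕ} (k : ℕ) (μ : Idx m n → ℂ) : Prop :=
  ∀ h : k < n, μ (Sum.inr ⟨k, h⟩) = 0

/-- `λ` is a `(p|n)`-hook partition: `λ_{p+1} ≤ n`. -/
def IsHook (p n : ℕ) (lam : YoungDiagram) : Prop := lam.rowLen p ≤ n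

end Gaudin

end

open Gaudin

/-!
The Berezinian of an invertible matrix is the ordered product of the pivots of Gauss elimination
(`ber_eq_berList`), the pivots at odd indices being inverted. The matrices `L ∂⁻¹`
and `1 + u L` are congruent to the identity modulo a subring without unit in which geometric series
converge; the Schur complements keep this property (`NearScalar.schur`), so all pivots are
invertible.

The matrices `L` and `1 + u L` satisfy the Manin relations (`LaxData.isManin`,
`isManin_laxMatrixU`), and so do their Schur complements (`IsManin.schurComplement`). For a Manin
matrix an even and an odd index that are adjacent in the order of elimination may be exchanged
without changing the product of pivots (`berList_swap`). Hence the indices outside `I_{p|k}` can be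
eliminated last (`berList_inner_append_outer`), and the first factors of the product then form the
Berezinian for `gl_{p|k}`. Modulo the left ideal generated by the elements `E_ij^{(a)}` with `j`
outside `I_{p|k}`, the remaining columns are those of `∂`, respectively `1 + u ∂`, and contribute
`∂^r` or `(1 + u ∂)^r` with `r = (m - p) - (n - k)` (`gaudinBer_sub_mem`, `ber_gaudinLu_sub_mem`).
Because `1 + u ∂` is invertible, the coefficients of each of the two Berezinians of `1 + u L` are
linear combinations of those of the other one modulo the left ideal (`hamiltonian_relation`).

This left ideal annihilates the vectors whose weight vanishes outside `I_{p|k}`: the weights of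
the tensor factors are nonnegative, so such a vector has weight zero at `j` in each factor, and
`E_ij^{(a)}` would make the weight negative (`tensorE_apply_eq_zero`). In particular all the raising
operators that do not belong to `gl_{p|k}` act by zero, which identifies the two spaces of singular
vectors (`truncSingWt_eq`). The coefficients of the Berezinian commute with the diagonal matrix
units and with the raising operators (`hamiltonian_commute_weight`, `hamiltonian_commute_raising`);
for a raising operator of two adjacent indices this is again a computation with the Manin relations
(`berList_commute_of_root`). So the algebra of `gl_{p|k}` preserves the space of singular vectors,
and together with the relations between the generators this gives stability under both algebras and
the equality of their images (`isStable_and_imageOn_eq`).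

The weights in question come from partitions for two reasons: a singular weight is dominant for
each `sl_2` of even root (`exists_nat_of_raising`), and applying successively the odd lowering
operators from the index `p` to a singular vector gives a nonzero vector as long as the weights at
the odd indices are positive, which bounds their number by the weight at `p` (`exists_chain`). The
first `p` rows and the lengths of the columns below them then fit together to a partition
(`exists_hook`).
-/

noncomputable section
namespace Gaudin

/-! ### Schur complements and Manin matrices -/

section Elimination

variable {B : Type*} [Ring B] {I : Type*}

/-- The Schur complement of `M` with respect to the diagonal entry at `a`. It is kept as a
matrix on all of `I`; if `M a a` is a unit, the row and the column of `a` become zero. -/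
def schur (M : Matrix I I B) (a : I) : Matrix I I B :=
  fun i j => M i j - M i a * Ring.inverse (M a a) * M a j

/-- The Manin relations for the parities `s`:
`[M_ij, M_kl] = (-1)^{|i||j| + |i||k| + |j||k|} [M_kj, M_il]` with supercommutators, where `M_ij`
has parity `|i| + |j|`. -/
def IsManin (s : I → ℕ) (M : Matrix I I B) : Prop :=
  ∀ i j k l, M i j * M k l - (-1) ^ ((s i + s j) * (s k + s l)) * (M k l * M i j) =
    (-1) ^ (s i * s j + s i * s k + s j * s k) *
      (M k j * M i l - (-1) ^ ((s k + s j) * (s i + s l)) * (M i l * M k j))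

theorem inv_mul_of_isUnit {a : B} (h : IsUnit a) : Ring.inverse a * a = 1 :=
  Ring.inverse_mul_cancel a h

theorem mul_inv_of_isUnit {a : B} (h : IsUnit a) : a * Ring.inverse a = 1 :=
  Ring.mul_inverse_cancel a h

theorem ring_inverse_eq {a b : B} (h1 : a * b = 1) (h2 : b * a = 1) : Ring.inverse a = b :=
  Ring.inverse_unit ⟨a, b, h1, h2⟩

/-- The relation between `M_ij`, `M_kj` and the normalized entries `M_ic M_cc⁻¹`, `M_kc M_cc⁻¹` of
the column of an even pivot. -/
theorem IsManin.pivot_column (two : ∀ x : B, x + x = 0 → x = 0) {s : I → ℕ}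
    (hs : ∀ i, s i = 0 ∨ s i = 1) {M : Matrix I I B}
    (hM : IsManin s M) {c : I} (hc : s c = 0) {a' : B} (h1 : a' * M c c = 1)
    (h2 : M c c * a' = 1) (i j k : I) :
    M i j * (M k c * a') - (-1) ^ ((s i + s j) * s k) * (M k c * a' * M i j)
      + (-1) ^ ((s i + s j) * s k + s i * s j) * (M k c * a' * M c j * (M i c * a'))
      - (-1) ^ (s i * s j + s i * s k + s j * s k) * (M k j * (M i c * a'))
      + (-1) ^ (s j * s k) * (M i c * a' * M k j)
      - (-1) ^ (s j * s k + s k * s j) * (M i c * a' * M c j * (M k c * a')) = 0 := by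
  have f2 : ∀ i, M c c * M i j = M i j * M c c -
      (-1) ^ (s i * s j) * (M c j * M i c) + M i c * M c j := fun i => by
    have := hM i j c c
    rcases hs i with hi | hi <;> rcases hs j with hj | hj <;>
      simp [hi, hj, hc] at this ⊢ <;> linear_combination (norm := noncomm_ring) -this
  have f0 : ∀ i k, M i c * M k c = (-1) ^ (s i * s k) * (M k c * M i c) := fun i k => by
    have := hM i c k c
    refine sub_eq_zero.1 (two _ ?_)
    rcases hs i with hi | hi <;> rcases hs k with hk | hk <;> simp [hi, hk, hc] at this ⊢ <;>
      linear_combination (norm := noncomm_ring) this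
  have f1 : ∀ i, M i c * a' = a' * M i c := fun i => by
    have h0 : M i c * M c c = M c c * M i c := by simpa [hc] using f0 i c
    calc M i c * a' = a' * M c c * (M i c * a') := by rw [h1, one_mul]
      _ = a' * (M c c * M i c) * a' := by noncomm_ring
      _ = a' * (M i c * M c c) * a' := by rw [h0]
      _ = a' * M i c * (M c c * a') := by noncomm_ring
      _ = _ := by rw [h2, mul_one]
  have g : ∀ i k, M k c * M i j * a' = M k c * a' * M i j
      - (-1) ^ (s i * s j) * (M k c * a' * M c j * (M i c * a'))
      + a' * (M k c * M i c) * M c j * a' := fun i k => by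
    calc M k c * M i j * a' = M k c * (a' * M c c) * M i j * a' := by rw [h1, mul_one]
      _ = M k c * a' * (M c c * M i j) * a' := by noncomm_ring
      _ = M k c * a' * M i j * (M c c * a')
        - M k c * a' * ((-1) ^ (s i * s j) * (M c j * M i c)) * a'
        + (M k c * a') * M i c * M c j * a' := by rw [f2]; noncomm_ring
      _ = _ := by
        rw [h2, f1 k, mul_one]
        rcases hs i with hi | hi <;> rcases hs j with hj | hj <;> simp [hi, hj] <;> noncomm_ring
  have f3 := hM i j k c
  have g1 := g i k
  have g2 := g k i
  have g0 := f0 i k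
  generalize M i j = X at *
  generalize M k j = Y at *
  generalize M c j = b at *
  generalize M i c = r at *
  generalize M k c = t at *
  clear hM f2 f0 f1 g
  linear_combination (norm := skip) f3 * a' + (-1) ^ ((s i + s j) * s k) * g1
    - (-1) ^ (s j * s k) * g2 - (-1) ^ (s j * s k) * (a' * g0 * b * a')
  rcases hs i with hi | hi <;> rcases hs j with hj | hj <;> rcases hs k with hk | hk <;>
    simp [hi, hj, hk, hc] <;> noncomm_ring

/-- The Manin relations are inherited by the Schur complement of an even pivot. -/
theorem IsManin.schur_even (two : ∀ x : B, x + x = 0 → x = 0) {s : I → ℕ}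
    (hs : ∀ i, s i = 0 ∨ s i = 1) {M : Matrix I I B} (hM : IsManin s M) {c : I} (hc : s c = 0)
    (hu : IsUnit (M c c)) : IsManin s (schur M c) := by
  intro i j k l
  have h1 := hM.pivot_column two hs hc (inv_mul_of_isUnit hu) (mul_inv_of_isUnit hu)
  have p1 := h1 i j k
  have p2 := h1 k l i
  have q := fun i => hM i j c l
  have q1 := q i
  have q2 := q k
  have f := hM i j k l
  simp only [schur]
  generalize Ring.inverse (M c c) = a' at *
  clear h1 q hM
  generalize M i j = X at *
  generalize M k j = Y at *
  generalize M i l = Z at *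
  generalize M k l = W at *
  generalize M c j = b at *
  generalize M c l = d at *
  generalize M i c = r at *
  generalize M k c = t at *
  generalize M c c = e at *
  linear_combination (norm := skip) f - p1 * d
    + (-1) ^ ((s i + s j) * (s k + s l)) * (p2 * b)
    - (-1) ^ ((s i + s j) * s k) * (t * a' * q1) + (-1) ^ (s j * s k) * (r * a' * q2)
  rcases hs i with hi | hi <;> rcases hs j with hj | hj <;> rcases hs k with hk | hk <;>
    rcases hs l with hl | hl <;> simp [hi, hj, hk, hl, hc] <;> noncomm_ring

/-- Transposition over the opposite ring, together with a change of all parities, preserves the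
Manin relations. -/
theorem IsManin.transpose_op {s : I → ℕ} (hs : ∀ i, s i = 0 ∨ s i = 1) {M : Matrix I I B}
    (hM : IsManin s M) :
    IsManin (fun i => 1 - s i) (fun i j => MulOpposite.op (M j i) : Matrix I I Bᵐᵒᵖ) := by
  intro i j k l
  have h := congrArg MulOpposite.op (hM j i l k)
  rcases hs i with hi | hi <;> rcases hs j with hj | hj <;> rcases hs k with hk | hk <;>
    rcases hs l with hl | hl <;> simp [hi, hj, hk, hl] at h ⊢ <;>
    first
    | linear_combination (norm := (noncomm_ring; done)) -h
    | linear_combination (norm := (noncomm_ring; done)) h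

/-- The Manin relations are inherited by Schur complements. -/
theorem IsManin.schurComplement (two : ∀ x : B, x + x = 0 → x = 0) {s : I → ℕ}
    (hs : ∀ i, s i = 0 ∨ s i = 1) {M : Matrix I I B} (hM : IsManin s M) {c : I}
    (hu : IsUnit (M c c)) : IsManin s (schur M c) := by
  rcases hs c with hc | hc
  · exact hM.schur_even two hs hc hu
  -- An odd pivot becomes even in the transposed matrix over the opposite ring.
  have hs' : ∀ i, 1 - s i = 0 ∨ 1 - s i = 1 := fun i => by rcases hs i with h | h <;> simp [h]
  have h := (hM.transpose_op hs).schur_even (c := c)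
    (fun x hx => MulOpposite.unop_injective (two _ (by
      rw [← MulOpposite.unop_add, hx, MulOpposite.unop_zero]))) hs' (by simp [hc]) hu.op
  have h' := h.transpose_op hs'
  intro i j k l
  have h'' := congrArg (fun x => x.unop.unop) (h' i j k l)
  have e : ∀ i, 1 - (1 - s i) = s i := fun i => by rcases hs i with h | h <;> simp [h]
  have e2 : Ring.inverse (MulOpposite.op (M c c)) = MulOpposite.op (Ring.inverse (M c c)) :=
    ring_inverse_eq (by rw [← MulOpposite.op_mul, inv_mul_of_isUnit hu, MulOpposite.op_one])
      (by rw [← MulOpposite.op_mul, mul_inv_of_isUnit hu, MulOpposite.op_one])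
  simp only [e, schur, e2] at h'' ⊢
  simpa [mul_assoc] using h''

/-- For rows and columns `a` even, `b` odd of a Manin matrix, the two ways of eliminating give the
same product of pivots. -/
theorem IsManin.swap (two : ∀ x : B, x + x = 0 → x = 0) {s : I → ℕ} {M : Matrix I I B}
    (hM : IsManin s M) {a b : I} (ha : s a = 0) (hb : s b = 1) (hua : IsUnit (M a a))
    (hub : IsUnit (M b b)) (hub' : IsUnit (schur M a b b)) :
    M a a * Ring.inverse (schur M a b b) = Ring.inverse (M b b) * schur M b a a := by
  have h1 := hM a a b a
  have h2 := hM b a b b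
  have h3 := hM b a b a
  have h4 := hM a a b b
  simp only [ha, hb] at h1 h2 h3 h4
  norm_num at h1 h2 h3 h4
  have e1 := inv_mul_of_isUnit hua
  have e2 := inv_mul_of_isUnit hub
  have e1' := mul_inv_of_isUnit hua
  have e2' := mul_inv_of_isUnit hub
  have q2 := mul_inv_of_isUnit hub'
  simp only [schur] at *
  generalize Ring.inverse (M a a) = A' at *
  generalize Ring.inverse (M b b) = D' at *
  generalize M a a = A at *
  generalize M b b = D at *
  generalize M a b = β at *
  generalize M b a = γ at *
  generalize Ring.inverse (D - γ * A' * β) = Q' at *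
  have h1' : A * γ = γ * A := sub_eq_zero.1 (two _ (by
    linear_combination (norm := noncomm_ring) h1))
  have h2' : γ * D = D * γ := sub_eq_zero.1 (two _ (by
    linear_combination (norm := noncomm_ring) h2))
  have h3' : γ * γ = 0 := two _ (two _ (by linear_combination (norm := noncomm_ring) h3))
  have key : D * A = (A - β * D' * γ) * (D - γ * A' * β) := by
    linear_combination (norm := noncomm_ring) -h4 + h1' * A' * β + γ * e1' * β
      - β * D' * h3' * A' * β + β * D' * h2' + β * e2 * γ
  calc A * Q' = D' * D * (A * Q') := by rw [e2, one_mul]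
    _ = D' * (D * A) * Q' := by noncomm_ring
    _ = D' * (A - β * D' * γ) * ((D - γ * A' * β) * Q') := by rw [key]; noncomm_ring
    _ = _ := by rw [q2, mul_one]

/-- The order in which two indices are eliminated does not matter for the Schur complement. -/
theorem schur_comm (M : Matrix I I B) {a b : I} (hua : IsUnit (M a a))
    (hub : IsUnit (M b b)) (hub' : IsUnit (schur M a b b)) (hua' : IsUnit (schur M b a a)) :
    schur (schur M a) b = schur (schur M b) a := by
  have a1 := inv_mul_of_isUnit hua
  have b1 := inv_mul_of_isUnit hub
  have a2 := mul_inv_of_isUnit hua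
  have b2 := mul_inv_of_isUnit hub
  have q1 := inv_mul_of_isUnit hub'
  have p1 := inv_mul_of_isUnit hua'
  have q2 := mul_inv_of_isUnit hub'
  have p2 := mul_inv_of_isUnit hua'
  ext i j
  simp only [schur] at *
  generalize Ring.inverse (M a a) = A' at *
  generalize Ring.inverse (M b b) = D' at *
  generalize Ring.inverse (M b b - M b a * A' * M a b) = Q' at *
  generalize Ring.inverse (M a a - M a b * D' * M b a) = P' at *
  generalize M a a = A at *
  generalize M b b = D at *
  generalize M a b = β at *
  generalize M b a = γ at *
  generalize M i a = u
  generalize M i b = v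
  generalize M a j = x
  generalize M b j = y
  have k1 : P' * β * D' = A' * β * Q' := by
    have : β * D' * (D - γ * A' * β) = (A - β * D' * γ) * (A' * β) := by
      linear_combination (norm := noncomm_ring) β * b1 - a2 * β
    calc P' * β * D' = P' * β * D' * ((D - γ * A' * β) * Q') := by rw [q2, mul_one]
      _ = P' * (β * D' * (D - γ * A' * β)) * Q' := by noncomm_ring
      _ = (P' * (A - β * D' * γ)) * (A' * β) * Q' := by rw [this]; noncomm_ring
      _ = _ := by rw [p1, one_mul]
  have k2 : Q' * γ * A' = D' * γ * P' := by
    have : γ * A' * (A - β * D' * γ) = (D - γ * A' * β) * (D' * γ) := by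
      linear_combination (norm := noncomm_ring) γ * a1 - b2 * γ
    calc Q' * γ * A' = Q' * γ * A' * ((A - β * D' * γ) * P') := by rw [p2, mul_one]
      _ = Q' * (γ * A' * (A - β * D' * γ)) * P' := by noncomm_ring
      _ = (Q' * (D - γ * A' * β)) * (D' * γ) * P' := by rw [this]; noncomm_ring
      _ = _ := by rw [q1, one_mul]
  have k3 : P' = A' + P' * β * D' * γ * A' := by
    linear_combination (norm := noncomm_ring) p1 * A' - P' * a2
  have k4 : Q' = D' + Q' * γ * A' * β * D' := by
    linear_combination (norm := noncomm_ring) q1 * D' - Q' * b2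
  linear_combination (norm := noncomm_ring) u * k3 * x - v * k4 * y - u * k1 * y + v * k2 * x
    + u * k1 * γ * A' * x  - v * k2 * β * D' * y

end Elimination

/-! ### The Berezinian as a product of pivots -/

section BerList

variable {B : Type*} [Ring B] {I : Type*}

/-- The subring `K` (without unit) is quasi-regular: the inverses of the elements `1 + k` exist and
have the same form. -/
def QuasiRegular (K : NonUnitalSubring B) : Prop :=
  ∀ k ∈ K, ∃ k' ∈ K, (1 + k) * (1 + k') = 1 ∧ (1 + k') * (1 + k) = 1

/-- The Berezinian by Gauss elimination: the ordered product of the successive pivots on the indices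
of a list, inverted at the odd indices. -/
def berList (s : I → ℕ) (M : Matrix I I B) : List I → B
  | [] => 1
  | a :: l => (if s a = 0 then M a a else Ring.inverse (M a a)) * berList s (schur M a) l

/-- The Schur complement with respect to all the indices of a list. -/
def schurList (M : Matrix I I B) (l : List I) : Matrix I I B := l.foldl schur M

theorem berList_append (s : I → ℕ) (M : Matrix I I B) (l l' : List I) :
    berList s M (l ++ l') = berList s M l * berList s (schurList M l) l' := by
  induction l generalizing M with
  | nil => simp [berList, schurList]
  | cons a l ih => simp [berList, ih, schurList, mul_assoc]

variable [DecidableEq I]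

/-- On the indices of the list `l`, the matrix `M` is `d` times a matrix that is congruent to the
identity modulo `K`. -/
def NearScalar (K : NonUnitalSubring B) (d : Bˣ) (M : Matrix I I B) (l : List I) : Prop :=
  ∀ i ∈ l, ∀ j ∈ l, M i j * ↑d⁻¹ - (if i = j then 1 else 0) ∈ K

variable {K : NonUnitalSubring B} {d : Bˣ} {M : Matrix I I B}

theorem QuasiRegular.isUnit (hK : QuasiRegular K) {x : B} (hx : x - 1 ∈ K) : IsUnit x := by
  obtain ⟨k, -, h1, h2⟩ := hK _ hx
  rw [add_sub_cancel] at h1 h2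
  exact ⟨⟨x, _, h1, h2⟩, rfl⟩

theorem QuasiRegular.inverse_sub_one_mem (hK : QuasiRegular K) {x : B} (hx : x - 1 ∈ K) :
    Ring.inverse x - 1 ∈ K := by
  obtain ⟨k, hk, h1, h2⟩ := hK _ hx
  rw [add_sub_cancel] at h1 h2
  rwa [ring_inverse_eq h1 h2, add_sub_cancel_left]

theorem NearScalar.mono {l l' : List I} (h : NearScalar K d M l) (hl : ∀ i ∈ l', i ∈ l) :
    NearScalar K d M l' :=
  fun i hi j hj => h i (hl i hi) j (hl j hj)

theorem NearScalar.isUnit (hK : QuasiRegular K) {l : List I} (h : NearScalar K d M l) {i : I}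
    (hi : i ∈ l) : IsUnit (M i i) := by
  have h1 := h i hi i hi
  rw [if_pos rfl] at h1
  have h2 := (hK.isUnit h1).mul d.isUnit
  rwa [Units.inv_mul_cancel_right] at h2

theorem NearScalar.schur (hK : QuasiRegular K) {a : I} {l : List I}
    (h : NearScalar K d M (a :: l)) (ha : a ∉ l) : NearScalar K d (schur M a) l := by
  intro i hi j hj
  have haa := h a (by simp) a (by simp)
  rw [if_pos rfl] at haa
  have hia : M i a * ↑d⁻¹ ∈ K := by
    have := h i (by simp [hi]) a (by simp)
    rwa [if_neg (fun e : i = a => ha (e ▸ hi)), sub_zero] at this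
  have haj : M a j * ↑d⁻¹ ∈ K := by
    have := h a (by simp) j (by simp [hj])
    rwa [if_neg (fun e : a = j => ha (e ▸ hj)), sub_zero] at this
  have hinv := hK.inverse_sub_one_mem haa
  have e : Ring.inverse (M a a) = ↑d⁻¹ * Ring.inverse (M a a * ↑d⁻¹) := by
    rw [Ring.inverse_mul (Or.inr d⁻¹.isUnit), Ring.inverse_unit, inv_inv, ← mul_assoc,
      Units.inv_mul, one_mul]
  have hij := h i (by simp [hi]) j (by simp [hj])
  have : Gaudin.schur M a i j * ↑d⁻¹ - (if i = j then 1 else 0) =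
      (M i j * ↑d⁻¹ - (if i = j then 1 else 0)) - (M i a * ↑d⁻¹ * (M a j * ↑d⁻¹) +
        M i a * ↑d⁻¹ * (Ring.inverse (M a a * ↑d⁻¹) - 1) * (M a j * ↑d⁻¹)) := by
    rw [Gaudin.schur, e]
    noncomm_ring
  rw [this]
  exact sub_mem hij (add_mem (mul_mem hia haj) (mul_mem (mul_mem hia hinv) haj))

/-- The hypotheses under which elimination along `l` and its reorderings makes sense. -/
structure Admissible (K : NonUnitalSubring B) (d : Bˣ) (s : I → ℕ) (M : Matrix I I B)
    (l : List I) : Prop where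
  nodup : l.Nodup
  near : NearScalar K d M l
  manin : IsManin s M

theorem Admissible.perm {s : I → ℕ} {l l' : List I} (h : Admissible K d s M l) (hl : l.Perm l') :
    Admissible K d s M l' :=
  ⟨hl.nodup_iff.1 h.nodup, h.near.mono fun _ hi => hl.mem_iff.2 hi, h.manin⟩

theorem Admissible.schur (two : ∀ x : B, x + x = 0 → x = 0) {s : I → ℕ}
    (hs : ∀ i, s i = 0 ∨ s i = 1) (hK : QuasiRegular K) {a : I} {l : List I}
    (h : Admissible K d s M (a :: l)) : Admissible K d s (schur M a) l :=
  ⟨(List.nodup_cons.1 h.nodup).2, h.near.schur hK (List.nodup_cons.1 h.nodup).1,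
    h.manin.schurComplement two hs (h.near.isUnit hK (by simp))⟩

/-- Exchange of an even and an odd index in the order of elimination. The other pivots do not
change, and the product of these two is the same in both orders by the Manin relations. -/
theorem berList_swap (two : ∀ x : B, x + x = 0 → x = 0) {s : I → ℕ}
    (hs : ∀ i, s i = 0 ∨ s i = 1) (hK : QuasiRegular K) {a b : I} {l : List I}
    (h : Admissible K d s M (a :: b :: l)) (ha : s a = 0) (hb : s b = 1) :
    berList s M (a :: b :: l) = berList s M (b :: a :: l) := by
  have ua := h.near.isUnit hK (i := a) (by simp)
  have ub := h.near.isUnit hK (i := b) (by simp)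
  have ub' := (h.schur two hs hK).near.isUnit hK (i := b) (by simp)
  have ua' := ((h.perm (.swap _ _ _)).schur two hs hK).near.isUnit hK (i := a) (by simp)
  simp only [berList, ha, hb, if_true, one_ne_zero, if_false]
  rw [← mul_assoc, ← mul_assoc, h.manin.swap two ha hb ua ub ub', schur_comm M ua ub ub' ua']

/-- An even index can be moved past odd ones. -/
theorem berList_cons_append (two : ∀ x : B, x + x = 0 → x = 0) {s : I → ℕ}
    (hs : ∀ i, s i = 0 ∨ s i = 1) (hK : QuasiRegular K) {a : I} {c l : List I}
    (h : Admissible K d s M (a :: (c ++ l))) (ha : s a = 0) (hc : ∀ i ∈ c, s i = 1) :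
    berList s M (a :: (c ++ l)) = berList s M (c ++ a :: l) := by
  induction c generalizing M with
  | nil => rfl
  | cons b c ih =>
    have hp : (a :: b :: (c ++ l)).Perm (b :: a :: (c ++ l)) := .swap _ _ _
    rw [List.cons_append] at h ⊢
    rw [berList_swap two hs hK h ha (hc b (by simp)), List.cons_append, berList,
      ih ((h.perm hp).schur two hs hK) fun i hi => hc i (by simp [hi])]
    rfl

/-- A block of even indices can be moved past a block of odd indices. -/
theorem berList_move (two : ∀ x : B, x + x = 0 → x = 0) {s : I → ℕ}
    (hs : ∀ i, s i = 0 ∨ s i = 1) (hK : QuasiRegular K) {pre b c post : List I}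
    (h : Admissible K d s M (pre ++ (b ++ (c ++ post)))) (hb : ∀ i ∈ b, s i = 0)
    (hc : ∀ i ∈ c, s i = 1) :
    berList s M (pre ++ (b ++ (c ++ post))) = berList s M (pre ++ (c ++ (b ++ post))) := by
  induction pre generalizing M with
  | nil =>
    simp only [List.nil_append] at *
    induction b generalizing M with
    | nil => simp
    | cons a b ih =>
      have hp : (a :: (b ++ (c ++ post))).Perm (a :: (c ++ (b ++ post))) := .cons _ (by
        rw [← List.append_assoc, ← List.append_assoc]
        exact List.perm_append_comm.append_right _)
      rw [List.cons_append, List.cons_append,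
        ← berList_cons_append two hs hK (h.perm hp) (hb a (by simp)) hc,
        berList, ih (fun i hi => hb i (by simp [hi])) (h.schur two hs hK)]
      rfl
  | cons a pre ih =>
    simp only [List.cons_append, berList]
    rw [ih (h.schur two hs hK)]

theorem map_inverse_of_isUnit {B' : Type*} [Ring B'] (φ : B →+* B') {x : B} (hx : IsUnit x) :
    φ (Ring.inverse x) = Ring.inverse (φ x) :=
  (ring_inverse_eq (by rw [← map_mul, mul_inv_of_isUnit hx, map_one])
    (by rw [← map_mul, inv_mul_of_isUnit hx, map_one])).symm

/-- Ring homomorphisms preserve the Berezinian, because all the pivots are units; a homomorphism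
need not commute with `Ring.inverse` at other elements. -/
theorem map_berList {B' : Type*} [Ring B'] (φ : B →+* B') (hK : QuasiRegular K) (s : I → ℕ)
    {l : List I} (hl : l.Nodup) (h : NearScalar K d M l) :
    φ (berList s M l) = berList s (M.map φ) l := by
  induction l generalizing M with
  | nil => simp [berList]
  | cons a l ih =>
    have hu := h.isUnit hK (i := a) (by simp)
    have e : (schur M a).map φ = schur (M.map φ) a := by
      ext i j
      simp [schur, map_inverse_of_isUnit φ hu]
    rw [berList, berList, map_mul, ih (List.nodup_cons.1 hl).2 (h.schur hK (List.nodup_cons.1 hl).1),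
      e, Matrix.map_apply, ← map_inverse_of_isUnit φ hu, apply_ite φ]

omit [DecidableEq I] in
theorem berList_submatrix {I' : Type*} (f : I' → I) (s : I → ℕ) (s' : I' → ℕ)
    (hs : ∀ i, s (f i) = s' i) (M : Matrix I I B) (l : List I') :
    berList s' (M.submatrix f f) l = berList s M (l.map f) := by
  induction l generalizing M with
  | nil => rfl
  | cons a l ih =>
    rw [List.map_cons, berList, berList, ← ih]
    simp only [hs, Matrix.submatrix_apply]
    rfl

/-- The Berezinian of a matrix that is congruent to the identity modulo `K` is congruent to one. -/
theorem berList_sub_one_mem (hK : QuasiRegular K) (s : I → ℕ)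
    {l : List I} (hl : l.Nodup) (h : NearScalar K 1 M l) : berList s M l - 1 ∈ K := by
  induction l generalizing M with
  | nil => simp [berList, K.zero_mem]
  | cons a l ih =>
    have h1 := ih (List.nodup_cons.1 hl).2 (h.schur hK (List.nodup_cons.1 hl).1)
    have haa : M a a - 1 ∈ K := by simpa using h a (by simp) a (by simp)
    rw [berList]
    have h2 : (if s a = 0 then M a a else Ring.inverse (M a a)) - 1 ∈ K := by
      split_ifs
      exacts [haa, hK.inverse_sub_one_mem haa]
    have e : ∀ x y : B, x * y - 1 = (x - 1) * (y - 1) + (x - 1) + (y - 1) := fun x y => by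
      noncomm_ring
    rw [e]
    exact add_mem (add_mem (mul_mem h2 h1) h2) h1

end BerList

/-! ### Elimination modulo a left ideal -/

section ModLeftIdeal

variable {B : Type*} [Ring B] {I : Type*} [DecidableEq I]

/-- If the column of `M` at `k` is that of the scalar matrix `d` modulo the left ideal `J`, the same
is true of the Schur complements at the other indices: the correction `M_ia M_aa⁻¹ M_ak` is a left
multiple of an element of `J`. -/
theorem schur_column_mem (J : Submodule B B) {M : Matrix I I B} {d : B} {a k : I} (hak : a ≠ k)
    (h : ∀ i, M i k - (if i = k then d else 0) ∈ J) (i : I) :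
    schur M a i k - (if i = k then d else 0) ∈ J := by
  have h1 := h a
  rw [if_neg hak, sub_zero] at h1
  rw [schur, sub_right_comm]
  exact J.sub_mem (h i) (J.smul_mem _ h1)

theorem schurList_column_mem (J : Submodule B B) {M : Matrix I I B} {d : B} {k : I} {l : List I}
    (hl : k ∉ l) (h : ∀ i, M i k - (if i = k then d else 0) ∈ J) (i : I) :
    schurList M l i k - (if i = k then d else 0) ∈ J := by
  induction l generalizing M with
  | nil => exact h i
  | cons a l ih =>
    simp only [List.mem_cons, not_or] at hl
    exact ih hl.2 (schur_column_mem J (Ne.symm hl.1) h)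

variable {K : NonUnitalSubring B} {d : Bˣ} {M : Matrix I I B}

theorem NearScalar.schurList (hK : QuasiRegular K) {l l' : List I} (hl : (l ++ l').Nodup)
    (h : NearScalar K d M (l ++ l')) : NearScalar K d (schurList M l) l' := by
  induction l generalizing M with
  | nil => exact h
  | cons a l ih =>
    exact ih (List.nodup_cons.1 hl).2 (h.schur hK (List.nodup_cons.1 hl).1)

/-- Modulo a left ideal `J`, the Berezinian over indices whose columns are those of the scalar
matrix `d` is the power of `d` with exponent the number of even minus the number of odd indices. -/
theorem berList_sub_zpow_mem (hK : QuasiRegular K) (J : Submodule B B)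
    (hJ : ∀ x ∈ J, x * (d : B) ∈ J) (hJ' : ∀ x ∈ J, x * (↑d⁻¹ : B) ∈ J) (s : I → ℕ)
    {l : List I} (hl : l.Nodup) (h : NearScalar K d M l)
    (hc : ∀ k ∈ l, ∀ i, M i k - (if i = k then (d : B) else 0) ∈ J) :
    berList s M l - ((d ^ (l.map fun i => if s i = 0 then (1 : ℤ) else -1).sum : Bˣ) : B) ∈ J := by
  induction l generalizing M with
  | nil => simp [berList]
  | cons a l ih =>
    obtain ⟨ha, hl'⟩ := List.nodup_cons.1 hl
    have hz : ∀ (t : ℤ), ∀ x ∈ J, x * ((d ^ t : Bˣ) : B) ∈ J := by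
      intro t
      induction t with
      | zero => simp
      | succ n ihn =>
        intro x hx
        rw [zpow_add_one, Units.val_mul, ← mul_assoc]
        exact hJ _ (ihn x hx)
      | pred n ihn =>
        intro x hx
        rw [zpow_sub_one, Units.val_mul, ← mul_assoc]
        exact hJ' _ (ihn x hx)
    have h1 := ih hl' (h.schur hK ha) fun k hk i =>
      schur_column_mem J (fun e : a = k => ha (e ▸ hk)) (hc k (by simp [hk])) i
    have haa : M a a - d ∈ J := by simpa using hc a (by simp) a
    have hu := h.isUnit hK (i := a) (by simp)
    set t := (l.map fun i => if s i = 0 then (1 : ℤ) else -1).sum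
    have h2 : (if s a = 0 then M a a else Ring.inverse (M a a)) -
        ((d ^ (if s a = 0 then (1 : ℤ) else -1) : Bˣ) : B) ∈ J := by
      split_ifs
      · simpa using haa
      · have : Ring.inverse (M a a) - ((d ^ (-1 : ℤ) : Bˣ) : B) =
            -(Ring.inverse (M a a) * ((M a a - d) * ↑d⁻¹)) := by
          have e := inv_mul_of_isUnit hu
          rw [zpow_neg_one, sub_mul, Units.mul_inv, mul_sub, ← mul_assoc, e]
          simp
        rw [this]
        exact J.neg_mem (J.smul_mem _ (hJ' _ haa))
    rw [berList, List.map_cons, List.sum_cons, zpow_add, Units.val_mul]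
    set w := (if s a = 0 then M a a else Ring.inverse (M a a))
    set y := ((d ^ (if s a = 0 then (1 : ℤ) else -1) : Bˣ) : B)
    have : w * berList s (schur M a) l - y * ((d ^ t : Bˣ) : B) =
        w * (berList s (schur M a) l - ((d ^ t : Bˣ) : B)) + (w - y) * ((d ^ t : Bˣ) : B) := by
      noncomm_ring
    rw [this]
    exact J.add_mem (J.smul_mem _ h1) (hz _ _ h2)

end ModLeftIdeal

/-! ### Quasiminors and pivots -/

section Quasiminors

variable {B : Type*} [Ring B] {N : ℕ}

/-- The matrix with first entry `a`, rest of the first row `r`, rest of the first column `c`, and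
remaining block `S`. -/
def bordered (a : B) (r c : Fin N → B) (S : Matrix (Fin N) (Fin N) B) :
    Matrix (Fin (N + 1)) (Fin (N + 1)) B :=
  Matrix.of (Fin.cons (Fin.cons a r) fun i => Fin.cons (c i) (S i))

theorem bordered_mul (a a' : B) (r c r' c' : Fin N → B) (S S' : Matrix (Fin N) (Fin N) B) :
    bordered a r c S * bordered a' r' c' S' =
      bordered (a * a' + ∑ k, r k * c' k) (fun j => a * r' j + ∑ k, r k * S' k j)
        (fun i => c i * a' + ∑ k, S i k * c' k) (Matrix.of fun i j => c i * r' j + (S * S') i j) := by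
  ext i j
  refine Fin.cases ?_ (fun i => ?_) i <;> refine Fin.cases ?_ (fun j => ?_) j <;>
    simp [bordered, Matrix.mul_apply, Fin.sum_univ_succ]

theorem bordered_one : bordered (1 : B) 0 0 (1 : Matrix (Fin N) (Fin N) B) = 1 := by
  ext i j
  refine Fin.cases ?_ (fun i => ?_) i <;> refine Fin.cases ?_ (fun j => ?_) j <;>
    simp [bordered, Matrix.one_apply, Fin.succ_ne_zero, (Fin.succ_ne_zero _).symm]

/-- The Schur complement with respect to the first diagonal entry. -/
def schurFin (A : Matrix (Fin (N + 1)) (Fin (N + 1)) B) : Matrix (Fin N) (Fin N) B :=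
  (schur A 0).submatrix Fin.succ Fin.succ

/-- Inversion by blocks: the lower right block of the inverse is the inverse of the Schur
complement. -/
theorem inverse_schurFin {A : Matrix (Fin (N + 1)) (Fin (N + 1)) B} (hu : IsUnit (A 0 0))
    (hS : IsUnit (schurFin A)) :
    IsUnit A ∧ ∀ i j, Ring.inverse A (Fin.succ i) (Fin.succ j) = Ring.inverse (schurFin A) i j := by
  have a1 := inv_mul_of_isUnit hu
  have a2 := mul_inv_of_isUnit hu
  have s1 := inv_mul_of_isUnit hS
  have s2 := mul_inv_of_isUnit hS
  set a' := Ring.inverse (A 0 0)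
  set S' := Ring.inverse (schurFin A)
  -- The triangular factorization of `A`.
  set x : Fin N → B := fun i => A i.succ 0 * a'
  set y : Fin N → B := fun j => a' * A 0 j.succ
  have hA : A = bordered 1 0 x 1 * (bordered (A 0 0) 0 0 (schurFin A) * bordered 1 y 0 1) := by
    rw [bordered_mul, bordered_mul]
    ext i j
    refine Fin.cases ?_ (fun i => ?_) i <;> refine Fin.cases ?_ (fun j => ?_) j <;>
      simp [bordered, x, y, schurFin, schur, mul_assoc, a1, a', Matrix.one_apply]
    · rw [← mul_assoc, a2, one_mul]
    · rw [← mul_assoc (A 0 0), a2, one_mul, add_sub_cancel]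
  have neg_right : ∀ y : Fin N → B, bordered 1 y 0 (1 : Matrix (Fin N) (Fin N) B) *
      bordered 1 (-y) 0 1 = 1 := fun y => by
    rw [bordered_mul, ← bordered_one]
    ext i j
    refine Fin.cases ?_ (fun i => ?_) i <;> refine Fin.cases ?_ (fun j => ?_) j <;>
      simp [bordered, Matrix.one_apply]
  have neg_left : ∀ x : Fin N → B, bordered 1 0 x (1 : Matrix (Fin N) (Fin N) B) *
      bordered 1 0 (-x) 1 = 1 := fun x => by
    rw [bordered_mul, ← bordered_one]
    ext i j
    refine Fin.cases ?_ (fun i => ?_) i <;> refine Fin.cases ?_ (fun j => ?_) j <;>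
      simp [bordered, Matrix.one_apply]
  have n2 := neg_right (-y)
  have n4 := neg_left (-x)
  rw [neg_neg] at n2 n4
  have n1 := neg_right y
  have n3 := neg_left x
  have d1 : bordered (A 0 0) 0 0 (schurFin A) * bordered a' 0 0 S' = 1 := by
    rw [bordered_mul, ← bordered_one, s2, a2]
    ext i j
    refine Fin.cases ?_ (fun i => ?_) i <;> refine Fin.cases ?_ (fun j => ?_) j <;>
      simp [bordered]
  have d2 : bordered a' 0 0 S' * bordered (A 0 0) 0 0 (schurFin A) = 1 := by
    rw [bordered_mul, ← bordered_one, s1, a1]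
    ext i j
    refine Fin.cases ?_ (fun i => ?_) i <;> refine Fin.cases ?_ (fun j => ?_) j <;>
      simp [bordered]
  set X := bordered 1 0 x (1 : Matrix (Fin N) (Fin N) B)
  set X' := bordered 1 0 (-x) (1 : Matrix (Fin N) (Fin N) B) with hX'
  set Y := bordered 1 y 0 (1 : Matrix (Fin N) (Fin N) B)
  set Y' := bordered 1 (-y) 0 (1 : Matrix (Fin N) (Fin N) B) with hY'
  set D := bordered (A 0 0) 0 0 (schurFin A)
  set D' := bordered a' 0 0 S' with hD'
  have e1 : A * (Y' * (D' * X')) = 1 := by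
    rw [hA]
    calc X * (D * Y) * (Y' * (D' * X')) = X * (D * (Y * Y') * D') * X' := by noncomm_ring
      _ = 1 := by rw [n1, mul_one, d1, mul_one, n3]
  have e2 : (Y' * (D' * X')) * A = 1 := by
    rw [hA]
    calc (Y' * (D' * X')) * (X * (D * Y)) = Y' * (D' * (X' * X) * D) * Y := by noncomm_ring
      _ = 1 := by rw [n4, mul_one, d2, mul_one, n2]
  refine ⟨⟨⟨A, _, e1, e2⟩, rfl⟩, fun i j => ?_⟩
  rw [ring_inverse_eq e1 e2, hY', hD', hX', bordered_mul, bordered_mul]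
  simp [bordered, Matrix.one_apply]

theorem isUnit_matrix_one {A : Matrix (Fin 1) (Fin 1) B} (hu : IsUnit (A 0 0)) :
    IsUnit A ∧ Ring.inverse A 0 0 = Ring.inverse (A 0 0) := by
  have e1 : A * Matrix.of (fun _ _ => Ring.inverse (A 0 0)) = 1 := by
    ext i j
    fin_cases i; fin_cases j
    simp [Matrix.mul_apply, mul_inv_of_isUnit hu]
  have e2 : Matrix.of (fun _ _ => Ring.inverse (A 0 0)) * A = 1 := by
    ext i j
    fin_cases i; fin_cases j
    simp [Matrix.mul_apply, inv_mul_of_isUnit hu]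
  exact ⟨⟨⟨A, _, e1, e2⟩, rfl⟩, by rw [ring_inverse_eq e1 e2]; rfl⟩

theorem quasiminor_zero {A : Matrix (Fin (N + 1)) (Fin (N + 1)) B} (hu : IsUnit (A 0 0)) :
    (IsUnit (lead A 0) ∧ IsUnit (Ring.inverse (lead A 0) (Fin.last _) (Fin.last _))) ∧
      quasiminor A 0 = A 0 0 := by
  have h : IsUnit (lead A 0) ∧ Ring.inverse (lead A 0) 0 0 = Ring.inverse (A 0 0) :=
    isUnit_matrix_one (A := lead A 0) hu
  have e : Ring.inverse (lead A 0) (Fin.last _) (Fin.last _) = Ring.inverse (A 0 0) := h.2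
  refine ⟨⟨h.1, ?_⟩, ?_⟩
  · rw [e]; exact hu.ringInverse
  · rw [quasiminor, e, Ring.inverse_inverse hu]

theorem quasiminor_succ {A : Matrix (Fin (N + 1)) (Fin (N + 1)) B} (hu : IsUnit (A 0 0))
    {i : Fin N} (h : IsUnit (lead (schurFin A) i)) :
    IsUnit (lead A i.succ) ∧ Ring.inverse (lead A i.succ) (Fin.last _) (Fin.last _) =
      Ring.inverse (lead (schurFin A) i) (Fin.last _) (Fin.last _) := by
  have h' := inverse_schurFin (N := i + 1) (A := lead A i.succ) hu h
  exact ⟨h'.1, h'.2 (Fin.last _) (Fin.last _)⟩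

/-- The quasiminors of a matrix are the pivots of Gauss elimination. -/
theorem ber_eq_berList {I : Type*} [DecidableEq I] {K : NonUnitalSubring B} {d : Bˣ}
    (hK : QuasiRegular K) (f : Fin N → I) (s : I → ℕ) (M : Matrix I I B)
    (hf : Function.Injective f) (h : NearScalar K d M (List.ofFn f)) :
    SufficientlyInvertible (M.submatrix f f) ∧
      Ber (s ∘ f) (M.submatrix f f) = berList s M (List.ofFn f) := by
  induction N generalizing M with
  | zero => exact ⟨fun i => i.elim0, by simp [Ber, berList]⟩
  | succ N ih =>
    rw [List.ofFn_succ] at h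
    have hu : IsUnit ((M.submatrix f f) 0 0) := h.isUnit hK (i := f 0) (by simp)
    have h0 : f 0 ∉ List.ofFn fun i : Fin N => f i.succ := by
      simp only [List.mem_ofFn, not_exists]
      exact fun i e => Fin.succ_ne_zero i (hf e)
    obtain ⟨h1, h2⟩ := ih (f ∘ Fin.succ) (schur M (f 0)) (hf.comp (Fin.succ_injective N))
      (h.schur hK h0)
    have e : schurFin (M.submatrix f f) =
        (schur M (f 0)).submatrix (f ∘ Fin.succ) (f ∘ Fin.succ) := rfl
    rw [← e] at h1 h2
    refine ⟨fun i => ?_, ?_⟩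
    · refine Fin.cases ?_ (fun i => ?_) i
      · exact (quasiminor_zero hu).1
      · obtain ⟨q1, q2⟩ := quasiminor_succ hu (h1 i).1
        refine ⟨q1, ?_⟩
        rw [q2]
        exact (h1 i).2
    · rw [Ber, List.ofFn_succ, List.prod_cons, (quasiminor_zero hu).2, List.ofFn_succ, berList]
      congr 1
      rw [← Function.comp_def f, ← h2, Ber]
      congr 1
      refine List.ofFn_inj.2 (funext fun i => ?_)
      have q := (quasiminor_succ hu (h1 i).1).2
      simp only [quasiminor, Function.comp_apply]
      rw [q]

end Quasiminors

/-! ### Root vectors and Schur complements -/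

section Invariance

variable {B : Type*} [Ring B] {I : Type*} [DecidableEq I]

/-- The commutation relations of the entries of `M` with an element `e` that behaves like the matrix
unit `E_xy`; the signs `ε i = (-1)^{|e| |i|}` account for the sign rule. -/
def RootRelation (e : B) (ε : I → B) (x y : I) (M : Matrix I I B) : Prop :=
  ∀ j k, e * M j k = ε j * ε k * (M j k * e) + (if j = y then ε x * ε y * M x k else 0)
    - (if k = x then ε j * ε x * M j y else 0)

theorem commute_ring_inverse {e a : B} (h : Commute e a) : Commute e (Ring.inverse a) := by
  by_cases hu : IsUnit a
  · obtain ⟨u, rfl⟩ := hu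
    rw [Ring.inverse_unit]
    exact h.units_inv_right
  · rw [Ring.inverse_non_unit a hu]
    exact Commute.zero_right e

/-- Elimination of an index other than `x` and `y` does not affect the relations with `e`, and the
pivot commutes with `e`. This reduces statements about `e` to the case where `x` and `y` come first.
-/
theorem RootRelation.schurComplement {e : B} {ε : I → B} (hε : ∀ i, ε i = 1 ∨ ε i = -1) {x y a : I}
    {M : Matrix I I B} (h : RootRelation e ε x y M) (hx : a ≠ x) (hy : a ≠ y) :
    Commute e (M a a) ∧ RootRelation e ε x y (schur M a) := by
  have haa : Commute e (M a a) := by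
    have := h a a
    rw [if_neg hy, if_neg hx] at this
    rw [Commute, SemiconjBy]
    rcases hε a with ha | ha <;> simpa [ha] using this
  refine ⟨haa, fun j k => ?_⟩
  have c : e * Ring.inverse (M a a) = Ring.inverse (M a a) * e :=
    (commute_ring_inverse haa).eq
  have h1 := h j k
  have h2 := h j a
  have h3 := h a k
  rw [if_neg hx] at h2
  rw [if_neg hy] at h3
  simp only [schur]
  generalize Ring.inverse (M a a) = A' at *
  have key : e * (M j a * A' * M a k) =
      ε j * ε k * (M j a * A' * M a k * e) + (if j = y then ε x * ε y * (M x a * A' * M a k) else 0)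
        - (if k = x then ε j * ε x * (M j a * A' * M a y) else 0) := by
    calc e * (M j a * A' * M a k) = (e * M j a) * A' * M a k := by noncomm_ring
      _ = ε j * ε a * M j a * (e * A') * M a k + (if j = y then ε x * ε y * M x a else 0) * A' * M a k
          := by rw [h2]; noncomm_ring
      _ = ε j * ε a * M j a * A' * (e * M a k) + (if j = y then ε x * ε y * M x a else 0) * A' * M a k
          := by rw [c]; noncomm_ring
      _ = _ := by
        rw [h3]
        rcases hε j with ej | ej <;> rcases hε k with ek | ek <;> rcases hε a with ea | ea <;>
          rcases hε x with ex | ex <;> simp only [ej, ek, ea, ex] <;> split_ifs <;> noncomm_ring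
  rw [mul_sub, h1, key]
  split_ifs <;> noncomm_ring

variable {e : B} {ε : I → B} {x y : I} {M : Matrix I I B}

/-- The commutation relations of `e` with the pivots at `x` and `y`. -/
theorem RootRelation.pivots (hε : ∀ i, ε i = 1 ∨ ε i = -1) (hxy : x ≠ y)
    (h : RootRelation e ε x y M) (hu : IsUnit (M x x)) :
    e * M x x = M x x * e - M x y ∧
    e * Ring.inverse (M x x) = Ring.inverse (M x x) * e
      + Ring.inverse (M x x) * M x y * Ring.inverse (M x x) ∧
    e * schur M x y y = schur M x y y * e
      + ε x * ε y * (schur M x y y * Ring.inverse (M x x) * M x y) := by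
  have h1 := h x x
  have h2 := h x y
  have h3 := h y x
  have h4 := h y y
  simp only [hxy, hxy.symm, if_true, if_false] at h1 h2 h3 h4
  have a1 := inv_mul_of_isUnit hu
  have a2 := mul_inv_of_isUnit hu
  simp only [schur]
  generalize Ring.inverse (M x x) = A' at *
  generalize M x x = A at *
  generalize M x y = β at *
  generalize M y x = γ at *
  generalize M y y = D at *
  have k1 : e * A = A * e - β := by
    rcases hε x with ex | ex <;> simp [ex] at h1 <;> exact h1
  have k2 : e * A' = A' * e + A' * β * A' := by
    linear_combination (norm := noncomm_ring) -(a1 * e * A') + A' * e * a2 - A' * k1 * A'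
  refine ⟨k1, k2, ?_⟩
  have k3 : e * (γ * A' * β) = γ * A' * β * e + ε x * ε y * (γ * A' * β * A' * β + β - D * A' * β) := by
    calc e * (γ * A' * β) = (e * γ) * A' * β := by noncomm_ring
      _ = ε x * ε y * γ * (e * A') * β + ε x * ε y * (A * A' - D * A') * β := by
        rw [h3]
        rcases hε x with ex | ex <;> rcases hε y with ey | ey <;> simp only [ex, ey] <;>
          noncomm_ring
      _ = ε x * ε y * γ * A' * (e * β) + ε x * ε y * γ * A' * β * A' * β +
          ε x * ε y * (β - D * A' * β) := by
        rw [k2, a2]; noncomm_ring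
      _ = _ := by
        rw [h2]
        rcases hε x with ex | ex <;> rcases hε y with ey | ey <;> simp only [ex, ey] <;>
          noncomm_ring
  rw [mul_sub, k3, h4]
  rcases hε x with ex | ex <;> rcases hε y with ey | ey <;> simp only [ex, ey] <;> noncomm_ring

/-- Once both pivots `x` and `y` are eliminated, `e` commutes with the entries up to sign. -/
theorem RootRelation.eliminated (hε : ∀ i, ε i = 1 ∨ ε i = -1) (hxy : x ≠ y)
    (h : RootRelation e ε x y M) (hu : IsUnit (M x x)) (hu' : IsUnit (schur M x y y)) {j k : I}
    (hjy : j ≠ y) (hkx : k ≠ x) :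
    e * schur (schur M x) y j k = ε j * ε k * (schur (schur M x) y j k * e) := by
  obtain ⟨-, k2, k3⟩ := h.pivots hε hxy hu
  have h1 := h j k
  have h2 := h j x
  have h3 := h j y
  have h4 := h x k
  have h5 := h y k
  have h6 := h x y
  have h7 := h y x
  simp only [hjy, hkx, hxy, hxy.symm, if_true, if_false] at h1 h2 h3 h4 h5 h6 h7
  have q1 := inv_mul_of_isUnit hu'
  have q2 := mul_inv_of_isUnit hu'
  have a2 := mul_inv_of_isUnit hu
  rw [schur]
  generalize hQ' : Ring.inverse (schur M x y y) = Q' at *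
  have eQ : schur M x y y = M y y - M y x * Ring.inverse (M x x) * M x y := rfl
  have ejk : schur M x j k = M j k - M j x * Ring.inverse (M x x) * M x k := rfl
  have ejy : schur M x j y = M j y - M j x * Ring.inverse (M x x) * M x y := rfl
  have eyk : schur M x y k = M y k - M y x * Ring.inverse (M x x) * M x k := rfl
  have exx : ε x * ε x = 1 := by rcases hε x with ex | ex <;> simp [ex]
  -- The relations for the entries after the first elimination.
  have l1 : ∀ k, k ≠ x → e * M x k = ε x * ε k * (M x k * e) →
      e * M j k = ε j * ε k * (M j k * e) →
      e * schur M x j k = ε j * ε k * (schur M x j k * e)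
        + ε j * ε x * (schur M x j y * Ring.inverse (M x x) * M x k) := by
    intro k hk g1 g2
    have : e * (M j x * Ring.inverse (M x x) * M x k) =
        ε j * ε k * (M j x * Ring.inverse (M x x) * M x k * e)
        - ε j * ε x * (schur M x j y * Ring.inverse (M x x) * M x k) := by
      rw [ejy]
      generalize Ring.inverse (M x x) = A' at *
      calc e * (M j x * A' * M x k) = (e * M j x) * A' * M x k := by noncomm_ring
        _ = ε j * ε x * M j x * (e * A') * M x k - ε j * ε x * M j y * A' * M x k := by
          rw [h2]; noncomm_ring
        _ = ε j * ε x * M j x * A' * (e * M x k) + ε j * ε x * M j x * A' * M x y * A' * M x k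
            - ε j * ε x * M j y * A' * M x k := by
          rw [k2]; noncomm_ring
        _ = _ := by
          rw [g1]
          rcases hε x with ex | ex <;> rcases hε j with ej | ej <;> rcases hε k with ek | ek <;>
            simp only [ex, ej, ek] <;> noncomm_ring
    rw [schur, mul_sub, this, g2]
    noncomm_ring
  have m1 := l1 k hkx (by simpa using h4) (by simpa using h1)
  have m2 := l1 y hxy.symm (by simpa using h6) (by simpa using h3)
  have m3 : e * schur M x y k = ε y * ε k * (schur M x y k * e)
      + ε x * ε y * (schur M x y y * Ring.inverse (M x x) * M x k) := by
    have : e * (M y x * Ring.inverse (M x x) * M x k) =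
        ε y * ε k * (M y x * Ring.inverse (M x x) * M x k * e) + ε x * ε y * M x k
        - ε x * ε y * (schur M x y y * Ring.inverse (M x x) * M x k) := by
      rw [eQ]
      generalize Ring.inverse (M x x) = A' at *
      calc e * (M y x * A' * M x k) = (e * M y x) * A' * M x k := by noncomm_ring
        _ = ε y * ε x * M y x * (e * A') * M x k + ε x * ε y * (M x x * A') * M x k
            - ε y * ε x * M y y * A' * M x k := by
          rw [h7]; noncomm_ring
        _ = ε y * ε x * M y x * A' * (e * M x k) + ε y * ε x * M y x * A' * M x y * A' * M x k
            + ε x * ε y * M x k - ε y * ε x * M y y * A' * M x k := by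
          rw [k2, a2]; noncomm_ring
        _ = _ := by
          rw [h4]
          rcases hε x with ex | ex <;> rcases hε y with ey | ey <;> rcases hε k with ek | ek <;>
            simp only [ex, ey, ek] <;> noncomm_ring
    rw [schur, mul_sub, this, h5]
    noncomm_ring
  clear l1 ejk ejy eyk eQ h1 h2 h3 h4 h5 h6 h7 hQ'
  generalize schur M x y y = Q at *
  generalize schur M x j k = X at *
  generalize schur M x j y = Y at *
  generalize schur M x y k = Z at *
  generalize Ring.inverse (M x x) = A' at *
  have k4 : e * Q' = Q' * e - ε x * ε y * (A' * M x y * Q') := by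
    calc e * Q' = Q' * Q * (e * Q') := by rw [q1, one_mul]
      _ = Q' * (e * Q) * Q' - ε x * ε y * ((Q' * Q) * A' * M x y * Q') := by
        rw [k3]
        rcases hε x with ex | ex <;> rcases hε y with ey | ey <;>
            simp only [ex, ey] <;> noncomm_ring
      _ = Q' * e * (Q * Q') - ε x * ε y * ((Q' * Q) * A' * M x y * Q') := by noncomm_ring
      _ = _ := by rw [q1, q2, mul_one, one_mul]
  have : e * (Y * Q' * Z) = ε j * ε k * (Y * Q' * Z * e) + ε j * ε x * (Y * A' * M x k) := by
    calc e * (Y * Q' * Z) = (e * Y) * Q' * Z := by noncomm_ring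
      _ = ε j * ε y * Y * (e * Q') * Z + ε j * ε x * (Y * A' * M x y * Q' * Z) := by
        rw [m2]; noncomm_ring
      _ = ε j * ε y * Y * Q' * (e * Z) := by
        rw [k4]
        rcases hε x with ex | ex <;> rcases hε y with ey | ey <;> rcases hε j with ej | ej <;>
            simp only [ex, ey, ej] <;> noncomm_ring
      _ = ε j * ε y * ε y * ε k * (Y * Q' * Z * e) + ε j * ε y * ε x * ε y * (Y * (Q' * Q) * A' * M x k) := by
        rw [m3]
        rcases hε x with ex | ex <;> rcases hε y with ey | ey <;> rcases hε j with ej | ej <;>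
          rcases hε k with ek | ek <;> simp only [ex, ey, ej, ek] <;> noncomm_ring
      _ = _ := by
        rw [q1, mul_one]
        rcases hε x with ex | ex <;> rcases hε y with ey | ey <;> rcases hε j with ej | ej <;>
          rcases hε k with ek | ek <;> simp only [ex, ey, ej, ek] <;> noncomm_ring
  rw [mul_sub, m1, this]
  noncomm_ring

end Invariance

/-! ### Elements that commute with the Berezinian -/

section Commutation

variable {B : Type*} [Ring B] {I : Type*} [DecidableEq I] {K : NonUnitalSubring B} {d : Bˣ}

omit [DecidableEq I] in
theorem commute_pivot {e : B} (s : I → ℕ) {M : Matrix I I B} {a : I} (h : Commute e (M a a)) :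
    Commute e (if s a = 0 then M a a else Ring.inverse (M a a)) := by
  split_ifs
  exacts [h, commute_ring_inverse h]

omit [DecidableEq I] in
/-- An element that commutes with the entries of `M` up to the signs `ε j * ε k` commutes with the
Berezinian: the sign is trivial on the diagonal, and the Schur complements inherit the relation. -/
theorem berList_commute_of_sign {e : B} {ε : I → B} (hε : ∀ i, ε i = 1 ∨ ε i = -1) (s : I → ℕ)
    {M : Matrix I I B} {l : List I}
    (h : ∀ j ∈ l, ∀ k ∈ l, e * M j k = ε j * ε k * (M j k * e)) :
    Commute e (berList s M l) := by
  induction l generalizing M with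
  | nil => exact Commute.one_right e
  | cons a l ih =>
    have haa : Commute e (M a a) := by
      rw [Commute, SemiconjBy, h a (by simp) a (by simp)]
      rcases hε a with ha | ha <;> simp [ha]
    refine (commute_pivot s haa).mul_right (ih fun j hj k hk => ?_)
    have h1 := h j (by simp [hj]) k (by simp [hk])
    have h2 := h j (by simp [hj]) a (by simp)
    have h3 := h a (by simp) k (by simp [hk])
    have c : e * Ring.inverse (M a a) = Ring.inverse (M a a) * e := (commute_ring_inverse haa).eq
    simp only [schur]
    generalize Ring.inverse (M a a) = A' at *
    have : e * (M j a * A' * M a k) = ε j * ε k * (M j a * A' * M a k * e) := by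
      calc e * (M j a * A' * M a k) = (e * M j a) * A' * M a k := by noncomm_ring
        _ = ε j * ε a * M j a * (e * A') * M a k := by rw [h2]; noncomm_ring
        _ = ε j * ε a * M j a * A' * (e * M a k) := by rw [c]; noncomm_ring
        _ = _ := by
          rw [h3]
          rcases hε j with ej | ej <;> rcases hε k with ek | ek <;> rcases hε a with ea | ea <;>
            simp only [ej, ek, ea] <;> noncomm_ring
    rw [mul_sub, h1, this]
    noncomm_ring

omit [DecidableEq I] in
/-- The Berezinian has weight zero. -/
theorem berList_commute_of_weight {e : B} (w : I → ℤ) (s : I → ℕ) {M : Matrix I I B} {l : List I}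
    (h : ∀ j k, e * M j k = M j k * e + (w j - w k) • M j k) :
    Commute e (berList s M l) := by
  induction l generalizing M with
  | nil => exact Commute.one_right e
  | cons a l ih =>
    have haa : Commute e (M a a) := by
      rw [Commute, SemiconjBy, h a a, sub_self, zero_smul, add_zero]
    refine (commute_pivot s haa).mul_right (ih fun j k => ?_)
    have c : e * Ring.inverse (M a a) = Ring.inverse (M a a) * e := (commute_ring_inverse haa).eq
    simp only [schur]
    generalize Ring.inverse (M a a) = A' at *
    have : e * (M j a * A' * M a k) = M j a * A' * M a k * e + (w j - w k) • (M j a * A' * M a k) := by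
      calc e * (M j a * A' * M a k) = (e * M j a) * A' * M a k := by noncomm_ring
        _ = M j a * (e * A') * M a k + (w j - w a) • (M j a * A' * M a k) := by
          rw [h j a, add_mul, add_mul, smul_mul_assoc, smul_mul_assoc]; simp only [mul_assoc]
        _ = M j a * A' * (e * M a k) + (w j - w a) • (M j a * A' * M a k) := by
          rw [c]; simp only [mul_assoc]
        _ = _ := by
          rw [h a k, mul_add, mul_smul_comm, add_assoc, ← add_smul, ← mul_assoc]
          congr 2
          ring
    rw [mul_sub, h j k, this, smul_sub]
    noncomm_ring

/-- The Berezinian commutes with the matrix unit of two adjacent indices. -/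
theorem berList_commute_of_root (two : ∀ x : B, x + x = 0 → x = 0) {s : I → ℕ}
    (hs : ∀ i, s i = 0 ∨ s i = 1) (hK : QuasiRegular K) {e : B} {x y : I} {M : Matrix I I B}
    {pre post : List I} (h : Admissible K d s M (pre ++ x :: y :: post))
    (he : RootRelation e (fun i => (-1) ^ ((s x + s y) * s i)) x y M) (hxy : s x ≤ s y) :
    Commute e (berList s M (pre ++ x :: y :: post)) := by
  have hε : ∀ i, (fun i => (-1 : B) ^ ((s x + s y) * s i)) i = 1 ∨
      (fun i => (-1 : B) ^ ((s x + s y) * s i)) i = -1 := fun i => neg_one_pow_eq_or B _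
  induction pre generalizing M with
  | cons a pre ih =>
    rw [List.cons_append, berList]
    have hn := (List.nodup_cons.1 h.nodup).1
    obtain ⟨h1, h2⟩ := he.schurComplement hε (a := a) (fun e => hn (by simp [e]))
      (fun e => hn (by simp [e]))
    exact (commute_pivot s h1).mul_right (ih (h.schur two hs hK) h2)
  | nil =>
    rw [List.nil_append] at h ⊢
    have hn := h.nodup
    simp only [List.nodup_cons, List.mem_cons, not_or] at hn
    obtain ⟨⟨hne, hx⟩, hy, -⟩ := hn
    have hu := h.near.isUnit hK (i := x) (by simp)
    have hu' := (h.schur two hs hK).near.isUnit hK (i := y) (by simp)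
    rw [berList, berList, ← mul_assoc]
    refine Commute.mul_right ?_ (berList_commute_of_sign hε s fun j hj k hk =>
      he.eliminated hε hne hu hu' (fun e => hy (e ▸ hj)) (fun e => hx (e ▸ hk)))
    obtain ⟨k1, k2, k3⟩ := he.pivots hε hne hu
    have a1 := inv_mul_of_isUnit hu
    have a2 := mul_inv_of_isUnit hu
    have q1 := inv_mul_of_isUnit hu'
    have q2 := mul_inv_of_isUnit hu'
    have r1 := h.manin x x y y
    have r2 := h.manin x y y y
    have r3 := h.manin x x x y
    have r4 := h.manin x x y x
    have eQ : schur M x y y = M y y - M y x * Ring.inverse (M x x) * M x y := rfl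
    rw [Commute, SemiconjBy]
    have k4 : e * Ring.inverse (schur M x y y) = Ring.inverse (schur M x y y) * e -
        Ring.inverse (schur M x y y) * (e * schur M x y y - schur M x y y * e) *
          Ring.inverse (schur M x y y) := by
      linear_combination (norm := noncomm_ring)
        -(q1 * e * Ring.inverse (schur M x y y)) + Ring.inverse (schur M x y y) * e * q2
    generalize schur M x y y = Q at *
    generalize Ring.inverse (M x x) = A' at *
    generalize Ring.inverse Q = Q' at *
    generalize M x x = A at *
    generalize M x y = β at *
    generalize M y x = γ at *
    generalize M y y = D at *
    -- The indices `x` and `y` are both even, even and odd, or both odd. For an even and an odd index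
    -- the product of the two pivots commutes with `e` without any Manin relation.
    rcases hs x with hx' | hx' <;> rcases hs y with hy' | hy' <;>
      simp only [hx', hy', if_true, if_false, one_ne_zero] at * <;> norm_num at r1 r2 r3 r4 k1 k2 k3 ⊢
    · have r2' : D * β = β * D := sub_eq_zero.1 (two _ (by
        linear_combination (norm := noncomm_ring) -r2))
      have r4' : A * γ = γ * A := sub_eq_zero.1 (two _ (by
        linear_combination (norm := noncomm_ring) r4))
      subst eQ
      have c1 : A * (D - γ * A' * β) * A' * β = β * (D - γ * A' * β) := by
        linear_combination (norm := noncomm_ring) r1 * A' * β + D * a2 * β + r2'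
          - r4' * A' * β * A' * β - γ * a2 * β * A' * β
      calc e * (A * (D - γ * A' * β)) = (e * A) * (D - γ * A' * β) := by noncomm_ring
        _ = A * (e * (D - γ * A' * β)) - β * (D - γ * A' * β) := by rw [k1]; noncomm_ring
        _ = A * (D - γ * A' * β) * e + (A * (D - γ * A' * β) * A' * β - β * (D - γ * A' * β)) := by
          rw [k3]; noncomm_ring
        _ = _ := by rw [c1, sub_self, add_zero]
    · linear_combination (norm := noncomm_ring) k1 * Q' + A * k4 - A * Q' * k3 * Q'
        + A * q1 * A' * β * Q' + a2 * β * Q'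
    · omega
    · have r3' : A * β = β * A := sub_eq_zero.1 (two _ (by
        linear_combination (norm := noncomm_ring) r3))
      have c1 : A' * β = β * A' := by
        linear_combination (norm := noncomm_ring) -A' * β * a2 - A' * r3' * A' + a1 * β * A'
      linear_combination (norm := noncomm_ring) k2 * Q' + A' * k4 - A' * Q' * k3 * Q'
        - A' * q1 * A' * β * Q' - A' * c1 * Q'

end Commutation

/-! ### Coefficients of compositions of symbols -/

section SymbolCoefficients

variable {A : Type*} [Ring A] [Algebra ℂ A]

theorem symbMul_coeff_eq {n m : ℤ} {f g : Symb A} (hf : f ∈ fil n) (hg : g ∈ fil m) {x : ℤ × ℤ}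
    {T : ℕ} (h : x.2 < n + m + T) :
    (symbMul f g).coeff x = ∑ t ∈ Finset.range T, (starTerm f g t).coeff x := by
  have := symbMul_sub_mem hf hg T x h
  rwa [HahnSeries.coeff_sub, sub_eq_zero, starSum, HahnSeries.coeff_sum] at this

theorem dXi_pow_coeff (t : ℕ) (x : ℤ × ℤ) :
    ∃ c : ℂ, ∀ f : Symb A, ((dXi ^ t) f).coeff x = c • f.coeff (x.1, x.2 - t) := by
  induction t generalizing x with
  | zero => exact ⟨1, fun f => by simp⟩
  | succ t ih =>
    obtain ⟨c, hc⟩ := ih (x.1, x.2 - 1)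
    refine ⟨((1 - x.2 : ℤ) : ℂ) * c, fun f => ?_⟩
    rw [pow_succ', Module.End.mul_apply, dXi_coeff, hc, smul_smul]
    congr 3
    push_cast
    ring

theorem dZ_pow_coeff (t : ℕ) (x : ℤ × ℤ) :
    ∃ c : ℂ, ∀ f : Symb A, ((dZ ^ t) f).coeff x = c • f.coeff (x.1 - t, x.2) := by
  induction t generalizing x with
  | zero => exact ⟨1, fun f => by simp⟩
  | succ t ih =>
    obtain ⟨c, hc⟩ := ih (x.1 - 1, x.2)
    refine ⟨((1 - x.1 : ℤ) : ℂ) * c, fun f => ?_⟩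
    rw [pow_succ', Module.End.mul_apply, dZ_coeff, hc, smul_smul]
    congr 3
    push_cast
    ring

/-- The coefficient of a composition at `x` lies in a subspace if the products of the coefficients
that contribute to it do. -/
theorem symbMul_coeff_mem (S : Submodule ℂ A) {f g : Symb A} {x : ℤ × ℤ}
    (h : ∀ (y w : ℤ × ℤ) (t : ℕ), y.1 + w.1 + t = x.1 → y.2 + w.2 + t = x.2 →
      f.coeff y * g.coeff w ∈ S) : (symbMul f g).coeff x ∈ S := by
  obtain ⟨n, hf⟩ := exists_fil f
  obtain ⟨m, hg⟩ := exists_fil g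
  rw [symbMul_coeff_eq hf hg (T := (x.2 - (n + m) + 1).toNat) (by omega)]
  refine S.sum_mem fun t _ => ?_
  rw [starTerm, HahnSeries.coeff_smul, HahnSeries.coeff_mul]
  refine S.smul_mem _ (S.sum_mem fun yw hyw => ?_)
  rw [Finset.mem_antidiagonal] at hyw
  obtain ⟨c, hc⟩ := dXi_pow_coeff (A := A) t yw.1
  obtain ⟨c', hc'⟩ := dZ_pow_coeff (A := A) t yw.2
  rw [hc, hc', smul_mul_assoc, mul_smul_comm]
  have h1 := congrArg Prod.fst hyw.2.2
  have h2 := congrArg Prod.snd hyw.2.2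
  simp only [Prod.fst_add, Prod.snd_add] at h1 h2
  exact S.smul_mem _ (S.smul_mem _ (h _ _ t (by simp only; omega) (by simp only; omega)))

end SymbolCoefficients

/-! ### Change of the coefficient algebra of pseudo-differential operators -/

section PDOFunctoriality

variable {A A' : Type*} [Ring A] [Algebra ℂ A] [Ring A'] [Algebra ℂ A'] (φ : A →ₐ[ℂ] A')

/-- Application of an algebra homomorphism to the coefficients of a symbol. -/
def symbMap (f : Symb A) : Symb A' where
  coeff x := φ (f.coeff x)
  isPWO_support' := f.isPWO_support.mono fun x hx h => hx (by simp [h])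

theorem symbMap_coeff (f : Symb A) (x : ℤ × ℤ) : (symbMap φ f).coeff x = φ (f.coeff x) := rfl

theorem symbMap_mem_fil {n : ℤ} {f : Symb A} (hf : f ∈ fil n) : symbMap φ f ∈ fil n :=
  fun x hx => by rw [symbMap_coeff, hf x hx, map_zero]

theorem symbMap_mul (f g : Symb A) : symbMap φ (f * g) = symbMap φ f * symbMap φ g := by
  have h := HahnSeries.map_mul (φ : A →ₙ+* A') (x := f) (y := g)
  exact h

theorem symbMap_dXi (f : Symb A) (t : ℕ) : symbMap φ ((dXi ^ t) f) = (dXi ^ t) (symbMap φ f) := by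
  induction t with
  | zero => simp
  | succ t ih =>
    rw [pow_succ', pow_succ', Module.End.mul_apply, Module.End.mul_apply, ← ih]
    ext x
    simp only [symbMap_coeff, dXi_coeff, map_smul]

theorem symbMap_dZ (f : Symb A) (t : ℕ) : symbMap φ ((dZ ^ t) f) = (dZ ^ t) (symbMap φ f) := by
  induction t with
  | zero => simp
  | succ t ih =>
    rw [pow_succ', pow_succ', Module.End.mul_apply, Module.End.mul_apply, ← ih]
    ext x
    simp only [symbMap_coeff, dZ_coeff, map_smul]

theorem symbMap_starTerm (f g : Symb A) (t : ℕ) :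
    symbMap φ (starTerm f g t) = starTerm (symbMap φ f) (symbMap φ g) t := by
  rw [starTerm, starTerm, ← symbMap_dXi, ← symbMap_dZ, ← symbMap_mul]
  ext x
  simp only [symbMap_coeff, HahnSeries.coeff_smul, map_smul]

theorem symbMap_symbMul (f g : Symb A) :
    symbMap φ (symbMul f g) = symbMul (symbMap φ f) (symbMap φ g) := by
  ext x
  obtain ⟨n, hf⟩ := exists_fil f
  obtain ⟨m, hg⟩ := exists_fil g
  have hT : x.2 < n + m + (x.2 - (n + m) + 1).toNat := by omega
  rw [symbMap_coeff, symbMul_coeff_eq hf hg hT, symbMul_coeff_eq (symbMap_mem_fil φ hf)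
    (symbMap_mem_fil φ hg) hT, map_sum]
  exact Finset.sum_congr rfl fun t _ => by rw [← symbMap_starTerm, symbMap_coeff]

/-- The ring homomorphism `A((z⁻¹, ∂⁻¹)) → A'((z⁻¹, ∂⁻¹))` induced by `φ`. -/
def PDO.map : PDO A →+* PDO A' where
  toFun f := symbMap φ f
  map_one' := by
    show symbMap φ (1 : Symb A) = (1 : Symb A')
    ext x
    rw [symbMap_coeff, HahnSeries.coeff_one, HahnSeries.coeff_one, apply_ite φ, map_one, map_zero]
  map_zero' := by
    exact HahnSeries.ext (funext fun x => map_zero φ)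
  map_add' f g := by
    exact HahnSeries.ext (funext fun x => map_add φ _ _)
  map_mul' f g := symbMap_symbMul φ f g

theorem PDO.map_coeff (f : PDO A) (i j : ℤ) : (PDO.map φ f).coeff i j = φ (f.coeff i j) := rfl

end PDOFunctoriality

/-! ### Left ideals of pseudo-differential operators -/

section PDOIdeals

variable {A : Type*} [Ring A] [Algebra ℂ A]

theorem PDO.ext_coeff {f g : PDO A} (h : ∀ i j, f.coeff i j = g.coeff i j) : f = g := by
  refine HahnSeries.ext (funext fun x => ?_)
  have := h (-x.1) (-x.2)
  simpa [PDO.coeff] using this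

theorem PDO.add_coeff (f g : PDO A) (i j : ℤ) : (f + g).coeff i j = f.coeff i j + g.coeff i j := rfl

theorem PDO.sub_coeff (f g : PDO A) (i j : ℤ) : (f - g).coeff i j = f.coeff i j - g.coeff i j :=
  HahnSeries.coeff_sub ..

theorem PDO.zero_coeff (i j : ℤ) : (0 : PDO A).coeff i j = 0 := rfl

theorem PDO.two_torsion_free (f : PDO A) (h : f + f = 0) : f = 0 := by
  refine PDO.ext_coeff fun i j => ?_
  have := congrArg (fun f => PDO.coeff f i j) h
  simp only [PDO.add_coeff, PDO.zero_coeff] at this ⊢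
  have h2 : (2 : ℂ) • f.coeff i j = 0 := by rw [two_smul]; exact this
  exact (smul_eq_zero.1 h2).resolve_left two_ne_zero

/-- The coefficient of a composition lies in a subspace if all the products of coefficients do. -/
theorem PDO.mul_coeff_mem (S : Submodule ℂ A) {f g : PDO A}
    (h : ∀ i j k l, f.coeff i j * g.coeff k l ∈ S) (i j : ℤ) : (f * g).coeff i j ∈ S := by
  refine symbMul_coeff_mem S (f := f) (g := g) fun y w t _ _ => ?_
  have := h (-y.1) (-y.2) (-w.1) (-w.2)
  simpa [PDO.coeff] using this

/-- The pseudo-differential operators with coefficients in a left ideal form a left ideal. -/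
def PDO.leftIdeal (J : Submodule A A) : Submodule (PDO A) (PDO A) where
  carrier := {f | ∀ i j, f.coeff i j ∈ J}
  add_mem' hf hg i j := J.add_mem (hf i j) (hg i j)
  zero_mem' _ _ := J.zero_mem
  smul_mem' _ _ hg i j := PDO.mul_coeff_mem (J.restrictScalars ℂ)
    (fun _ _ _ _ => J.smul_mem _ (hg _ _)) i j

theorem symbMul_dpow_coeff (f : Symb A) (r i j : ℤ) :
    (symbMul f (HahnSeries.single (-0, -r) 1)).coeff (-i, -j) = f.coeff (-i, -(j - r)) := by
  rw [symbMul_eq_mul _ _ (Or.inr (by simpa using dZ_pow_single (1 : A) 0 r 1)),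
    HahnSeries.coeff_mul_single, mul_one]
  congr 1
  ext <;> simp
  ring

/-- Multiplication by `∂^j` shifts the coefficients. -/
theorem PDO.mul_dpow_coeff (f : PDO A) (r i j : ℤ) :
    (f * PDO.dpow A r).coeff i j = f.coeff i (j - r) :=
  symbMul_dpow_coeff f r i j

theorem PDO.mul_dpow_mem (J : Submodule A A) {f : PDO A} (hf : f ∈ PDO.leftIdeal J) (r : ℤ) :
    f * PDO.dpow A r ∈ PDO.leftIdeal J := fun i j => by
  rw [PDO.mul_dpow_coeff]
  exact hf _ _

end PDOIdeals

/-! ### Operators of negative order and differential operators -/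

section Subrings

variable (A : Type*) [Ring A] [Algebra ℂ A]

omit [Algebra ℂ A] in
theorem one_coeff_of_ne {x : ℤ × ℤ} (hx : x ≠ 0) : (1 : Symb A).coeff x = 0 := by
  rw [HahnSeries.coeff_one, if_neg hx]

/-- The operators in nonpositive powers of `z` and negative powers of `∂`. -/
def PDO.negative : NonUnitalSubring (PDO A) where
  carrier := {f | ∀ i j : ℤ, 0 < i ∨ 0 ≤ j → f.coeff i j = 0}
  add_mem' hf hg i j h := by rw [PDO.add_coeff, hf i j h, hg i j h, add_zero]
  zero_mem' _ _ _ := rfl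
  neg_mem' {f} hf i j h := by
    have : (-f).coeff i j = -f.coeff i j := rfl
    rw [this, hf i j h, neg_zero]
  mul_mem' {f g} hf hg i j h := by
    have : (f * g).coeff i j ∈ (⊥ : Submodule ℂ A) := by
      refine symbMul_coeff_mem ⊥ (f := f) (g := g) fun y w t h1 h2 => ?_
      by_cases hy : 0 < -y.1 ∨ 0 ≤ -y.2
      · have := hf (-y.1) (-y.2) hy
        simp only [PDO.coeff, neg_neg] at this
        rw [this, zero_mul]; rfl
      · have := hg (-w.1) (-w.2) (by simp only at h1 h2; omega)
        simp only [PDO.coeff, neg_neg] at this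
        rw [this, mul_zero]; rfl
    simpa using this

variable {A} in
/-- The composition of operators without negative powers of `∂` is of the same kind, because
`∂^j` is annihilated by more than `j` derivatives with respect to `∂`. -/
theorem symbMul_coeff_of_differential {f g : Symb A} (hf : ∀ x : ℤ × ℤ, 0 < x.2 → f.coeff x = 0)
    (hg : ∀ x : ℤ × ℤ, 0 < x.2 → g.coeff x = 0) {x : ℤ × ℤ} (hx : 0 < x.2) :
    (symbMul f g).coeff x = 0 := by
  obtain ⟨n, hn⟩ := exists_fil f
  obtain ⟨m, hm⟩ := exists_fil g
  have hd : ∀ (t : ℕ) (x : ℤ × ℤ), 0 < x.2 → ((dXi ^ t) f).coeff x = 0 := by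
    intro t
    induction t with
    | zero => exact hf
    | succ t ih =>
      intro x hx
      rw [pow_succ', Module.End.mul_apply, dXi_coeff]
      by_cases h1 : x.2 = 1
      · simp [h1]
      · rw [ih _ (by simp only; omega), smul_zero]
  rw [symbMul_coeff_eq hn hm (T := (x.2 - (n + m) + 1).toNat) (by omega)]
  refine Finset.sum_eq_zero fun t _ => ?_
  rw [starTerm, HahnSeries.coeff_smul, HahnSeries.coeff_mul, Finset.sum_eq_zero, smul_zero]
  intro yw hyw
  rw [Finset.mem_antidiagonal] at hyw
  have h2 := congrArg Prod.snd hyw.2.2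
  simp only [Prod.snd_add] at h2
  by_cases hy : 0 < yw.1.2
  · rw [hd t _ hy, zero_mul]
  · obtain ⟨c, hc⟩ := dZ_pow_coeff (A := A) t yw.2
    rw [hc, hg _ (by simp only; omega), smul_zero, mul_zero]

/-- The differential operators, i.e. the operators without negative powers of `∂`. -/
def PDO.differential : Subring (PDO A) where
  carrier := {f | ∀ i j : ℤ, j < 0 → f.coeff i j = 0}
  add_mem' hf hg i j h := by rw [PDO.add_coeff, hf i j h, hg i j h, add_zero]
  zero_mem' _ _ _ := rfl
  one_mem' i j h := one_coeff_of_ne A fun e => by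
    have := congrArg Prod.snd e
    simp at this
    omega
  neg_mem' {f} hf i j h := by
    have : (-f).coeff i j = -f.coeff i j := rfl
    rw [this, hf i j h, neg_zero]
  mul_mem' {f g} hf hg i j h := by
    refine symbMul_coeff_of_differential (f := f) (g := g) (fun x hx => ?_) (fun x hx => ?_) (by
      simp only; omega)
    · have := hf (-x.1) (-x.2) (by omega)
      simpa [PDO.coeff] using this
    · have := hg (-x.1) (-x.2) (by omega)
      simpa [PDO.coeff] using this

variable {A}

theorem PDO.pow_mem_fil {k : PDO A} (hk : k ∈ PDO.negative A) (t : ℕ) :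
    (k ^ t : PDO A) ∈ fil (A := A) (t : ℤ) := by
  induction t with
  | zero =>
    rw [pow_zero]
    intro x hx
    exact one_coeff_of_ne A fun e => by simp [e] at hx
  | succ t ih =>
    rw [pow_succ]
    have h1 : k ∈ fil (A := A) 1 := fun x hx => by
      have := hk (-x.1) (-x.2) (by omega)
      simpa [PDO.coeff] using this
    have := symbMul_mem (A := A) ih h1
    push_cast
    exact this

theorem PDO.sum_coeff {ι : Type*} (s : Finset ι) (f : ι → PDO A) (i j : ℤ) :
    (∑ t ∈ s, f t).coeff i j = ∑ t ∈ s, (f t).coeff i j :=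
  HahnSeries.coeff_sum ..

theorem PDO.one_coeff (i j : ℤ) : (1 : PDO A).coeff i j = if i = 0 ∧ j = 0 then 1 else 0 := by
  refine (HahnSeries.coeff_one (Γ := ℤ × ℤ) (R := A)).trans ?_
  simp only [Prod.ext_iff, Prod.fst_zero, Prod.snd_zero, neg_eq_zero]

theorem PDO.pow_succ_mem_negative {k : PDO A} (hk : k ∈ PDO.negative A) (t : ℕ) :
    k ^ (t + 1) ∈ PDO.negative A := by
  induction t with
  | zero => simpa using hk
  | succ t ih => rw [pow_succ]; exact mul_mem ih hk

theorem PDO.sum_pow_coeff {k : PDO A} (hk : k ∈ PDO.negative A) (T : ℕ) {i j : ℤ}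
    (h : 0 < i ∨ 0 ≤ j) :
    (∑ t ∈ Finset.range (T + 1), k ^ t).coeff i j = (1 : PDO A).coeff i j := by
  rw [Finset.sum_range_succ', PDO.add_coeff, PDO.sum_coeff, Finset.sum_eq_zero, zero_add, pow_zero]
  exact fun t _ => PDO.pow_succ_mem_negative hk t i j h

/-- The geometric series `∑_t k^t`. Since `k^t` has order at most `-t`, the coefficients at `∂^j`
involve only the powers with `t ≤ -j`; each coefficient is taken from such a finite sum. -/
def PDO.geom {k : PDO A} (hk : k ∈ PDO.negative A) : PDO A :=
  show HahnSeries (ℤ × ℤ) A from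
  { coeff := fun x => (∑ t ∈ Finset.range (x.2.toNat + 1), k ^ t).coeff (-x.1) (-x.2)
    isPWO_support' := by
      rw [isPWO_iff]
      refine ⟨0, 0, fun x hx => ?_⟩
      by_contra hlt
      refine hx ((PDO.sum_pow_coeff hk _ (by omega)).trans ?_)
      rw [PDO.one_coeff, if_neg (by omega)] }

theorem PDO.geom_coeff {k : PDO A} (hk : k ∈ PDO.negative A) (i j : ℤ) :
    (PDO.geom hk).coeff i j = (∑ t ∈ Finset.range ((-j).toNat + 1), k ^ t).coeff i j := by
  have : (PDO.geom hk).coeff i j =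
    (∑ t ∈ Finset.range ((-j).toNat + 1), k ^ t).coeff (- -i) (- -j) := rfl
  rw [this, neg_neg, neg_neg]

theorem PDO.geom_sub_mem {k : PDO A} (hk : k ∈ PDO.negative A) (T : ℕ) :
    (PDO.geom hk - ∑ t ∈ Finset.range T, k ^ t : PDO A) ∈ fil (A := A) (T : ℤ) := by
  intro x hx
  have h : (PDO.geom hk - ∑ t ∈ Finset.range T, k ^ t : PDO A).coeff (-x.1) (-x.2) = 0 := by
    have hz : ∀ t : ℕ, x.2 < t → (k ^ t : PDO A).coeff (-x.1) (-x.2) = 0 := fun t ht => by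
      have := PDO.pow_mem_fil hk t x ht
      simpa [PDO.coeff] using this
    rw [PDO.sub_coeff, PDO.geom_coeff, neg_neg, PDO.sum_coeff, PDO.sum_coeff, sub_eq_zero]
    by_cases hT : x.2.toNat + 1 ≤ T
    · refine Finset.sum_subset (Finset.range_mono hT) fun t _ ht => hz t ?_
      rw [Finset.mem_range] at ht
      omega
    · refine (Finset.sum_subset (Finset.range_mono (by omega)) fun t _ ht => hz t ?_).symm
      rw [Finset.mem_range] at ht
      omega
  simpa [PDO.coeff] using h

theorem PDO.eq_of_fil {f g : PDO A} (h : ∀ T : ℕ, (f - g : PDO A) ∈ fil (A := A) (T : ℤ)) :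
    f = g :=
  Gaudin.eq_of_fil (A := A) 0 fun T => by rw [zero_add]; exact h T

/-- The inverse of `1 + k` is a geometric series, which converges because the order of the powers of
`k` decreases. -/
theorem PDO.quasiRegular_negative : QuasiRegular (PDO.negative A) := by
  intro k hk
  have hn : -k ∈ PDO.negative A := neg_mem hk
  have h1 : (1 + k : PDO A) ∈ fil (A := A) 0 := by
    intro x hx
    have : (1 + k : PDO A).coeff (-x.1) (-x.2) = 0 := by
      rw [PDO.add_coeff, hk _ _ (by omega), PDO.one_coeff, if_neg (by omega), add_zero]
    simpa [PDO.coeff] using this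
  have hpow : ∀ T : ℕ, (-(-k) ^ T : PDO A) ∈ fil (A := A) (T : ℤ) := fun T =>
    (fil (A := A) (T : ℤ)).neg_mem (PDO.pow_mem_fil hn T)
  have e1 : (1 + k) * PDO.geom hn = 1 := PDO.eq_of_fil fun T => by
    have h2 := symbMul_mem (A := A) h1 (PDO.geom_sub_mem hn T)
    rw [zero_add] at h2
    have h3 := (fil (A := A) (T : ℤ)).add_mem h2 (hpow T)
    have e : (1 + k) * PDO.geom hn - 1 =
        (1 + k) * (PDO.geom hn - ∑ t ∈ Finset.range T, (-k) ^ t) + -(-k) ^ T := by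
      have := mul_neg_geom_sum (-k) T
      rw [sub_neg_eq_add] at this
      rw [mul_sub, this]
      abel
    rw [e]
    exact h3
  have e2 : PDO.geom hn * (1 + k) = 1 := PDO.eq_of_fil fun T => by
    have h2 := symbMul_mem (A := A) (PDO.geom_sub_mem hn T) h1
    rw [add_zero] at h2
    have h3 := (fil (A := A) (T : ℤ)).add_mem h2 (hpow T)
    have e : PDO.geom hn * (1 + k) - 1 =
        (PDO.geom hn - ∑ t ∈ Finset.range T, (-k) ^ t) * (1 + k) + -(-k) ^ T := by
      have := geom_sum_mul_neg (-k) T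
      rw [sub_neg_eq_add] at this
      rw [sub_mul, this]
      abel
    rw [e]
    exact h3
  refine ⟨PDO.geom hn - 1, fun i j h => ?_, by rwa [add_sub_cancel], by rwa [add_sub_cancel]⟩
  rw [PDO.sub_coeff, PDO.geom_coeff, PDO.sum_pow_coeff hn _ h, sub_self]

end Subrings

/-! ### Subrings and left ideals of power series -/

section PowerSeriesSubrings

variable {R : Type*} [Ring R]

/-- The power series without constant term whose coefficients lie in a subring. -/
def augmentation (S : Subring R) : NonUnitalSubring (PowerSeries R) where
  carrier := {f | PowerSeries.coeff 0 f = 0 ∧ ∀ i, PowerSeries.coeff i f ∈ S}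
  add_mem' hf hg := ⟨by rw [map_add, hf.1, hg.1, add_zero], fun i => by
    rw [map_add]; exact S.add_mem (hf.2 i) (hg.2 i)⟩
  zero_mem' := ⟨map_zero _, fun i => by rw [map_zero]; exact S.zero_mem⟩
  neg_mem' hf := ⟨by rw [map_neg, hf.1, neg_zero], fun i => by
    rw [map_neg]; exact S.neg_mem (hf.2 i)⟩
  mul_mem' hf hg := ⟨by simp [PowerSeries.coeff_mul, hf.1], fun i => by
    rw [PowerSeries.coeff_mul]
    exact S.sum_mem fun x _ => S.mul_mem (hf.2 _) (hg.2 _)⟩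

theorem quasiRegular_augmentation (S : Subring R) : QuasiRegular (augmentation S) := by
  intro k hk
  -- The inverse is computed over the subring.
  let k₀ : PowerSeries S := PowerSeries.mk fun i => ⟨PowerSeries.coeff i k, hk.2 i⟩
  have hc : PowerSeries.constantCoeff (1 + k₀) = ((1 : Sˣ) : S) := by
    have : PowerSeries.constantCoeff k₀ = 0 := by
      rw [← PowerSeries.coeff_zero_eq_constantCoeff_apply, PowerSeries.coeff_mk]
      exact Subtype.ext hk.1
    rw [map_add, map_one, this, add_zero, Units.val_one]
  have h1 := PowerSeries.mul_invOfUnit (1 + k₀) 1 hc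
  have h2 := PowerSeries.invOfUnit_mul (1 + k₀) 1 hc
  have h0 := PowerSeries.constantCoeff_invOfUnit (1 + k₀) 1
  set v := PowerSeries.invOfUnit (1 + k₀) 1
  have e : PowerSeries.map S.subtype k₀ = k := by
    ext i
    simp [k₀]
  have g1 := congrArg (PowerSeries.map S.subtype) h1
  have g2 := congrArg (PowerSeries.map S.subtype) h2
  rw [map_mul, map_add, map_one, e] at g1 g2
  refine ⟨PowerSeries.map S.subtype v - 1, ⟨?_, fun i => ?_⟩, by rwa [add_sub_cancel],
    by rwa [add_sub_cancel]⟩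
  · rw [map_sub, PowerSeries.coeff_map, PowerSeries.coeff_zero_eq_constantCoeff_apply, h0,
      PowerSeries.coeff_zero_one]
    simp
  · rw [map_sub, PowerSeries.coeff_map]
    refine S.sub_mem (Subtype.prop _) ?_
    rw [PowerSeries.coeff_one]
    split_ifs
    exacts [S.one_mem, S.zero_mem]

/-- The power series with coefficients in a left ideal form a left ideal. -/
def powerSeriesLeftIdeal (J : Submodule R R) : Submodule (PowerSeries R) (PowerSeries R) where
  carrier := {f | ∀ i, PowerSeries.coeff i f ∈ J}
  add_mem' hf hg i := by rw [map_add]; exact J.add_mem (hf i) (hg i)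
  zero_mem' i := by rw [map_zero]; exact J.zero_mem
  smul_mem' f g hg i := by
    rw [smul_eq_mul, PowerSeries.coeff_mul]
    exact J.sum_mem fun x _ => J.smul_mem _ (hg _)

theorem PowerSeries.two_torsion_free (h : ∀ x : R, x + x = 0 → x = 0) (f : PowerSeries R)
    (hf : f + f = 0) : f = 0 := by
  ext i
  have := congrArg (PowerSeries.coeff i) hf
  rw [map_add, map_zero] at this
  rw [h _ this, map_zero]

end PowerSeriesSubrings

/-! ### The Manin relations of a Lax matrix -/

section Lax

/-- Elements that generate a copy of the Gaudin Lax matrix: `D` plays the role of `∂`, `q a` that of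
`1 / (z - z_a)`, and `g a i j` that of `E_ij^{(a)}`. -/
structure LaxData {B : Type*} [Ring B] {I : Type*} [DecidableEq I] {ℓ : ℕ} (s : I → ℕ) (D : B)
    (q : Fin ℓ → B) (g : Fin ℓ → I → I → B) : Prop where
  same : ∀ a i j k l, g a i j * g a k l - (-1) ^ ((s i + s j) * (s k + s l)) * (g a k l * g a i j) =
    (if j = k then g a i l else 0)
      - (-1) ^ ((s i + s j) * (s k + s l)) * (if l = i then g a k j else 0)
  diff : ∀ a b, a ≠ b → ∀ i j k l,
    g a i j * g b k l = (-1) ^ ((s i + s j) * (s k + s l)) * (g b k l * g a i j)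
  comm_q : ∀ a b, q a * q b = q b * q a
  comm_g : ∀ a b i j, q a * g b i j = g b i j * q a
  comm_D : ∀ b i j, D * g b i j = g b i j * D
  deriv : ∀ a, D * q a = q a * D - q a * q a

namespace LaxData

variable {B : Type*} [Ring B] {I : Type*} [DecidableEq I] {ℓ : ℕ} {s : I → ℕ} {D : B}
  {q : Fin ℓ → B} {g : Fin ℓ → I → I → B}

/-- `∑_a g_ij^{(a)} q_a`. -/
def cur (q : Fin ℓ → B) (g : Fin ℓ → I → I → B) (i j : I) : B := ∑ a, g a i j * q a

/-- `∑_a g_ij^{(a)} q_a²`, which is minus the derivative of `cur`. -/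
def cur₂ (q : Fin ℓ → B) (g : Fin ℓ → I → I → B) (i j : I) : B := ∑ a, g a i j * (q a * q a)

theorem comm_cur (h : LaxData s D q g) (i j : I) : D * cur q g i j = cur q g i j * D - cur₂ q g i j := by
  rw [cur, cur₂, Finset.mul_sum, Finset.sum_mul, ← Finset.sum_sub_distrib]
  refine Finset.sum_congr rfl fun a _ => ?_
  rw [← mul_assoc, h.comm_D, mul_assoc, h.deriv]
  noncomm_ring

/-- The supercommutators at a single point `z`: only the terms with both factors in the same tensor
factor contribute, which gives `q_a²`. -/
theorem cur_bracket (h : LaxData s D q g) (i j k l : I) :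
    cur q g i j * cur q g k l
      - (-1) ^ ((s i + s j) * (s k + s l)) * (cur q g k l * cur q g i j) =
    (if j = k then cur₂ q g i l else 0)
      - (-1) ^ ((s i + s j) * (s k + s l)) * (if l = i then cur₂ q g k j else 0) := by
  set θ : B := (-1) ^ ((s i + s j) * (s k + s l)) with hθ
  have hθc : ∀ x : B, x * θ = θ * x := fun x =>
    ((Commute.neg_one_right x).pow_right _).eq
  have e1 : cur q g i j * cur q g k l - θ * (cur q g k l * cur q g i j) =
      ∑ a, ∑ b, (g a i j * g b k l - θ * (g b k l * g a i j)) * (q a * q b) := by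
    have e2 : cur q g i j * cur q g k l = ∑ a, ∑ b, g a i j * g b k l * (q a * q b) := by
      rw [cur, cur, Finset.sum_mul_sum]
      refine Finset.sum_congr rfl fun a _ => Finset.sum_congr rfl fun b _ => ?_
      calc g a i j * q a * (g b k l * q b) = g a i j * (q a * g b k l) * q b := by noncomm_ring
        _ = _ := by rw [h.comm_g]; noncomm_ring
    have e3 : cur q g k l * cur q g i j = ∑ a, ∑ b, g b k l * g a i j * (q a * q b) := by
      rw [cur, cur, Finset.sum_mul_sum, Finset.sum_comm]
      refine Finset.sum_congr rfl fun a _ => Finset.sum_congr rfl fun b _ => ?_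
      calc g b k l * q b * (g a i j * q a) = g b k l * (q b * g a i j) * q a := by noncomm_ring
        _ = g b k l * g a i j * (q b * q a) := by rw [h.comm_g]; noncomm_ring
        _ = _ := by rw [h.comm_q]
    rw [e2, e3, Finset.mul_sum, ← Finset.sum_sub_distrib]
    refine Finset.sum_congr rfl fun a _ => ?_
    rw [Finset.mul_sum, ← Finset.sum_sub_distrib]
    refine Finset.sum_congr rfl fun b _ => ?_
    noncomm_ring
  rw [e1]
  have e4 : ∀ a, ∑ b, (g a i j * g b k l - θ * (g b k l * g a i j)) * (q a * q b) =
      ((if j = k then g a i l else 0) - θ * (if l = i then g a k j else 0)) * (q a * q a) := by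
    intro a
    rw [Finset.sum_eq_single a, h.same]
    · intro b _ hb
      rw [h.diff a b hb.symm, sub_self, zero_mul]
    · simp
  rw [Finset.sum_congr rfl fun a _ => e4 a]
  simp only [sub_mul, Finset.sum_sub_distrib, mul_assoc, ← Finset.mul_sum, cur₂]
  congr 2 <;> split_ifs <;> simp

/-- The matrix with entries `δ_ij D - (-1)^{|i|} cur_ij`. -/
def lax (s : I → ℕ) (D : B) (q : Fin ℓ → B) (g : Fin ℓ → I → I → B) : Matrix I I B :=
  fun i j => (if i = j then D else 0) - (-1) ^ s i * cur q g i j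

/-- The supercommutators of the entries of the Lax matrix: the terms with a diagonal entry involve
the commutator of `D` with the currents. -/
theorem lax_bracket (hs : ∀ i, s i = 0 ∨ s i = 1) (h : LaxData s D q g) (i j k l : I) :
    lax s D q g i j * lax s D q g k l
      - (-1) ^ ((s i + s j) * (s k + s l)) * (lax s D q g k l * lax s D q g i j) =
    (if i = j then (-1) ^ s k * cur₂ q g k l else 0)
      - (if k = l then (-1) ^ s i * cur₂ q g i j else 0)
      + (-1) ^ (s i + s k) * ((if j = k then cur₂ q g i l else 0)
        - (-1) ^ ((s i + s j) * (s k + s l)) * (if l = i then cur₂ q g k j else 0)) := by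
  rw [← h.cur_bracket i j k l]
  have d1 := h.comm_cur i j
  have d2 := h.comm_cur k l
  simp only [lax]
  generalize cur q g i j = X at *
  generalize cur q g k l = Y at *
  generalize cur₂ q g i j = X' at *
  generalize cur₂ q g k l = Y' at *
  by_cases hij : i = j <;> by_cases hkl : k = l
  · subst hij hkl
    rcases hs i with hi | hi <;> rcases hs k with hk | hk <;> simp [hi, hk] <;>
    · first
      | linear_combination (norm := (noncomm_ring; done)) d1 - d2
      | linear_combination (norm := (noncomm_ring; done)) d1 + d2
      | linear_combination (norm := (noncomm_ring; done)) -d1 - d2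
      | linear_combination (norm := (noncomm_ring; done)) -d1 + d2
  · subst hij
    rcases hs i with hi | hi <;> rcases hs k with hk | hk <;> rcases hs l with hl | hl <;>
      simp [hi, hk, hl, hkl] <;>
    · first
      | linear_combination (norm := (noncomm_ring; done)) d2
      | linear_combination (norm := (noncomm_ring; done)) -d2
  · subst hkl
    rcases hs i with hi | hi <;> rcases hs k with hk | hk <;> rcases hs j with hj | hj <;>
      simp [hi, hk, hj, hij] <;>
    · first
      | linear_combination (norm := (noncomm_ring; done)) d1
      | linear_combination (norm := (noncomm_ring; done)) -d1
  · rcases hs i with hi | hi <;> rcases hs k with hk | hk <;> rcases hs j with hj | hj <;>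
      rcases hs l with hl | hl <;>
      simp [hi, hk, hj, hl, hij, hkl] <;> noncomm_ring

/-- The Gaudin Lax matrix satisfies the Manin relations. -/
theorem isManin (hs : ∀ i, s i = 0 ∨ s i = 1) (h : LaxData s D q g) : IsManin s (lax s D q g) := by
  intro i j k l
  rw [h.lax_bracket hs, h.lax_bracket hs]
  have p1 : (if i = j then (-1) ^ s k * cur₂ q g k l else 0) =
      (-1) ^ (s i * s j + s i * s k + s j * s k) *
        ((-1) ^ (s k + s i) * (if j = i then cur₂ q g k l else 0)) := by
    by_cases e : i = j
    · subst e
      rcases hs i with hi | hi <;> rcases hs k with hk | hk <;> norm_num [hi, hk]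
    · simp [e, Ne.symm e]
  have p2 : (if k = l then (-1) ^ s i * cur₂ q g i j else 0) =
      (-1) ^ (s i * s j + s i * s k + s j * s k) *
        ((-1) ^ (s k + s i) * ((-1) ^ ((s k + s j) * (s i + s l)) *
          (if l = k then cur₂ q g i j else 0))) := by
    by_cases e : k = l
    · subst e
      rcases hs i with hi | hi <;> rcases hs k with hk | hk <;> rcases hs j with hj | hj <;>
        norm_num [hi, hk, hj]
    · simp [e, Ne.symm e]
  have p3 : (-1) ^ (s i + s k) * (if j = k then cur₂ q g i l else 0) =
      (-1) ^ (s i * s j + s i * s k + s j * s k) *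
        (if k = j then (-1) ^ s i * cur₂ q g i l else 0) := by
    by_cases e : j = k
    · subst e
      rcases hs i with hi | hi <;> rcases hs j with hj | hj <;> norm_num [hi, hj]
    · simp [e, Ne.symm e]
  have p4 : (-1) ^ (s i + s k) * ((-1) ^ ((s i + s j) * (s k + s l)) *
        (if l = i then cur₂ q g k j else 0)) =
      (-1) ^ (s i * s j + s i * s k + s j * s k) *
        (if i = l then (-1) ^ s k * cur₂ q g k j else 0) := by
    by_cases e : i = l
    · subst e
      rcases hs i with hi | hi <;> rcases hs k with hk | hk <;> rcases hs j with hj | hj <;>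
        norm_num [hi, hk, hj]
    · simp [e, Ne.symm e]
  rw [mul_sub ((-1) ^ (s i + s k)), p1, p2, p3, p4]
  noncomm_ring

end LaxData

end Lax

/-! ### The operators of order zero and the simple poles -/

section Constants

variable {A : Type*} [Ring A] [Algebra ℂ A]

/-- The elements of `A` as operators of order zero. -/
def PDO.C : A →+* PDO A where
  toFun a := PDO.mono a 0 0
  map_one' := rfl
  map_zero' := HahnSeries.single_eq_zero
  map_add' a b := HahnSeries.single_add ..
  map_mul' a b := by
    have h := symbMul_eq_mul (HahnSeries.single (-0, -0) a : Symb A) (HahnSeries.single (-0, -0) b)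
      (Or.inr (by simpa using dZ_pow_single b 0 0 1))
    rw [HahnSeries.single_mul_single] at h
    exact h.symm

theorem symbMul_const_left_coeff (a : A) (f : Symb A) (x : ℤ × ℤ) :
    (symbMul (HahnSeries.single (-0, -0) a) f).coeff x = a * f.coeff x := by
  rw [symbMul_eq_mul _ _ (Or.inl (by simpa using dXi_pow_single a 0 0 1)),
    HahnSeries.coeff_single_mul, show ((-0, -0) : ℤ × ℤ) = 0 by simp, sub_zero]

theorem symbMul_const_right_coeff (a : A) (f : Symb A) (x : ℤ × ℤ) :
    (symbMul f (HahnSeries.single (-0, -0) a)).coeff x = f.coeff x * a := by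
  rw [symbMul_eq_mul _ _ (Or.inr (by simpa using dZ_pow_single a 0 0 1)),
    HahnSeries.coeff_mul_single, show ((-0, -0) : ℤ × ℤ) = 0 by simp, sub_zero]

theorem PDO.C_mul_coeff (a : A) (f : PDO A) (i j : ℤ) : (PDO.C a * f).coeff i j = a * f.coeff i j :=
  symbMul_const_left_coeff a f _

theorem PDO.mul_C_coeff (a : A) (f : PDO A) (i j : ℤ) : (f * PDO.C a).coeff i j = f.coeff i j * a :=
  symbMul_const_right_coeff a f _

/-- The operator `z`. -/
def PDO.Z (A : Type*) [Ring A] [Algebra ℂ A] : PDO A := PDO.mono 1 1 0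

theorem symbMul_Z_left_coeff (f : Symb A) (x : ℤ × ℤ) :
    (symbMul (HahnSeries.single (-1, -0) 1) f).coeff x = f.coeff (x.1 + 1, x.2) := by
  rw [symbMul_eq_mul _ _ (Or.inl (by simpa using dXi_pow_single (1 : A) 1 0 1)),
    HahnSeries.coeff_single_mul, one_mul]
  congr 1
  ext <;> simp

theorem symbMul_Z_right {f : Symb A} (hf : ∀ x : ℤ × ℤ, x.2 ≠ 0 → f.coeff x = 0) :
    symbMul f (HahnSeries.single (-1, -0) 1) = symbMul (HahnSeries.single (-1, -0) 1) f := by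
  rw [symbMul_eq_mul f _ (Or.inl ?_),
    symbMul_eq_mul _ f (Or.inl (by simpa using dXi_pow_single (1 : A) 1 0 1)), single_comm]
  ext x
  rw [dXi_coeff]
  by_cases h : x.2 = 1
  · simp [h]
  · rw [hf _ (by simp only; omega), smul_zero, HahnSeries.coeff_zero]

/-- An operator without `∂` commutes with `z`. -/
theorem PDO.commute_Z {f : PDO A} (hf : ∀ i j, j ≠ 0 → f.coeff i j = 0) : Commute f (PDO.Z A) :=
  symbMul_Z_right (f := f) fun x hx => by
    have := hf (-x.1) (-x.2) (by omega)
    simpa [PDO.coeff] using this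

theorem PDO.Z_mul_coeff (f : PDO A) (i j : ℤ) : (PDO.Z A * f).coeff i j = f.coeff (i - 1) j := by
  refine (symbMul_Z_left_coeff (A := A) f _).trans ?_
  rw [PDO.coeff]
  congr 1
  ext <;> simp
  ring

theorem PDO.mono_coeff (a : A) (i j k l : ℤ) :
    (PDO.mono a i j).coeff k l = if k = i ∧ l = j then a else 0 := by
  refine (HahnSeries.coeff_single (Γ := ℤ × ℤ) ..).trans ?_
  simp only [Prod.ext_iff, neg_inj]

theorem PDO.C_coeff (a : A) (k l : ℤ) :
    (PDO.C a).coeff k l = if k = 0 ∧ l = 0 then a else 0 :=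
  PDO.mono_coeff a 0 0 k l

theorem symbMul_D_Z : symbMul (HahnSeries.single (-0, -1) 1) (HahnSeries.single (-1, -0) 1) =
    symbMul (HahnSeries.single (-1, -0) 1) (HahnSeries.single (-0, -1) 1) + (1 : Symb A) := by
  ext x
  have h1 : (HahnSeries.single (-0, -1) 1 : Symb A) ∈ fil (-1) := fun y hy =>
    HahnSeries.coeff_single_of_ne fun e => by simp [e] at hy
  have h2 : (HahnSeries.single (-1, -0) 1 : Symb A) ∈ fil 0 := fun y hy =>
    HahnSeries.coeff_single_of_ne fun e => by simp [e] at hy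
  rw [symbMul_coeff_eq h1 h2 (T := (x.2 + 1).toNat + 2) (by omega), Finset.sum_range_succ',
    Finset.sum_range_succ', Finset.sum_eq_zero]
  · rw [symbMul_eq_mul _ _ (Or.inr (by simpa using dZ_pow_single (1 : A) 0 1 1)),
      HahnSeries.single_mul_single]
    rw [starTerm_single, starTerm_single, zero_add, add_comm, HahnSeries.coeff_add]
    congr 1
    · simp
    · rw [← HahnSeries.single_zero_one]
      simp [HahnSeries.coeff_single, HahnSeries.coeff_one, Prod.ext_iff]
  · intro t _
    rw [starTerm_single]
    have : (Ring.choose (1 : ℤ) (t + 1 + 1)) = 0 := by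
      have := Ring.choose_natCast (R := ℤ) 1 (t + 1 + 1)
      rw [Nat.choose_eq_zero_of_lt (by omega)] at this
      simpa using this
    rw [this]
    simp

theorem PDO.dpow_one_mul_Z : PDO.dpow A 1 * PDO.Z A = PDO.Z A * PDO.dpow A 1 + 1 := symbMul_D_Z

theorem PDO.C_comm_dpow (a : A) (r : ℤ) : PDO.dpow A r * PDO.C a = PDO.C a * PDO.dpow A r := by
  refine PDO.ext_coeff fun i j => ?_
  rw [PDO.C_mul_coeff, PDO.mul_C_coeff, PDO.dpow, PDO.mono_coeff]
  split_ifs <;> simp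

theorem pole_coeff (a : A) (c : ℂ) (i j : ℤ) :
    (pole a c).coeff i j = if i ≤ -1 ∧ j = 0 then c ^ (-i - 1).toNat • a else 0 := by
  have : (pole a c).coeff i j = if 1 ≤ -i ∧ -j = 0 then c ^ (-i - 1).toNat • a else 0 := rfl
  rw [this]
  congr 1
  simp only [eq_iff_iff]
  omega

theorem pole_eq_C_mul (a : A) (c : ℂ) : pole a c = PDO.C a * pole 1 c := by
  refine PDO.ext_coeff fun i j => ?_
  rw [PDO.C_mul_coeff, pole_coeff, pole_coeff]
  split_ifs <;> simp

theorem Z_sub_mul_pole (c : ℂ) :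
    (PDO.Z A - PDO.C (algebraMap ℂ A c)) * pole 1 c = 1 := by
  refine PDO.ext_coeff fun i j => ?_
  rw [sub_mul, PDO.sub_coeff, PDO.Z_mul_coeff, PDO.C_mul_coeff, pole_coeff, pole_coeff,
    PDO.one_coeff]
  by_cases hj : j = 0
  · rcases lt_trichotomy i 0 with hi | rfl | hi
    · rw [if_pos (by omega), if_pos (by omega), if_neg (by omega), sub_eq_zero]
      have : (-(i - 1) - 1).toNat = (-i - 1).toNat + 1 := by omega
      rw [this, pow_succ', mul_smul, Algebra.smul_def c]
    · simp [hj]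
    · rw [if_neg (by omega), if_neg (by omega), if_neg (by omega), mul_zero, sub_zero]
  · rw [if_neg (by omega), if_neg (by omega), if_neg (by omega), mul_zero, sub_zero]

theorem commute_const (f : PDO A) (c : ℂ) : Commute f (PDO.C (algebraMap ℂ A c)) := by
  refine PDO.ext_coeff fun i j => ?_
  rw [PDO.C_mul_coeff, PDO.mul_C_coeff, Algebra.commutes]

theorem pole_mul_Z_sub (c : ℂ) :
    pole 1 c * (PDO.Z A - PDO.C (algebraMap ℂ A c)) = 1 := by
  rw [← Z_sub_mul_pole c]
  refine Commute.sub_right (PDO.commute_Z fun i j hj => ?_) (commute_const _ _)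
  rw [pole_coeff, if_neg (by omega)]

theorem commute_pole_of_commute {x : PDO A} {c : ℂ} (h : Commute x (PDO.Z A)) :
    Commute x (pole 1 c) := by
  have h' : Commute x (PDO.Z A - PDO.C (algebraMap ℂ A c)) := h.sub_right (commute_const _ _)
  exact h'.units_inv_right (u := ⟨_, pole 1 c, Z_sub_mul_pole c, pole_mul_Z_sub c⟩)

theorem dpow_one_mul_pole (c : ℂ) : PDO.dpow A 1 * pole 1 c =
    pole 1 c * PDO.dpow A 1 - pole 1 c * pole 1 c := by
  have h1 := Z_sub_mul_pole (A := A) c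
  have h2 := pole_mul_Z_sub (A := A) c
  have h3 := PDO.dpow_one_mul_Z (A := A)
  have h4 := (commute_const (PDO.dpow A 1) c).eq
  linear_combination (norm := noncomm_ring) -(h2 * PDO.dpow A 1 * pole 1 c)
    + pole 1 c * PDO.dpow A 1 * h1 - pole 1 c * h3 * pole 1 c + pole 1 c * h4 * pole 1 c

end Constants

/-! ### The Gaudin Lax matrix -/

section LaxMatrix

variable {m n ℓ : ℕ}

theorem par_cases (i : Idx m n) : par i = 0 ∨ par i = 1 := by rcases i with i | i <;> simp [par]

/-- The Gaudin Lax matrix, indexed by `I_{m|n}`. -/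
def laxMatrix (m n : ℕ) (z : Fin ℓ → ℂ) : Matrix (Idx m n) (Idx m n) (PDO (Env m n ℓ)) :=
  fun i j => (if i = j then PDO.dpow _ 1 else 0) - (-1) ^ par i * current z i j

theorem PDO.C_sgn {A : Type*} [Ring A] [Algebra ℂ A] (i j k l : Idx m n) (x : A) :
    PDO.C (sgn i j k l • x) = (-1) ^ ((par i + par j) * (par k + par l)) * PDO.C x := by
  rw [sgn]
  rcases neg_one_pow_eq_or ℂ ((par i + par j) * (par k + par l)) with h | h
  · have : Even ((par i + par j) * (par k + par l)) := by
      by_contra hn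
      rw [Nat.not_even_iff_odd] at hn
      rw [hn.neg_one_pow] at h
      norm_num at h
    rw [h, this.neg_one_pow, one_smul, one_mul]
  · have : Odd ((par i + par j) * (par k + par l)) := by
      by_contra hn
      rw [Nat.not_odd_iff_even] at hn
      rw [hn.neg_one_pow] at h
      norm_num at h
    rw [h, this.neg_one_pow, neg_smul, one_smul, map_neg, neg_one_mul]

theorem laxData (z : Fin ℓ → ℂ) :
    LaxData (par : Idx m n → ℕ) (PDO.dpow (Env m n ℓ) 1) (fun a => pole 1 (z a))
      (fun a i j => PDO.C (Env.gen a i j)) where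
  same a i j k l := by
    have h := congrArg PDO.C (Env.gen_same (ℓ := ℓ) a i j k l)
    simpa only [map_sub, map_mul, PDO.C_sgn, apply_ite PDO.C, map_zero] using h
  diff a b hab i j k l := by
    have h := congrArg PDO.C (Env.gen_diff (ℓ := ℓ) a b hab i j k l)
    simpa only [map_mul, PDO.C_sgn] using h
  comm_q a b := commute_pole_of_commute (PDO.commute_Z fun i j hj => by
    rw [pole_coeff, if_neg (by omega)])
  comm_g a b i j := (commute_pole_of_commute (PDO.commute_Z fun i j hj => by
    rw [PDO.C_coeff, if_neg (by omega)])).symm.eq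
  comm_D b i j := PDO.C_comm_dpow _ _
  deriv a := dpow_one_mul_pole _

theorem current_eq (z : Fin ℓ → ℂ) (i j : Idx m n) :
    current z i j = LaxData.cur (fun a => pole 1 (z a)) (fun a i j => PDO.C (Env.gen a i j)) i j :=
  Finset.sum_congr rfl fun _ _ => pole_eq_C_mul _ _

theorem laxMatrix_eq (z : Fin ℓ → ℂ) : laxMatrix m n z =
    LaxData.lax par (PDO.dpow (Env m n ℓ) 1) (fun a => pole 1 (z a))
      (fun a i j => PDO.C (Env.gen a i j)) := by
  ext i j
  rw [laxMatrix, current_eq, LaxData.lax]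

theorem isManin_laxMatrix (z : Fin ℓ → ℂ) : IsManin par (laxMatrix m n z) := by
  rw [laxMatrix_eq]
  exact (laxData z).isManin par_cases

/-- The matrix `1 + u L_{m|n}(z)`, indexed by `I_{m|n}`. -/
def laxMatrixU (m n : ℕ) (z : Fin ℓ → ℂ) :
    Matrix (Idx m n) (Idx m n) (PowerSeries (PDO (Env m n ℓ))) :=
  fun i j => (if i = j then 1 else 0) + PowerSeries.X * PowerSeries.C (laxMatrix m n z i j)

theorem isManin_laxMatrixU (z : Fin ℓ → ℂ) : IsManin par (laxMatrixU m n z) := by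
  intro i j k l
  have h := congrArg (PowerSeries.C (R := PDO (Env m n ℓ)))
    (isManin_laxMatrix (m := m) (n := n) z i j k l)
  simp only [map_sub, map_mul, map_pow, map_neg, map_one] at h
  have hX : ∀ f : PowerSeries (PDO (Env m n ℓ)), f * PowerSeries.X = PowerSeries.X * f :=
    fun f => (PowerSeries.commute_X f).eq
  -- The supercommutators do not see the identity matrix, since diagonal entries are even.
  have e : ∀ i j k l : Idx m n, laxMatrixU m n z i j * laxMatrixU m n z k l
      - (-1) ^ ((par i + par j) * (par k + par l)) * (laxMatrixU m n z k l * laxMatrixU m n z i j) =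
      PowerSeries.X * PowerSeries.X *
        (PowerSeries.C (laxMatrix m n z i j) * PowerSeries.C (laxMatrix m n z k l)
        - (-1) ^ ((par i + par j) * (par k + par l)) *
          (PowerSeries.C (laxMatrix m n z k l) * PowerSeries.C (laxMatrix m n z i j))) := by
    intro i j k l
    simp only [laxMatrixU]
    have h1 := hX (PowerSeries.C (laxMatrix m n z i j))
    have h2 := hX (PowerSeries.C (laxMatrix m n z k l))
    generalize PowerSeries.C (laxMatrix m n z i j) = a at *
    generalize PowerSeries.C (laxMatrix m n z k l) = b at *
    have hθ : i = j ∨ k = l →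
        (-1 : PowerSeries (PDO (Env m n ℓ))) ^ ((par i + par j) * (par k + par l)) = 1 := by
      rintro (rfl | rfl)
      · rw [← two_mul, mul_assoc, pow_mul, neg_one_sq, one_pow]
      · rw [← two_mul, mul_left_comm, pow_mul, neg_one_sq, one_pow]
    by_cases hij : i = j <;> by_cases hkl : k = l
    · rw [hθ (Or.inl hij), if_pos hij, if_pos hkl]
      linear_combination (norm := noncomm_ring)
        PowerSeries.X * h1 * b - PowerSeries.X * h2 * a
    · rw [hθ (Or.inl hij), if_pos hij, if_neg hkl]
      linear_combination (norm := noncomm_ring)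
        PowerSeries.X * h1 * b - PowerSeries.X * h2 * a
    · rw [hθ (Or.inr hkl), if_neg hij, if_pos hkl]
      linear_combination (norm := noncomm_ring)
        PowerSeries.X * h1 * b - PowerSeries.X * h2 * a
    · rw [if_neg hij, if_neg hkl]
      rcases neg_one_pow_eq_or (PowerSeries (PDO (Env m n ℓ)))
        ((par i + par j) * (par k + par l)) with hs | hs <;> rw [hs]
      · linear_combination (norm := noncomm_ring)
          PowerSeries.X * h1 * b - PowerSeries.X * h2 * a
      · linear_combination (norm := noncomm_ring)
          PowerSeries.X * h1 * b + PowerSeries.X * h2 * a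
  rw [e, e, h]
  rcases neg_one_pow_eq_or (PowerSeries (PDO (Env m n ℓ)))
    (par i * par j + par i * par k + par j * par k) with hs | hs <;> rw [hs] <;> noncomm_ring

end LaxMatrix

/-! ### Power series in `u ∂` -/

section HomogeneousSeries

variable (A : Type*) [Ring A] [Algebra ℂ A]

theorem PDO.mono_mul_mono_const (a b : A) (k l : ℤ) :
    PDO.mono a 0 k * PDO.mono b 0 l = PDO.mono (a * b) 0 (k + l) := by
  have h := symbMul_eq_mul (HahnSeries.single (-0, -k) a : Symb A) (HahnSeries.single (-0, -l) b)
    (Or.inr (by simpa using dZ_pow_single b 0 l 1))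
  rw [HahnSeries.single_mul_single] at h
  refine h.trans ?_
  rw [PDO.mono]
  congr 1
  rw [Prod.mk_add_mk, neg_add, neg_zero, add_zero]

theorem PDO.mono_add (a b : A) (k l : ℤ) :
    PDO.mono (a + b) k l = PDO.mono a k l + PDO.mono b k l :=
  HahnSeries.single_add ..

/-- The powers of `∂` as units. -/
def PDO.dpowUnit : Multiplicative ℤ →* (PDO A)ˣ :=
  MonoidHom.toHomUnits
    { toFun r := PDO.dpow A (Multiplicative.toAdd r)
      map_one' := rfl
      map_mul' := fun _ _ => (PDO.dpow_mul _ _).symm }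

/-- The unit `∂`. -/
def PDO.dUnit : (PDO A)ˣ := PDO.dpowUnit A (Multiplicative.ofAdd 1)

theorem PDO.dUnit_zpow (r : ℤ) : ((PDO.dUnit A ^ r : (PDO A)ˣ) : PDO A) = PDO.dpow A r := by
  rw [PDO.dUnit, ← map_zpow, ← ofAdd_zsmul, smul_eq_mul, mul_one]
  rfl

theorem PDO.dUnit_inv : ((PDO.dUnit A)⁻¹ : (PDO A)ˣ) = PDO.dpow A (-1) := by
  rw [← PDO.dUnit_zpow, zpow_neg_one]

/-- The substitution of `u ∂` into a power series with complex coefficients. -/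
def substD : PowerSeries ℂ →+* PowerSeries (PDO A) where
  toFun f := PowerSeries.mk fun i => PDO.mono (algebraMap ℂ A (PowerSeries.coeff i f)) 0 i
  map_one' := by
    ext i
    rw [PowerSeries.coeff_mk, PowerSeries.coeff_one, PowerSeries.coeff_one]
    split_ifs with h
    · rw [h, map_one]; rfl
    · rw [map_zero]; exact HahnSeries.single_eq_zero
  map_zero' := by
    ext i
    rw [PowerSeries.coeff_mk, map_zero, map_zero, map_zero]
    exact HahnSeries.single_eq_zero
  map_add' f g := by
    ext i
    rw [map_add, PowerSeries.coeff_mk, PowerSeries.coeff_mk, PowerSeries.coeff_mk, map_add,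
      map_add, PDO.mono_add]
  map_mul' f g := by
    ext i
    rw [PowerSeries.coeff_mk, PowerSeries.coeff_mul, PowerSeries.coeff_mul, map_sum]
    have h : ∀ (s : Finset (ℕ × ℕ)) (c : ℕ × ℕ → A),
        PDO.mono (∑ x ∈ s, c x) 0 i = ∑ x ∈ s, PDO.mono (c x) 0 (i : ℤ) := fun s c =>
      map_sum (⟨⟨fun a => PDO.mono a 0 (i : ℤ), HahnSeries.single_eq_zero⟩,
        fun a b => PDO.mono_add A a b 0 i⟩ : A →+ PDO A) c s
    rw [h]
    refine Finset.sum_congr rfl fun x hx => ?_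
    rw [Finset.HasAntidiagonal.mem_antidiagonal] at hx
    rw [PowerSeries.coeff_mk, PowerSeries.coeff_mk, PDO.mono_mul_mono_const, map_mul, ← hx]
    push_cast
    rfl

variable {A}

theorem coeff_substD (f : PowerSeries ℂ) (i : ℕ) : PowerSeries.coeff i (substD A f) =
    PDO.mono (algebraMap ℂ A (PowerSeries.coeff i f)) 0 i := by
  rw [substD, RingHom.coe_mk, MonoidHom.coe_mk, OneHom.coe_mk, PowerSeries.coeff_mk]

theorem PDO.mono_const_eq (a : A) (r : ℤ) : PDO.mono a 0 r = PDO.dpow A r * PDO.C a := by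
  refine PDO.ext_coeff fun i j => ?_
  rw [PDO.mul_C_coeff, PDO.dpow, PDO.mono_coeff, PDO.mono_coeff]
  split_ifs <;> simp

theorem PDO.mul_mono_const_coeff (f : PDO A) (a : A) (r i j : ℤ) :
    (f * PDO.mono a 0 r).coeff i j = f.coeff i (j - r) * a := by
  rw [PDO.mono_const_eq, ← mul_assoc, PDO.mul_C_coeff, PDO.mul_dpow_coeff]

theorem mul_substD_coeff (F : PowerSeries (PDO A)) (c : PowerSeries ℂ) (i : ℕ) (s j : ℤ) :
    (PowerSeries.coeff i (F * substD A c)).coeff s j =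
      ∑ x ∈ Finset.HasAntidiagonal.antidiagonal i, PowerSeries.coeff x.2 c •
        (PowerSeries.coeff x.1 F).coeff s (j - x.2) := by
  rw [PowerSeries.coeff_mul, PDO.sum_coeff]
  refine Finset.sum_congr rfl fun x _ => ?_
  rw [coeff_substD, PDO.mul_mono_const_coeff, Algebra.smul_def, Algebra.commutes]

/-- The left ideal of the series over the pseudo-differential operators with all coefficients in a
left ideal of `A`. -/
abbrev seriesIdeal (J : Submodule A A) : Submodule (PowerSeries (PDO A)) (PowerSeries (PDO A)) :=
  powerSeriesLeftIdeal (PDO.leftIdeal J)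

/-- The coefficients of `F * substD c` are finite linear combinations of those of `F`, because powers
of `∂` on the right only shift the coefficients. -/
theorem mul_substD_mem (J : Submodule A A) {F : PowerSeries (PDO A)} (hF : F ∈ seriesIdeal J)
    (c : PowerSeries ℂ) : F * substD A c ∈ seriesIdeal J := by
  intro i s j
  rw [mul_substD_coeff]
  exact sum_mem fun x _ => Submodule.smul_of_tower_mem J _ (hF _ _ _)

theorem isUnit_one_add_X : IsUnit (1 + PowerSeries.X : PowerSeries ℂ) := by
  rw [PowerSeries.isUnit_iff_constantCoeff]
  simp

variable (A) in
/-- The unit `1 + u ∂`. -/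
def seriesUnit : (PowerSeries (PDO A))ˣ := Units.map (substD A) isUnit_one_add_X.unit

theorem seriesUnit_zpow (r : ℤ) : ∃ c : PowerSeries ℂ,
    ((seriesUnit A ^ r : (PowerSeries (PDO A))ˣ) : PowerSeries (PDO A)) = substD A c :=
  ⟨((isUnit_one_add_X.unit ^ r : (PowerSeries ℂ)ˣ) : PowerSeries ℂ), by
    rw [seriesUnit, ← map_zpow]; rfl⟩

theorem PowerSeries.X_comm {B : Type*} [Ring B] (f : PowerSeries B) :
    f * PowerSeries.X = PowerSeries.X * f := (PowerSeries.commute_X f).eq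

theorem seriesUnit_val : (seriesUnit A : PowerSeries (PDO A)) =
    1 + PowerSeries.X * PowerSeries.C (PDO.dpow A 1) := by
  have h : (seriesUnit A : PowerSeries (PDO A)) = substD A (1 + PowerSeries.X) := rfl
  rw [h, map_add, map_one]
  congr 1
  ext i
  rw [coeff_substD, ← PowerSeries.X_comm]
  rcases i with _ | _ | i
  · rw [PowerSeries.coeff_zero_mul_X, PowerSeries.coeff_zero_X, map_zero]
    exact HahnSeries.single_eq_zero
  · rw [PowerSeries.coeff_succ_mul_X]
    simp [PDO.dpow]
  · rw [PowerSeries.coeff_succ_mul_X, PowerSeries.coeff_X, if_neg (by omega), map_zero,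
      PowerSeries.coeff_C, if_neg (by omega)]
    exact HahnSeries.single_eq_zero

theorem PDO.dpow_mem_differential {r : ℤ} (hr : 0 ≤ r) : PDO.dpow A r ∈ PDO.differential A := by
  intro i j hj
  rw [PDO.dpow, PDO.mono_coeff, if_neg (by omega)]

theorem X_mul_C_mem_augmentation {B : Type*} [Ring B] {S : Subring B} {x : B} (hx : x ∈ S) :
    PowerSeries.X * PowerSeries.C x ∈ augmentation S := by
  constructor
  · rw [← PowerSeries.X_comm, PowerSeries.coeff_zero_mul_X]
  · rintro (_ | i)
    · rw [← PowerSeries.X_comm, PowerSeries.coeff_zero_mul_X]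
      exact S.zero_mem
    · rw [← PowerSeries.X_comm, PowerSeries.coeff_succ_mul_X, PowerSeries.coeff_C]
      split_ifs
      exacts [hx, S.zero_mem]

end HomogeneousSeries

/-! ### The Berezinian of the Lax matrix by elimination -/

section Near

variable {m n ℓ : ℕ}

theorem neg_one_pow_par_coeff {A : Type*} [Ring A] [Algebra ℂ A] (f : PDO A) (r : ℕ) (i j : ℤ) :
    ((-1) ^ r * f).coeff i j = (-1) ^ r * f.coeff i j := by
  have : (-1 : PDO A) ^ r = PDO.C ((-1) ^ r) := by rw [map_pow, map_neg, map_one]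
  rw [this, PDO.C_mul_coeff]

theorem current_coeff (z : Fin ℓ → ℂ) (i j : Idx m n) (r t : ℤ) :
    (current z i j).coeff r t =
      ∑ a, if r ≤ -1 ∧ t = 0 then z a ^ (-r - 1).toNat • Env.gen a i j else 0 := by
  rw [current, PDO.sum_coeff]
  exact Finset.sum_congr rfl fun a _ => pole_coeff _ _ _ _

theorem current_mem_differential (z : Fin ℓ → ℂ) (i j : Idx m n) :
    current z i j ∈ PDO.differential (Env m n ℓ) := by
  intro r t ht
  rw [current_coeff]
  exact Finset.sum_eq_zero fun a _ => if_neg (by omega)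

theorem nearScalar_laxMatrix (z : Fin ℓ → ℂ) (l : List (Idx m n)) :
    NearScalar (PDO.negative _) (PDO.dUnit _) (laxMatrix m n z) l := by
  intro i _ j _
  have h1 : (if i = j then PDO.dpow (Env m n ℓ) 1 else 0) * PDO.dpow (Env m n ℓ) (-1) =
      if i = j then 1 else 0 := by
    split_ifs
    · rw [PDO.dpow_mul]; rfl
    · rw [zero_mul]
  rw [PDO.dUnit_inv, laxMatrix, sub_mul, h1, sub_sub_cancel_left]
  refine neg_mem fun r t h => ?_
  rw [PDO.mul_dpow_coeff, neg_one_pow_par_coeff, current_coeff,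
    Finset.sum_eq_zero fun a _ => if_neg (by omega), mul_zero]

theorem laxMatrix_mem_differential (z : Fin ℓ → ℂ) (i j : Idx m n) :
    laxMatrix m n z i j ∈ PDO.differential (Env m n ℓ) := by
  refine sub_mem ?_ (mul_mem (pow_mem (neg_mem (one_mem _)) _) (current_mem_differential z i j))
  split_ifs
  exacts [PDO.dpow_mem_differential zero_le_one, zero_mem _]

theorem nearScalar_laxMatrixU (z : Fin ℓ → ℂ) (l : List (Idx m n)) :
    NearScalar (augmentation (PDO.differential _)) 1 (laxMatrixU m n z) l := by
  intro i _ j _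
  rw [inv_one, Units.val_one, mul_one, laxMatrixU, add_sub_cancel_left]
  exact X_mul_C_mem_augmentation (laxMatrix_mem_differential z i j)

theorem laxMatrixU_sub (z : Fin ℓ → ℂ) (i j : Idx m n) :
    laxMatrixU m n z i j - (if i = j then (seriesUnit (Env m n ℓ) : PowerSeries _) else 0) =
      PowerSeries.X * PowerSeries.C (-((-1) ^ par i * current z i j)) := by
  rw [laxMatrixU, laxMatrix, seriesUnit_val]
  split_ifs
  · rw [sub_eq_add_neg (PDO.dpow _ 1), map_add, mul_add]; abel
  · rw [zero_sub, sub_zero, zero_add]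

/-- Besides `1`, the scalar `1 + u ∂` can serve as the leading term of `1 + u L`. The first choice
shows that the Hamiltonians are coefficients of differential operators, the second one is adapted to
the reduction modulo a left ideal. -/
theorem nearScalar_laxMatrixU' (z : Fin ℓ → ℂ) (l : List (Idx m n)) :
    NearScalar (augmentation (PDO.differential _)) (seriesUnit _) (laxMatrixU m n z) l := by
  intro i _ j _
  have hu : (↑(seriesUnit (Env m n ℓ))⁻¹ : PowerSeries (PDO (Env m n ℓ))) - 1 ∈
      augmentation (PDO.differential _) := by
    have h : (seriesUnit (Env m n ℓ) : PowerSeries (PDO (Env m n ℓ))) - 1 ∈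
        augmentation (PDO.differential _) := by
      rw [seriesUnit_val, add_sub_cancel_left]
      exact X_mul_C_mem_augmentation (PDO.dpow_mem_differential zero_le_one)
    have h' := (quasiRegular_augmentation _).inverse_sub_one_mem h
    rwa [Ring.inverse_unit] at h'
  have h2 : PowerSeries.X * PowerSeries.C (-((-1) ^ par i * current z i j)) ∈
      augmentation (PDO.differential (Env m n ℓ)) :=
    X_mul_C_mem_augmentation (neg_mem
      (mul_mem (pow_mem (neg_mem (one_mem _)) _) (current_mem_differential z i j)))
  have e : laxMatrixU m n z i j * (↑(seriesUnit (Env m n ℓ))⁻¹ : PowerSeries (PDO (Env m n ℓ)))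
      - (if i = j then 1 else 0) =
      (laxMatrixU m n z i j - (if i = j then (seriesUnit (Env m n ℓ) : PowerSeries _) else 0)) *
        ((↑(seriesUnit (Env m n ℓ))⁻¹ : PowerSeries (PDO (Env m n ℓ))) - 1 + 1) := by
    rw [sub_add_cancel, sub_mul]
    congr 1
    split_ifs
    · rw [Units.mul_inv]
    · rw [zero_mul]
  rw [e, laxMatrixU_sub, mul_add, mul_one]
  exact add_mem (mul_mem h2 hu) h2

theorem idx_injective : Function.Injective (idx : Fin (m + n) → Idx m n) :=
  finSumFinEquiv.symm.injective

theorem gaudinL_eq (z : Fin ℓ → ℂ) :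
    gaudinL m n z = (laxMatrix m n z).submatrix idx idx := by
  ext1 r s
  simp only [gaudinL, laxMatrix, Matrix.of_apply, Matrix.submatrix_apply, idx_injective.eq_iff]

theorem gaudinLu_eq (z : Fin ℓ → ℂ) :
    gaudinLu m n z = (laxMatrixU m n z).submatrix idx idx := by
  ext1 r s
  simp only [gaudinLu, gaudinL_eq, laxMatrixU, Matrix.of_apply, Matrix.submatrix_apply,
    idx_injective.eq_iff]

theorem gaudinL_ber (z : Fin ℓ → ℂ) : SufficientlyInvertible (gaudinL m n z) ∧
    gaudinBer m n z = berList par (laxMatrix m n z) (List.ofFn idx) := by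
  rw [gaudinBer, gaudinL_eq]
  exact ber_eq_berList PDO.quasiRegular_negative idx par _ idx_injective (nearScalar_laxMatrix z _)

theorem gaudinLu_ber (z : Fin ℓ → ℂ) : SufficientlyInvertible (gaudinLu m n z) ∧
    Ber (stdType m n) (gaudinLu m n z) = berList par (laxMatrixU m n z) (List.ofFn idx) := by
  rw [gaudinLu_eq]
  exact ber_eq_berList (quasiRegular_augmentation _) idx par _ idx_injective
    (nearScalar_laxMatrixU z _)

end Near

/-! ### The indices inside and outside `I_{p|k}` -/

section Sublist

/-- The elements of `I_{m|n}` outside `I_{p|k}`, in the standard order. -/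
def outer (m n p k : ℕ) : List (Idx m n) :=
  (List.ofFn fun i : Fin (m - p) => (Sum.inl ⟨p + i, by omega⟩ : Idx m n)) ++
    List.ofFn fun j : Fin (n - k) => (Sum.inr ⟨k + j, by omega⟩ : Idx m n)

theorem ofFn_castLE {α : Type*} {a b : ℕ} (h : a ≤ b) (f : Fin b → α) :
    List.ofFn f = List.ofFn (fun i => f (Fin.castLE h i)) ++
      List.ofFn fun i : Fin (b - a) => f ⟨a + i, by omega⟩ := by
  obtain ⟨c, rfl⟩ := Nat.exists_eq_add_of_le h
  rw [List.ofFn_add]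
  congr 1
  refine List.ext_getElem (by simp) fun i h1 h2 => ?_
  simp only [List.getElem_ofFn]
  rfl

variable {m n p k : ℕ} (hp : p ≤ m) (hk : k ≤ n)

/-- The elements of `I_{p|k}`, in the standard order. -/
def inner : List (Idx m n) := (List.ofFn (idx : Fin (p + k) → Idx p k)).map (emb hp hk)

theorem ofFn_idx : List.ofFn (idx : Fin (m + n) → Idx m n) =
    List.ofFn (Sum.inl : Fin m → Idx m n) ++ List.ofFn (Sum.inr : Fin n → Idx m n) := by
  rw [List.ofFn_add]
  simp only [idx]
  congr 2
  · funext i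
    exact finSumFinEquiv_symm_apply_castAdd i
  · funext i
    exact finSumFinEquiv_symm_apply_natAdd i

theorem inner_eq : inner hp hk =
    List.ofFn (fun i => (Sum.inl (Fin.castLE hp i) : Idx m n)) ++
      List.ofFn (fun j => (Sum.inr (Fin.castLE hk j) : Idx m n)) := by
  rw [inner, ofFn_idx, List.map_append, List.map_ofFn, List.map_ofFn]
  rfl

/-- The even indices outside `I_{p|k}` can be moved behind the odd indices of `I_{p|k}`. -/
theorem berList_inner_append_outer {B : Type*} [Ring B] {K : NonUnitalSubring B} {d : Bˣ}
    {M : Matrix (Idx m n) (Idx m n) B} (two : ∀ x : B, x + x = 0 → x = 0) (hK : QuasiRegular K)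
    (h : Admissible K d par M (List.ofFn idx)) :
    berList par M (List.ofFn idx) = berList par M (inner hp hk ++ outer m n p k) := by
  rw [ofFn_idx, ofFn_castLE hp, ofFn_castLE hk, List.append_assoc] at h ⊢
  rw [berList_move two par_cases hK h (by simp [par])
    (by simp [par]), inner_eq, outer,
    List.append_assoc]

theorem ofFn_idx_perm :
    (List.ofFn (idx : Fin (m + n) → Idx m n)).Perm (inner hp hk ++ outer m n p k) := by
  rw [inner_eq, outer, ofFn_idx, ofFn_castLE hp, ofFn_castLE hk, List.append_assoc,
    List.append_assoc]
  refine List.Perm.append_left _ ?_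
  rw [← List.append_assoc, ← List.append_assoc]
  exact List.perm_append_comm.append_right _

theorem nodup_ofFn_idx : (List.ofFn (idx : Fin (m + n) → Idx m n)).Nodup :=
  List.nodup_ofFn.2 idx_injective

theorem mem_inner {i : Idx m n} : i ∈ inner hp hk ↔ i ∈ Set.range (emb hp hk) := by
  rw [inner, List.mem_map]
  refine ⟨fun ⟨x, _, h⟩ => ⟨x, h⟩, fun ⟨x, h⟩ => ⟨x, ?_, h⟩⟩
  rw [List.mem_ofFn]
  exact finSumFinEquiv.symm.surjective x

theorem sum_sign_outer :
    ((outer m n p k).map fun i => if par i = 0 then (1 : ℤ) else -1).sum =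
      ((m - p : ℕ) : ℤ) - ((n - k : ℕ) : ℤ) := by
  have h1 : ∀ i : Fin m, par (Sum.inl i : Idx m n) = 0 := fun _ => rfl
  have h2 : ∀ i : Fin n, par (Sum.inr i : Idx m n) = 1 := fun _ => rfl
  rw [outer, List.map_append, List.sum_append, List.map_ofFn, List.map_ofFn, List.sum_ofFn,
    List.sum_ofFn]
  simp [h1, h2]
  ring

end Sublist

/-! ### Reduction from `gl_{m|n}` to `gl_{p|k}` -/

section Reduction

variable {m n p k ℓ : ℕ} (hp : p ≤ m) (hk : k ≤ n)

variable (ℓ) in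
/-- The left ideal generated by the elements `E_ij^{(a)}` with `j` outside `I_{p|k}`. -/
def outsideIdeal : Submodule (Env m n ℓ) (Env m n ℓ) :=
  Submodule.span _ {x | ∃ a i j, j ∉ Set.range (emb hp hk) ∧ x = Env.gen a i j}

theorem PDO.map_dpow {A A' : Type*} [Ring A] [Algebra ℂ A] [Ring A'] [Algebra ℂ A']
    (φ : A →ₐ[ℂ] A') (r : ℤ) : PDO.map φ (PDO.dpow A r) = PDO.dpow A' r := by
  refine PDO.ext_coeff fun i j => ?_
  rw [PDO.map_coeff, PDO.dpow, PDO.dpow, PDO.mono_coeff, PDO.mono_coeff]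
  split_ifs
  exacts [map_one φ, map_zero φ]

theorem map_current (z : Fin ℓ → ℂ) (i j : Idx p k) :
    PDO.map (envIncl ℓ hp hk) (current z i j) = current z (emb hp hk i) (emb hp hk j) := by
  refine PDO.ext_coeff fun r t => ?_
  rw [PDO.map_coeff, current_coeff, current_coeff, map_sum]
  refine Finset.sum_congr rfl fun a _ => ?_
  split_ifs
  · rw [map_smul, envIncl, Env.lift_gen]
  · rw [map_zero]

theorem map_laxMatrix (z : Fin ℓ → ℂ) (i j : Idx p k) :
    PDO.map (envIncl ℓ hp hk) (laxMatrix p k z i j) =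
      laxMatrix m n z (emb hp hk i) (emb hp hk j) := by
  rw [laxMatrix, laxMatrix, map_sub, map_mul, map_current, map_pow, map_neg, map_one, par_emb]
  simp only [(emb_injective hp hk).eq_iff]
  split_ifs
  · rw [PDO.map_dpow]
  · rw [map_zero]

theorem map_laxMatrixU (z : Fin ℓ → ℂ) (i j : Idx p k) :
    PowerSeries.map (PDO.map (envIncl ℓ hp hk)) (laxMatrixU p k z i j) =
      laxMatrixU m n z (emb hp hk i) (emb hp hk j) := by
  rw [laxMatrixU, laxMatrixU, map_add, map_mul, PowerSeries.map_X, PowerSeries.map_C,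
    map_laxMatrix]
  simp only [(emb_injective hp hk).eq_iff]
  split_ifs
  · rw [map_one]
  · rw [map_zero]

theorem map_berList_laxMatrix (z : Fin ℓ → ℂ) :
    PDO.map (envIncl ℓ hp hk) (gaudinBer p k z) =
      berList par (laxMatrix m n z) (inner hp hk) := by
  rw [(gaudinL_ber z).2, map_berList _ PDO.quasiRegular_negative par nodup_ofFn_idx
    (nearScalar_laxMatrix z _), inner, ← berList_submatrix (emb hp hk) par par (par_emb hp hk)]
  congr 1
  ext1 i j
  exact map_laxMatrix hp hk z i j

theorem map_berList_laxMatrixU (z : Fin ℓ → ℂ) :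
    PowerSeries.map (PDO.map (envIncl ℓ hp hk)) (Ber (stdType p k) (gaudinLu p k z)) =
      berList par (laxMatrixU m n z) (inner hp hk) := by
  rw [(gaudinLu_ber z).2, map_berList _ (quasiRegular_augmentation _) par nodup_ofFn_idx
    (nearScalar_laxMatrixU z _), inner, ← berList_submatrix (emb hp hk) par par (par_emb hp hk)]
  congr 1
  ext1 i j
  exact map_laxMatrixU hp hk z i j

theorem current_mem_leftIdeal (z : Fin ℓ → ℂ) (i : Idx m n) {j : Idx m n}
    (hj : j ∉ Set.range (emb hp hk)) :
    current z i j ∈ PDO.leftIdeal (outsideIdeal ℓ hp hk) := by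
  intro r t
  rw [current_coeff]
  refine sum_mem fun a _ => ?_
  split_ifs
  · exact Submodule.smul_of_tower_mem _ _ (Submodule.subset_span ⟨a, i, j, hj, rfl⟩)
  · exact zero_mem _

theorem outer_not_mem {j : Idx m n} (hj : j ∈ outer m n p k) : j ∉ Set.range (emb hp hk) := by
  have h := (ofFn_idx_perm hp hk).nodup_iff.1 nodup_ofFn_idx
  rw [← mem_inner]
  exact fun h' => List.disjoint_of_nodup_append h h' hj

/-- A Berezinian over `I_{m|n}` is the Berezinian over `I_{p|k}` times a power of `d`, modulo a left
ideal that contains the deviation of the outer columns from those of `d`. -/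
theorem berList_sub_mul_zpow_mem {B : Type*} [Ring B] {K : NonUnitalSubring B} {d : Bˣ}
    {M : Matrix (Idx m n) (Idx m n) B} (two : ∀ x : B, x + x = 0 → x = 0) (hK : QuasiRegular K)
    (h : Admissible K d par M (List.ofFn idx)) (J : Submodule B B)
    (hJ : ∀ x ∈ J, x * (d : B) ∈ J) (hJ' : ∀ x ∈ J, x * (↑d⁻¹ : B) ∈ J)
    (hc : ∀ j ∉ Set.range (emb hp hk), ∀ i, M i j - (if i = j then (d : B) else 0) ∈ J) :
    berList par M (List.ofFn idx) - berList par M (inner hp hk) *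
      ((d ^ (((m - p : ℕ) : ℤ) - ((n - k : ℕ) : ℤ)) : Bˣ) : B) ∈ J := by
  have h' := h.perm (ofFn_idx_perm hp hk)
  rw [berList_inner_append_outer hp hk two hK h, berList_append, ← mul_sub, ← sum_sign_outer]
  refine J.smul_mem _ (berList_sub_zpow_mem hK J hJ hJ' par (List.nodup_append.1 h'.nodup).2.1
    (h'.near.schurList hK h'.nodup) fun j hj i => schurList_column_mem J (fun hj' => ?_)
      (hc j (outer_not_mem hp hk hj)) i)
  exact outer_not_mem hp hk hj ((mem_inner hp hk).1 hj')

/-- `Ber (L_{m|n})` agrees with `Ber (L_{p|k}) ∂^r` modulo the left ideal. -/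
theorem gaudinBer_sub_mem (z : Fin ℓ → ℂ) :
    gaudinBer m n z - PDO.map (envIncl ℓ hp hk) (gaudinBer p k z *
      PDO.dpow _ (((m - p : ℕ) : ℤ) - ((n - k : ℕ) : ℤ))) ∈
        PDO.leftIdeal (outsideIdeal ℓ hp hk) := by
  rw [(gaudinL_ber z).2, map_mul, PDO.map_dpow, map_berList_laxMatrix, ← PDO.dUnit_zpow]
  refine berList_sub_mul_zpow_mem hp hk PDO.two_torsion_free PDO.quasiRegular_negative
    ⟨nodup_ofFn_idx, nearScalar_laxMatrix z _, isManin_laxMatrix z⟩ _ ?_ ?_ ?_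
  · intro x hx
    have := PDO.mul_dpow_mem _ hx 1
    rwa [← PDO.dUnit_zpow, zpow_one] at this
  · intro x hx
    rw [PDO.dUnit_inv]
    exact PDO.mul_dpow_mem _ hx (-1)
  · intro j hj i
    have e : ((PDO.dUnit (Env m n ℓ) : (PDO (Env m n ℓ))ˣ) : PDO (Env m n ℓ)) = PDO.dpow _ 1 := by
      rw [← PDO.dUnit_zpow, zpow_one]
    rw [e, laxMatrix, sub_sub_cancel_left]
    exact neg_mem (Submodule.smul_mem _ _ (current_mem_leftIdeal hp hk z i hj))

/-- `Ber (1 + u L_{m|n})` agrees with `Ber (1 + u L_{p|k}) (1 + u ∂)^r` modulo the left ideal. -/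
theorem ber_gaudinLu_sub_mem (z : Fin ℓ → ℂ) :
    Ber (stdType m n) (gaudinLu m n z) -
      PowerSeries.map (PDO.map (envIncl ℓ hp hk)) (Ber (stdType p k) (gaudinLu p k z)) *
        ((seriesUnit _ ^ (((m - p : ℕ) : ℤ) - ((n - k : ℕ) : ℤ)) : (PowerSeries (PDO (Env m n ℓ)))ˣ) :
          PowerSeries (PDO (Env m n ℓ))) ∈
      seriesIdeal (outsideIdeal ℓ hp hk) := by
  rw [(gaudinLu_ber z).2, map_berList_laxMatrixU]
  have hz : ∀ (r : ℤ), ∀ x ∈ seriesIdeal (outsideIdeal ℓ hp hk),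
      x * ((seriesUnit _ ^ r : (PowerSeries (PDO (Env m n ℓ)))ˣ) : PowerSeries (PDO (Env m n ℓ))) ∈
        seriesIdeal (outsideIdeal ℓ hp hk) := by
    intro r x hx
    obtain ⟨c, hc⟩ := seriesUnit_zpow (A := Env m n ℓ) r
    rw [hc]
    exact mul_substD_mem _ hx c
  refine berList_sub_mul_zpow_mem hp hk (PowerSeries.two_torsion_free PDO.two_torsion_free)
    (quasiRegular_augmentation _)
    ⟨nodup_ofFn_idx, nearScalar_laxMatrixU' z _, isManin_laxMatrixU z⟩ _ ?_ ?_ ?_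
  · intro x hx
    simpa using hz 1 x hx
  · intro x hx
    simpa using hz (-1) x hx
  · intro j hj i
    rw [laxMatrixU_sub]
    refine Submodule.smul_mem (seriesIdeal (outsideIdeal ℓ hp hk)) _ fun t => ?_
    rw [PowerSeries.coeff_C]
    split_ifs
    · exact neg_mem (Submodule.smul_mem _ _ (current_mem_leftIdeal hp hk z i hj))
    · exact zero_mem _

/-- The coefficients of `Ber (1 + u L)` are differential operators, so the coefficient of
`∂^{i-j} u^i` vanishes if `i < j`. -/
theorem hamiltonian_eq_zero (z : Fin ℓ → ℂ) {i j : ℕ} (h : i < j) (s : ℤ) :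
    hamiltonian m n z i j s = 0 := by
  have hmem := berList_sub_one_mem (quasiRegular_augmentation _) par nodup_ofFn_idx
    (nearScalar_laxMatrixU (m := m) (n := n) z _)
  rw [← (gaudinLu_ber z).2] at hmem
  have h1 := hmem.2 i
  rw [map_sub] at h1
  have h2 : PowerSeries.coeff i (1 : PowerSeries (PDO (Env m n ℓ))) ∈ PDO.differential _ := by
    rw [PowerSeries.coeff_one]
    split_ifs
    exacts [one_mem _, zero_mem _]
  have h3 := add_mem h1 h2
  rw [sub_add_cancel] at h3
  exact h3 s _ (by omega)

/-- The relations between the Gaudin Hamiltonians of `gl_{m|n}` and those of `gl_{p|k}` modulo the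
left ideal. For `c` and `c'` one takes the powers of `1 + u` with exponents `r` and `-r`, where
`r = (m - p) - (n - k)`. -/
theorem hamiltonian_relation (z : Fin ℓ → ℂ) : ∃ c c' : PowerSeries ℂ, ∀ (i j : ℕ) (s : ℤ),
    hamiltonian m n z i j s - ∑ x ∈ Finset.HasAntidiagonal.antidiagonal i,
        PowerSeries.coeff x.2 c • envIncl ℓ hp hk (hamiltonian p k z x.1 j s) ∈
      outsideIdeal ℓ hp hk ∧
    envIncl ℓ hp hk (hamiltonian p k z i j s) - ∑ x ∈ Finset.HasAntidiagonal.antidiagonal i,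
        PowerSeries.coeff x.2 c' • hamiltonian m n z x.1 j s ∈
      outsideIdeal ℓ hp hk := by
  set r : ℤ := ((m - p : ℕ) : ℤ) - ((n - k : ℕ) : ℤ) with hr
  obtain ⟨c, hc⟩ := seriesUnit_zpow (A := Env m n ℓ) r
  obtain ⟨c', hc'⟩ := seriesUnit_zpow (A := Env m n ℓ) (-r)
  have h1 := ber_gaudinLu_sub_mem hp hk z
  rw [← hr, hc] at h1
  have h2 := neg_mem (mul_substD_mem _ h1 c')
  have hcc : substD (Env m n ℓ) c * substD _ c' = 1 := by
    rw [← hc, ← hc', ← Units.val_mul, zpow_neg, mul_inv_cancel, Units.val_one]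
  rw [sub_mul, mul_assoc, hcc, mul_one, neg_sub] at h2
  refine ⟨c, c', fun i j s => ⟨?_, ?_⟩⟩
  · have h := h1 i s ((i : ℤ) - j)
    rw [map_sub, PDO.sub_coeff, mul_substD_coeff] at h
    convert h using 2
    · rfl
    refine Finset.sum_congr rfl fun x hx => ?_
    rw [Finset.HasAntidiagonal.mem_antidiagonal] at hx
    rw [hamiltonian, ← PDO.map_coeff, PowerSeries.coeff_map]
    congr 2
    rw [← hx]; push_cast; ring
  · have h := h2 i s ((i : ℤ) - j)
    rw [map_sub, PDO.sub_coeff, mul_substD_coeff] at h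
    convert h using 2
    · rfl
    refine Finset.sum_congr rfl fun x hx => ?_
    rw [Finset.HasAntidiagonal.mem_antidiagonal] at hx
    rw [hamiltonian]
    congr 2
    rw [← hx]; push_cast; ring

end Reduction

/-! ### The diagonal action and the Gaudin Hamiltonians -/

section Total

variable {m n ℓ : ℕ}

variable (ℓ) in
/-- The image of the matrix unit `E_ij` under the iterated coproduct. -/
def tot (i j : Idx m n) : Env m n ℓ := ∑ a, Env.gen a i j

theorem tot_bracket_gen (b : Fin ℓ) (x y j k : Idx m n) :
    tot ℓ x y * Env.gen b j k - sgn x y j k • (Env.gen b j k * tot ℓ x y) =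
      (if y = j then Env.gen b x k else 0) - sgn x y j k • (if k = x then Env.gen b j y else 0) := by
  rw [← Env.gen_same, tot, Finset.sum_mul, Finset.mul_sum, Finset.smul_sum,
    ← Finset.sum_sub_distrib, Finset.sum_eq_single b]
  · intro a _ hab
    rw [Env.gen_diff a b hab, sub_self]
  · simp

theorem tot_bracket (x y j k : Idx m n) :
    tot ℓ x y * tot ℓ j k - sgn x y j k • (tot ℓ j k * tot ℓ x y) =
      (if y = j then tot ℓ x k else 0) - sgn x y j k • (if k = x then tot ℓ j y else 0) := by
  have h : tot ℓ x y * tot ℓ j k - sgn x y j k • (tot ℓ j k * tot ℓ x y) = ∑ b,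
      (tot ℓ x y * Env.gen b j k - sgn x y j k • (Env.gen b j k * tot ℓ x y)) := by
    rw [Finset.sum_sub_distrib, ← Finset.smul_sum, ← Finset.mul_sum, ← Finset.sum_mul]
    rfl
  rw [h, Finset.sum_congr rfl fun b _ => tot_bracket_gen b x y j k, Finset.sum_sub_distrib,
    ← Finset.smul_sum]
  congr 2 <;> split_ifs <;> simp [tot]

/-- The signs in the commutation relations with an element of the parity of `E_xy`. -/
def rootSign (B : Type*) [Ring B] (x y i : Idx m n) : B := (-1) ^ ((par x + par y) * par i)

theorem neg_one_pow_two_mul {B : Type*} [Ring B] (a : ℕ) : (-1 : B) ^ (2 * a) = 1 := by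
  rw [pow_mul, neg_one_sq, one_pow]

theorem PDO.C_sgn_eq {A : Type*} [Ring A] [Algebra ℂ A] (x y j k : Idx m n) (a : A) :
    PDO.C (sgn x y j k • a) = rootSign _ x y j * rootSign _ x y k * PDO.C a := by
  rw [PDO.C_sgn, rootSign, rootSign, ← pow_add, mul_add]

/-- The currents `E_jk(z)` span an adjoint representation of the diagonal copy of `gl_{m|n}`. -/
theorem C_tot_mul_current (z : Fin ℓ → ℂ) (x y j k : Idx m n) :
    PDO.C (tot ℓ x y) * current z j k =
      rootSign _ x y j * rootSign _ x y k * (current z j k * PDO.C (tot ℓ x y))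
      + (if j = y then current z x k else 0)
      - (if k = x then rootSign _ x y j * rootSign _ x y k * current z j y else 0) := by
  have hsgn : ∀ f : PDO (Env m n ℓ), ∀ r t, (rootSign _ x y j * rootSign _ x y k * f).coeff r t =
      sgn x y j k • f.coeff r t := by
    intro f r t
    have e : (rootSign (PDO (Env m n ℓ)) x y j * rootSign _ x y k) = PDO.C (sgn x y j k • 1) := by
      rw [PDO.C_sgn_eq, map_one, mul_one]
    rw [e, PDO.C_mul_coeff, smul_mul_assoc, one_mul]
  refine PDO.ext_coeff fun r t => ?_
  have hite : ∀ (P : Prop) [Decidable P] (f : PDO (Env m n ℓ)),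
      (if P then f else 0).coeff r t = if P then f.coeff r t else 0 := by
    intro P _ f
    split_ifs <;> rfl
  rw [PDO.sub_coeff, PDO.add_coeff, hite, hite, hsgn, hsgn, PDO.C_mul_coeff, PDO.mul_C_coeff]
  simp only [current_coeff]
  by_cases hrt : r ≤ -1 ∧ t = 0
  · simp only [if_pos hrt]
    rw [Finset.mul_sum, Finset.sum_mul]
    have h : ∀ b : Fin ℓ, tot ℓ x y * z b ^ (-r - 1).toNat • Env.gen b j k =
        sgn x y j k • (z b ^ (-r - 1).toNat • Env.gen b j k * tot ℓ x y)
          + (if j = y then z b ^ (-r - 1).toNat • Env.gen b x k else 0)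
          - (if k = x then sgn x y j k • z b ^ (-r - 1).toNat • Env.gen b j y else 0) := by
      intro b
      have := congrArg (fun w => z b ^ (-r - 1).toNat • w) (tot_bracket_gen b x y j k)
      simp only [smul_sub] at this
      rw [sub_eq_iff_eq_add] at this
      rw [mul_smul_comm, this, smul_mul_assoc, smul_comm (sgn x y j k)]
      simp only [eq_comm (a := y)]
      split_ifs <;> simp [smul_comm (sgn x y j k)] <;> abel
    rw [Finset.sum_congr rfl fun b _ => h b, Finset.sum_sub_distrib, Finset.sum_add_distrib,
      Finset.smul_sum]
    congr 2 <;> split_ifs <;> simp [Finset.smul_sum]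
  · simp [hrt]

theorem rootRelation_laxMatrix (z : Fin ℓ → ℂ) (x y : Idx m n) :
    RootRelation (PDO.C (tot ℓ x y)) (rootSign _ x y) x y (laxMatrix m n z) := by
  intro j k
  have hD := PDO.C_comm_dpow (tot ℓ x y) 1
  have h := C_tot_mul_current z x y j k
  simp only [laxMatrix]
  rw [mul_sub]
  have hj : ∀ w : PDO (Env m n ℓ), PDO.C (tot ℓ x y) * ((-1) ^ par j * w) =
      (-1) ^ par j * (PDO.C (tot ℓ x y) * w) := by
    intro w
    rcases neg_one_pow_eq_or (PDO (Env m n ℓ)) (par j) with h | h <;> rw [h] <;> noncomm_ring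
  rw [hj, h]
  clear h hj
  generalize PDO.C (tot ℓ x y) = e at *
  generalize hj0 : current z j k = Ejk at *
  generalize PDO.dpow (Env m n ℓ) 1 = D at *
  simp only [eq_comm (a := x) (b := k)]
  by_cases hjy : j = y <;> by_cases hkx : k = x <;> by_cases hjk : j = k
  all_goals
    rcases par_cases j with pj | pj <;> rcases par_cases k with pk | pk <;>
    rcases par_cases x with px | px <;> rcases par_cases y with py | py
  all_goals
    first
    | (exfalso; subst_vars; omega)
    | (subst_vars
       simp [rootSign, *]
       try noncomm_ring
       try rw [hD]
       try abel)

theorem rootRelation_laxMatrixU (z : Fin ℓ → ℂ) (x y : Idx m n) :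
    RootRelation (PowerSeries.C (PDO.C (tot ℓ x y))) (rootSign _ x y) x y (laxMatrixU m n z) := by
  intro j k
  have h := congrArg (PowerSeries.C (R := PDO (Env m n ℓ))) (rootRelation_laxMatrix z x y j k)
  have hC : ∀ i, PowerSeries.C (rootSign (PDO (Env m n ℓ)) x y i) = rootSign _ x y i := fun i => by
    rw [rootSign, rootSign, map_pow, map_neg, map_one]
  simp only [map_add, map_sub, map_mul, apply_ite (PowerSeries.C (R := PDO (Env m n ℓ))), map_zero,
    hC] at h
  have hX := fun f : PowerSeries (PDO (Env m n ℓ)) => PowerSeries.X_comm f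
  have hs : ∀ i : Idx m n, rootSign (PowerSeries (PDO (Env m n ℓ))) x y i = 1 ∨
      rootSign (PowerSeries (PDO (Env m n ℓ))) x y i = -1 := fun i => neg_one_pow_eq_or _ _
  simp only [laxMatrixU]
  have e1 : ∀ a b : PowerSeries (PDO (Env m n ℓ)), a * (PowerSeries.X * b) =
      PowerSeries.X * (a * b) := fun a b => by rw [← mul_assoc, hX, mul_assoc]
  rw [mul_add, e1, h]
  generalize rootSign (PowerSeries (PDO (Env m n ℓ))) x y = ε at *
  generalize PowerSeries.C (PDO.C (tot ℓ x y)) = e at *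
  -- The identity matrix contributes nothing.
  have d : e * (if j = k then 1 else 0) = ε j * ε k * ((if j = k then 1 else 0) * e)
      + (if j = y then ε x * ε y * (if x = k then 1 else 0) else 0)
      - (if k = x then ε j * ε x * (if j = y then 1 else 0) else 0) := by
    have h1 : ε j * ε k * ((if j = k then 1 else 0) * e) = e * (if j = k then 1 else 0) := by
      by_cases hjk : j = k
      · subst hjk
        rcases hs j with h | h <;> simp [h]
      · simp [hjk]
    have h2 : (if j = y then ε x * ε y * (if x = k then 1 else 0) else 0) =
        (if k = x then ε j * ε x * (if j = y then 1 else 0) else 0) := by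
      by_cases hjy : j = y <;> by_cases hkx : k = x
      · subst hjy hkx
        rcases hs j with h | h <;> rcases hs k with h' | h' <;> simp [h, h']
      · simp [hkx, Ne.symm hkx]
      · simp [hjy]
      · simp [hkx, hjy]
    rw [h1, h2, add_sub_cancel_right]
  have r : ∀ (i i' : Idx m n) (w : PowerSeries (PDO (Env m n ℓ))),
      ε i * ε i' * (PowerSeries.X * w) = PowerSeries.X * (ε i * ε i' * w) := by
    intro i i' w
    rcases hs i with h | h <;> rcases hs i' with h' | h' <;> simp [h, h']
  have q : ∀ (P : Prop) [Decidable P] (i i' : Idx m n) (b w : PowerSeries (PDO (Env m n ℓ))),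
      (if P then ε i * ε i' * (b + PowerSeries.X * w) else 0) =
        (if P then ε i * ε i' * b else 0) + PowerSeries.X * (if P then ε i * ε i' * w else 0) := by
    intro P _ i i' b w
    split_ifs
    · rw [mul_add, r]
    · rw [mul_zero, add_zero]
  rw [d, q, q, add_mul, mul_add (ε j * ε k), mul_assoc PowerSeries.X, r]
  noncomm_ring

theorem hamiltonian_commute {e : Env m n ℓ} (z : Fin ℓ → ℂ)
    (h : Commute (PowerSeries.C (PDO.C e)) (Ber (stdType m n) (gaudinLu m n z))) (i j : ℕ) (s : ℤ) :
    Commute e (hamiltonian m n z i j s) := by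
  have h1 := congrArg (PowerSeries.coeff i) h.eq
  rw [PowerSeries.coeff_C_mul, PowerSeries.coeff_mul_C] at h1
  have h2 := congrArg (fun f => PDO.coeff f s ((i : ℤ) - j)) h1
  simp only [PDO.C_mul_coeff, PDO.mul_C_coeff] at h2
  exact h2

/-- The Hamiltonians preserve weights. -/
theorem hamiltonian_commute_weight (z : Fin ℓ → ℂ) (x : Idx m n) (i j : ℕ) (s : ℤ) :
    Commute (tot ℓ x x) (hamiltonian m n z i j s) := by
  refine hamiltonian_commute z ?_ i j s
  rw [(gaudinLu_ber z).2]
  refine berList_commute_of_weight (fun i => if i = x then 1 else 0) par fun j k => ?_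
  have h := rootRelation_laxMatrixU z x x j k
  have h1 : ∀ i, rootSign (PowerSeries (PDO (Env m n ℓ))) x x i = 1 := fun i => by
    rw [rootSign, ← two_mul, mul_assoc, neg_one_pow_two_mul]
  simp only [h1, one_mul] at h
  rw [h, add_sub_assoc]
  congr 1
  by_cases hj : j = x <;> by_cases hk : k = x <;> simp [hj, hk]

/-- The Hamiltonians commute with the raising operators of adjacent indices. -/
theorem hamiltonian_commute_simple (z : Fin ℓ → ℂ) {x y : Fin (m + n)} (hxy : (x : ℕ) + 1 = y)
    (i j : ℕ) (s : ℤ) : Commute (tot ℓ (idx x) (idx y : Idx m n)) (hamiltonian m n z i j s) := by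
  refine hamiltonian_commute z ?_ i j s
  rw [(gaudinLu_ber z).2]
  have hl : List.ofFn (idx : Fin (m + n) → Idx m n) =
      (List.ofFn (idx : Fin (m + n) → Idx m n)).take x ++
        idx x :: idx y :: (List.ofFn (idx : Fin (m + n) → Idx m n)).drop (x + 2) := by
    have hx : (x : ℕ) < (List.ofFn (idx : Fin (m + n) → Idx m n)).length := by simp
    have hy : (x : ℕ) + 1 < (List.ofFn (idx : Fin (m + n) → Idx m n)).length := by
      simp; omega
    conv_lhs => rw [← List.take_append_drop x (List.ofFn idx), List.drop_eq_getElem_cons hx,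
      List.drop_eq_getElem_cons hy]
    simp only [List.getElem_ofFn, hxy, show (x : ℕ) + 2 = y + 1 by omega]
  have hpar : par (idx x : Idx m n) ≤ par (idx y : Idx m n) := by
    have hp : ∀ r : Fin (m + n), par (idx r : Idx m n) = if (r : ℕ) < m then 0 else 1 := by
      intro r
      refine Fin.addCases (fun r => ?_) (fun r => ?_) r
      · rw [idx, finSumFinEquiv_symm_apply_castAdd, if_pos (by simp)]; rfl
      · rw [idx, finSumFinEquiv_symm_apply_natAdd, if_neg (by simp)]; rfl
    rw [hp, hp]
    split_ifs <;> omega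
  have hadm : Admissible (augmentation (PDO.differential (Env m n ℓ))) 1 par (laxMatrixU m n z)
      (List.ofFn idx) := ⟨nodup_ofFn_idx, nearScalar_laxMatrixU z _, isManin_laxMatrixU z⟩
  rw [hl] at hadm ⊢
  exact berList_commute_of_root (PowerSeries.two_torsion_free PDO.two_torsion_free) par_cases
    (quasiRegular_augmentation _) hadm (rootRelation_laxMatrixU z _ _) hpar

/-- The Hamiltonians commute with the raising operators, which are iterated commutators of those of
adjacent indices. -/
theorem hamiltonian_commute_raising (z : Fin ℓ → ℂ) {x y : Idx m n} (hxy : pos x < pos y)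
    (i j : ℕ) (s : ℤ) : Commute (tot ℓ x y) (hamiltonian m n z i j s) := by
  have key : ∀ (d : ℕ) (x y : Fin (m + n)), (x : ℕ) + d + 1 = y →
      Commute (tot ℓ (idx x) (idx y : Idx m n)) (hamiltonian m n z i j s) := by
    intro d
    induction d with
    | zero => exact fun x y h => hamiltonian_commute_simple z h i j s
    | succ d ih =>
      intro x y h
      have hw : (x : ℕ) + d + 1 < m + n := by omega
      have h1 := ih x ⟨_, hw⟩ rfl
      have h2 := hamiltonian_commute_simple (ℓ := ℓ) z (x := ⟨_, hw⟩) (y := y)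
        (by simp only; omega) i j s
      have hb := tot_bracket (ℓ := ℓ) (idx x) (idx ⟨_, hw⟩) (idx ⟨_, hw⟩) (idx y : Idx m n)
      rw [if_pos rfl, if_neg (fun e => by have := congrArg Fin.val (idx_injective e); omega), smul_zero, sub_zero] at hb
      rw [← hb]
      exact (h1.mul_left h2).sub_left ((h2.mul_left h1).smul_left _)
  have := key ((pos y : ℕ) - pos x - 1) (pos x) (pos y) (by have := Fin.lt_def.1 hxy; omega)
  simpa [idx, pos] using this

end Total

/-! ### Eigenspaces of an operator with a spanning set of eigenvectors -/

section Eigenvectors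

variable {V : Type*} [AddCommGroup V] [Module ℂ V]

/-- If a space is spanned by eigenvectors, an eigenspace is spanned by the eigenvectors in it. -/
theorem mem_span_of_eigenvector {h : Module.End ℂ V} {P : Set V} (hP : Submodule.span ℂ P = ⊤)
    (he : ∀ t ∈ P, ∃ c : ℂ, h t = c • t) {c : ℂ} {v : V} (hv : h v = c • v) :
    v ∈ Submodule.span ℂ {t ∈ P | h t = c • t} := by
  set U := Submodule.span ℂ {t ∈ P | h t = c • t}
  set W := h.eigenspace c
  set X := ⨆ (c' : ℂ) (_ : c' ≠ c), h.eigenspace c'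
  have hUW : U ≤ W := Submodule.span_le.2 fun t ht => Module.End.mem_eigenspace_iff.2 ht.2
  have htop : U ⊔ X = ⊤ := by
    rw [eq_top_iff, ← hP, Submodule.span_le]
    intro t ht
    obtain ⟨c', hc'⟩ := he t ht
    by_cases e : c' = c
    · exact Submodule.mem_sup_left (Submodule.subset_span ⟨ht, e ▸ hc'⟩)
    · exact Submodule.mem_sup_right
        (le_iSup₂_of_le (f := fun c' (_ : c' ≠ c) => h.eigenspace c') c' e le_rfl
          (Module.End.mem_eigenspace_iff.2 hc'))
  have hd : W ⊓ X = ⊥ := (h.eigenspaces_iSupIndep c).eq_bot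
  have hvW : v ∈ W ⊓ (U ⊔ X) := by
    rw [htop, inf_top_eq]
    exact Module.End.mem_eigenspace_iff.2 hv
  rwa [inf_comm, sup_inf_assoc_of_le X hUW, inf_comm, hd, sup_bot_eq] at hvW

theorem exists_nat_of_eigenvector {h : Module.End ℂ V} {P : Set V}
    (hP : Submodule.span ℂ P = ⊤) (he : ∀ t ∈ P, ∃ d : ℕ, h t = (d : ℂ) • t) {c : ℂ} {v : V}
    (hv : h v = c • v) (hv0 : v ≠ 0) : ∃ d : ℕ, c = d := by
  by_contra hn
  push Not at hn
  have hmem := mem_span_of_eigenvector hP (fun t ht => (he t ht).elim fun d hd => ⟨(d : ℂ), hd⟩) hv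
  refine hv0 ((Submodule.mem_bot ℂ).1 (Submodule.span_le.2 (fun t ht => ?_) hmem))
  obtain ⟨d, hd⟩ := he t ht.1
  have : ((c - d : ℂ)) • t = 0 := by rw [sub_smul, ← ht.2, ← hd, sub_self]
  exact (smul_eq_zero.1 this).resolve_left (sub_ne_zero.2 (hn d))

end Eigenvectors

/-! ### Weights of tensor products of polynomial modules -/

section TensorWeights

open TensorProduct

variable {m n ℓ : ℕ} {M : Fin ℓ → Type*} [∀ a, AddCommGroup (M a)] [∀ a, Module ℂ (M a)]
  (R : ∀ a, PolyModule m n (M a))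

/-- The joint eigenvectors of the operators `E_ii^{(a)}`, with eigenvalues in `ℕ`. -/
def jointWeightVectors : Set (⨂[ℂ] a, M a) :=
  {t | ∃ ν : Fin ℓ → Idx m n → ℕ, ∀ a i, tensorE R a i i t = (ν a i : ℂ) • t}

/-- A multilinear map takes its values in a submodule if it does so on spanning sets. -/
theorem multilinear_mem_of_span {ι : Type*} [DecidableEq ι] [Finite ι] {N : ι → Type*}
    [∀ b, AddCommGroup (N b)] [∀ b, Module ℂ (N b)] {W : Type*} [AddCommGroup W] [Module ℂ W]
    (f : MultilinearMap ℂ N W) (S : Submodule ℂ W) (T : ∀ b, Set (N b))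
    (hT : ∀ b, Submodule.span ℂ (T b) = ⊤) (h : ∀ v, (∀ b, v b ∈ T b) → f v ∈ S) (v : ∀ b, N b) :
    f v ∈ S := by
  cases nonempty_fintype ι
  have key : ∀ s : Finset ι, ∀ v : ∀ b, N b, (∀ b ∉ s, v b ∈ T b) → f v ∈ S := by
    intro s
    induction s using Finset.induction_on with
    | empty => exact fun v hv => h v fun b => hv b (Finset.notMem_empty b)
    | insert a s ha ih =>
      intro v hv
      have hx : v a ∈ Submodule.span ℂ (T a) := by rw [hT]; trivial
      have : ∀ x ∈ Submodule.span ℂ (T a), f (Function.update v a x) ∈ S := by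
        intro x hx
        induction hx using Submodule.span_induction with
        | mem x hx =>
          refine ih _ fun b hb => ?_
          by_cases hba : b = a
          · subst hba; simpa using hx
          · rw [Function.update_of_ne hba]
            exact hv b (by simp [hba, hb])
        | zero => rw [f.map_update_zero]; exact S.zero_mem
        | add x y _ _ hx hy => rw [f.map_update_add]; exact S.add_mem hx hy
        | smul c x _ hx => rw [f.map_update_smul]; exact S.smul_mem c hx
      simpa using this _ hx
  exact key Finset.univ v fun b hb => absurd (Finset.mem_univ b) hb

theorem span_jointWeightVectors : Submodule.span ℂ (jointWeightVectors R) = ⊤ := by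
  rw [eq_top_iff, ← PiTensorProduct.span_tprod_eq_top, Submodule.span_le]
  rintro _ ⟨v, rfl⟩
  refine multilinear_mem_of_span (PiTensorProduct.tprod ℂ) _ (fun b => ⋃ ν, (R b).natWt ν)
    (fun b => ?_) (fun v hv => Submodule.subset_span ?_) v
  · rw [← (R b).isInternal.submodule_iSup_eq_top, Submodule.iSup_eq_span]
  · simp only [Set.mem_iUnion] at hv
    choose ν hν using hv
    refine ⟨ν, fun a i => ?_⟩
    rw [tensorE, show par i + par i = 0 + 2 * par i by ring, siteOp_parity, siteOp,
      PiTensorProduct.map_tprod]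
    have hi := mem_weightSpace.1 (hν a) i
    -- The diagonal matrix units are even, so no sign appears.
    have e : (fun b => Function.update (fun b => if b < a then (R b).parity ^ 0 else 1) a
        ((R a).E i i) b (v b)) = Function.update v a ((ν a i : ℂ) • v a) := by
      funext b
      by_cases hb : b = a
      · subst hb; simp [hi]
      · simp [hb]
    rw [e, MultilinearMap.map_update_smul, Function.update_eq_self]

theorem totalE_apply_jointWeight {ν : Fin ℓ → Idx m n → ℕ} {t : ⨂[ℂ] a, M a}
    (h : ∀ a i, tensorE R a i i t = (ν a i : ℂ) • t) (i : Idx m n) :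
    totalE R i i t = ((∑ a, ν a i : ℕ) : ℂ) • t := by
  rw [totalE, LinearMap.sum_apply, Finset.sum_congr rfl fun a _ => h a i, ← Finset.sum_smul]
  push_cast
  rfl

/-- The eigenvalues of `E_ii` on the tensor product are natural numbers. -/
theorem totalE_eigenvalue {i : Idx m n} {c : ℂ} {v : ⨂[ℂ] a, M a} (hv : totalE R i i v = c • v)
    (hv0 : v ≠ 0) : ∃ d : ℕ, c = d :=
  exists_nat_of_eigenvector (span_jointWeightVectors R)
    (fun _ ht => ht.elim fun _ hν => ⟨_, totalE_apply_jointWeight R hν i⟩) hv hv0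

/-- A vector of weight zero at `j` is killed by all `E_ij^{(a)}`: it has weight zero at `j` in each
tensor factor, and `E_ij^{(a)}` would make one of these weights negative. -/
theorem tensorE_apply_eq_zero {j : Idx m n} {v : ⨂[ℂ] a, M a} (hv : totalE R j j v = 0)
    (a : Fin ℓ) (i : Idx m n) : tensorE R a i j v = 0 := by
  have hmem := mem_span_of_eigenvector (span_jointWeightVectors R)
    (fun t ht => ht.elim fun _ hν => ⟨_, totalE_apply_jointWeight R hν j⟩)
    (hv.trans (zero_smul ℂ v).symm)
  refine LinearMap.mem_ker.1 (Submodule.span_le.2 (fun t ht => ?_) hmem)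
  obtain ⟨⟨ν, hν⟩, ht0⟩ := ht
  rw [SetLike.mem_coe, LinearMap.mem_ker]
  by_contra hne
  have ht : t ≠ 0 := fun h => hne (by rw [h, map_zero])
  have hsum : ∑ a, ν a j = 0 := by
    rw [totalE_apply_jointWeight R hν j, zero_smul, smul_eq_zero] at ht0
    exact_mod_cast ht0.resolve_right ht
  have hνa : ν a j = 0 := Finset.sum_eq_zero_iff.1 hsum a (Finset.mem_univ a)
  have hj := hν a j
  rw [hνa, Nat.cast_zero, zero_smul] at hj
  by_cases hij : i = j
  · exact hne (hij ▸ hj)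
  · have h := LinearMap.congr_fun (tensorE_same R a j j i j) t
    have hs : sgn j j i j = 1 := by rw [sgn, ← two_mul, mul_assoc, pow_mul]; simp
    rw [hs, one_smul, one_smul, if_neg (Ne.symm hij), if_pos rfl] at h
    simp only [LinearMap.sub_apply, Module.End.mul_apply, hj, map_zero, sub_zero, zero_sub] at h
    obtain ⟨d, hd⟩ := exists_nat_of_eigenvector (h := tensorE R a j j) (c := -1)
      (span_jointWeightVectors R) (fun _ ht => ht.elim fun ν hν => ⟨ν a j, hν a j⟩)
      (by rw [h, neg_one_smul]; rfl) hne
    have : ((d : ℂ) + 1) = 0 := by rw [← hd]; ring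
    exact Nat.cast_add_one_ne_zero d this

theorem tensorAct_gen (a : Fin ℓ) (i j : Idx m n) :
    tensorAct R (Env.gen a i j) = tensorE R a i j := Env.lift_gen ..

theorem tensorAct_tot (i j : Idx m n) : tensorAct R (tot ℓ i j) = totalE R i j := by
  rw [tot, map_sum, totalE]
  exact Finset.sum_congr rfl fun a _ => tensorAct_gen R a i j

theorem isGLAction_totalE : IsGLAction (totalE R) := by
  intro i j k l
  have h := congrArg (tensorAct R) (tot_bracket (ℓ := ℓ) i j k l)
  simpa only [map_sub, map_mul, map_smul, apply_ite (tensorAct R), map_zero, tensorAct_tot] using h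

end TensorWeights

/-! ### Constraints on singular weights -/

section HighestWeights

variable {m n : ℕ} {V : Type*} [AddCommGroup V] [Module ℂ V]
  {E : Idx m n → Idx m n → Module.End ℂ V}

theorem IsGLAction.apply (hE : IsGLAction E) (i j k l : Idx m n) (v : V) :
    E i j (E k l v) = sgn i j k l • E k l (E i j v) + (if j = k then E i l v else 0)
      - sgn i j k l • (if l = i then E k j v else 0) := by
  have h := LinearMap.congr_fun (hE i j k l) v
  simp only [LinearMap.sub_apply, LinearMap.smul_apply, Module.End.mul_apply] at h
  rw [sub_eq_iff_eq_add] at h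
  rw [h]
  by_cases h1 : j = k <;> by_cases h2 : l = i <;> simp [h1, h2] <;> abel

theorem IsGLAction.apply_diag (hE : IsGLAction E) (k i j : Idx m n) (v : V) :
    E k k (E i j v) = E i j (E k k v) + (if k = i then E i j v else 0)
      - (if k = j then E i j v else 0) := by
  have hs : sgn k k i j = 1 := by rw [sgn, ← two_mul, mul_assoc, pow_mul]; simp
  rw [hE.apply, hs, one_smul, one_smul]
  congr 1
  · congr 1
    split_ifs with h
    · rw [h]
    · rfl
  · simp only [eq_comm (a := j)]
    split_ifs with h
    · rw [h]
    · rfl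

/-- The eigenvalues of the diagonal matrix units are natural numbers. -/
def NatEigenvalues (E : Idx m n → Idx m n → Module.End ℂ V) : Prop :=
  ∀ i (c : ℂ) v, E i i v = c • v → v ≠ 0 → ∃ d : ℕ, c = d

/-- The weight of a vector that is killed by a raising operator of even parity is dominant with
respect to the corresponding `sl_2`. -/
theorem exists_nat_of_raising (hE : IsGLAction E) (hnat : NatEigenvalues E) {i j : Idx m n}
    (hij : i ≠ j) (hpar : par i = par j) {a b : ℂ} {v : V} (hi : E i i v = a • v)
    (hj : E j j v = b • v) (hv : E i j v = 0) (hv0 : v ≠ 0) : ∃ d : ℕ, a = b + d := by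
  have hs : ∀ k l, sgn i j k l = 1 ∧ sgn k l i j = 1 := fun k l => by
    constructor
    · rw [sgn, hpar, ← two_mul, mul_assoc, pow_mul]; simp
    · rw [sgn, hpar, ← two_mul, mul_left_comm, pow_mul]; simp
  set f := E j i
  have hfi : ∀ t : ℕ, E i i ((f ^ t) v) = (a - t) • (f ^ t) v := by
    intro t
    induction t with
    | zero => simpa using hi
    | succ t ih =>
      rw [pow_succ', Module.End.mul_apply, hE.apply_diag, ih, if_neg hij, if_pos rfl, map_smul]
      push_cast
      module
  have hfj : ∀ t : ℕ, E j j ((f ^ t) v) = (b + t) • (f ^ t) v := by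
    intro t
    induction t with
    | zero => simpa using hj
    | succ t ih =>
      rw [pow_succ', Module.End.mul_apply, hE.apply_diag, ih, if_neg (Ne.symm hij), if_pos rfl,
        map_smul]
      push_cast
      module
  have he : ∀ t : ℕ, E i j ((f ^ (t + 1)) v) = ((t + 1 : ℂ) * (a - b - t)) • (f ^ t) v := by
    intro t
    induction t with
    | zero =>
      rw [zero_add, pow_one, hE.apply, hv, map_zero, smul_zero, if_pos rfl, if_pos rfl, hi, hj,
        (hs _ _).1]
      simp
      module
    | succ t ih =>
      rw [pow_succ', Module.End.mul_apply, hE.apply, ih, if_pos rfl, if_pos rfl, hfi, hfj,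
        (hs _ _).1, map_smul, ← Module.End.mul_apply, ← pow_succ']
      push_cast
      module
  -- Some power of the lowering operator kills `v`, because the weight at `i` stays nonnegative.
  obtain ⟨A, rfl⟩ := hnat i a v hi hv0
  have hz : ∃ t, (f ^ t) v = 0 := by
    refine ⟨A + 1, ?_⟩
    by_contra h
    obtain ⟨d, hd⟩ := hnat i _ _ (hfi (A + 1)) h
    have : (d : ℂ) + 1 = 0 := by rw [← hd]; push_cast; ring
    exact Nat.cast_add_one_ne_zero d this
  classical
  obtain ⟨t, ht, hmin⟩ : ∃ t, (f ^ t) v = 0 ∧ ∀ s < t, (f ^ s) v ≠ 0 :=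
    ⟨Nat.find hz, Nat.find_spec hz, fun s hs => Nat.find_min hz hs⟩
  obtain _ | t := t
  · exact absurd (by simpa using ht) hv0
  · have h := he t
    rw [ht, map_zero, eq_comm, smul_eq_zero, mul_eq_zero] at h
    refine ⟨t, ?_⟩
    rcases h with (h | h) | h
    · exact absurd h (Nat.cast_add_one_ne_zero t)
    · linear_combination h
    · exact absurd h (hmin t (Nat.lt_succ_self t))

/-- Odd lowering operators `E_{s,c}`, `s = 1/2, 3/2, …`, applied to a singular vector produce
nonzero vectors as long as the weights at the `s` are positive; the vector after `s` steps has
weight `a - s` at `c`, which is therefore a natural number. -/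
theorem exists_chain (hE : IsGLAction E) (hnat : NatEigenvalues E) (c : Fin m) {a : ℂ}
    {η : Fin n → ℕ} {v : V} (hv0 : v ≠ 0) (hc : E (Sum.inl c) (Sum.inl c) v = a • v)
    (hη : ∀ r, E (Sum.inr r) (Sum.inr r) v = (η r : ℂ) • v)
    (hcr : ∀ r, E (Sum.inl c) (Sum.inr r) v = 0)
    (hrr : ∀ r r', r < r' → E (Sum.inr r) (Sum.inr r') v = 0) (s : ℕ)
    (hs : ∀ r : Fin n, (r : ℕ) < s → 0 < η r) (hsn : s ≤ n) :
    ∃ w, w ≠ 0 ∧ E (Sum.inl c) (Sum.inl c) w = (a - s) • w ∧ ∀ r : Fin n, s ≤ (r : ℕ) →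
      E (Sum.inr r) (Sum.inr r) w = (η r : ℂ) • w ∧ E (Sum.inl c) (Sum.inr r) w = 0 ∧
        ∀ r' < r, E (Sum.inr r') (Sum.inr r) w = 0 := by
  induction s with
  | zero =>
    exact ⟨v, hv0, by simpa using hc, fun r _ => ⟨hη r, hcr r, fun r' h => hrr r' r h⟩⟩
  | succ s ih =>
    obtain ⟨w, hw0, hwc, hw⟩ := ih (fun r hr => hs r (by omega)) (by omega)
    set q : Fin n := ⟨s, by omega⟩
    obtain ⟨hq1, hq2, -⟩ := hw q le_rfl
    have hne : ∀ i : Fin m, ∀ j : Fin n, (Sum.inl i : Idx m n) ≠ Sum.inr j := fun i j h => by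
      cases h
    have hne' : ∀ i : Fin m, ∀ j : Fin n, (Sum.inr j : Idx m n) ≠ Sum.inl i := fun i j h => by
      cases h
    refine ⟨E (Sum.inr q) (Sum.inl c) w, fun h0 => ?_, ?_, fun r hr => ?_⟩
    · have h := hE.apply (Sum.inl c) (Sum.inr q) (Sum.inr q) (Sum.inl c) w
      have hsg : sgn (Sum.inl c) (Sum.inr q) (Sum.inr q : Idx m n) (Sum.inl c) = -1 := by
        simp [sgn, par]
      rw [h0, hq2, if_pos rfl, if_pos rfl, hsg, hwc, hq1, map_zero, map_zero, smul_zero, zero_add,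
        neg_one_smul, sub_neg_eq_add, ← add_smul, eq_comm, smul_eq_zero] at h
      obtain ⟨d, hd⟩ := hnat _ _ _ hwc hw0
      have hpos := hs q (Nat.lt_succ_self s)
      rw [hd] at h
      have := h.resolve_right hw0
      norm_cast at this
      omega
    · rw [hE.apply_diag, hwc, if_neg (hne _ _), if_pos rfl, map_smul]
      push_cast
      module
    · have hqr : q < r := Fin.lt_def.2 hr
      obtain ⟨h1, h2, h3⟩ := hw r (by omega)
      refine ⟨?_, ?_, fun r' hr' => ?_⟩
      · rw [hE.apply_diag, h1, if_neg (fun h => hqr.ne' (Sum.inr_injective h)), if_neg (hne' _ _),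
          map_smul, add_zero, sub_zero]
      · rw [hE.apply, h2, if_neg (fun h => hqr.ne' (Sum.inr_injective h)), if_pos rfl,
          h3 q hqr]
        simp
      · rw [hE.apply, h3 r' hr', if_neg (fun h => hqr.ne' (Sum.inr_injective h)),
          if_neg (hne _ _)]
        simp

end HighestWeights

/-! ### Hook partitions -/

section Partitions

/-- A weakly decreasing sequence that vanishes eventually is the sequence of rows of a Young
diagram. -/
theorem exists_youngDiagram {r : ℕ → ℕ} (hr : Antitone r) {N : ℕ} (hN : r N = 0) :
    ∃ lam : YoungDiagram, ∀ i, lam.rowLen i = r i := by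
  have hmem : ∀ x : ℕ × ℕ, x ∈ ((Finset.range N ×ˢ Finset.range (r 0)).filter
      fun x => x.2 < r x.1) ↔ x.2 < r x.1 := by
    intro x
    rw [Finset.mem_filter, Finset.mem_product, Finset.mem_range, Finset.mem_range]
    refine ⟨fun h => h.2, fun h => ⟨⟨?_, h.trans_le (hr (Nat.zero_le _))⟩, h⟩⟩
    by_contra hx
    have := hr (not_lt.1 hx)
    omega
  refine ⟨⟨(Finset.range N ×ˢ Finset.range (r 0)).filter fun x => x.2 < r x.1,
    fun x y hyx hx => ?_⟩, fun i => ?_⟩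
  · rw [Finset.mem_coe, hmem] at hx ⊢
    exact (hyx.2.trans_lt hx).trans_le (hr hyx.1)
  · refine eq_of_forall_lt_iff fun j => ?_
    rw [← YoungDiagram.mem_iff_lt_rowLen, ← YoungDiagram.mem_cells]
    exact hmem (i, j)

/-- The set where a weakly decreasing sequence exceeds `t` is an initial segment. -/
theorem lt_card_filter_iff {n : ℕ} {η : Fin n → ℕ} (hη : Antitone η) (t : ℕ) (j : Fin n) :
    (j : ℕ) < (Finset.univ.filter fun j' => t < η j').card ↔ t < η j := by
  constructor
  · intro h
    by_contra hj
    have hsub : (Finset.univ.filter fun j' => t < η j') ⊆ Finset.Iio j := fun j' hj' => by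
      rw [Finset.mem_Iio]
      by_contra hle
      have h1 := hη (not_lt.1 hle)
      have h2 := (Finset.mem_filter.1 hj').2
      omega
    have := Finset.card_le_card hsub
    rw [Fin.card_Iio] at this
    omega
  · intro h
    have hsub : Finset.Iic j ⊆ (Finset.univ.filter fun j' => t < η j') := fun j' hj' =>
      Finset.mem_filter.2 ⟨Finset.mem_univ _, h.trans_le (hη (Finset.mem_Iic.1 hj'))⟩
    have := Finset.card_le_card hsub
    rw [Fin.card_Iic] at this
    omega

/-- The hook partition with given first `p` rows and given columns below row `p`. -/
theorem exists_hook {p n : ℕ} (hp : 0 < p) {a : ℕ → ℕ} {η : Fin n → ℕ} (ha : AntitoneOn a (Set.Iio p))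
    (hη : Antitone η) (hb : ∀ j : Fin n, 0 < η j → (j : ℕ) < a (p - 1)) :
    ∃ lam : YoungDiagram, lam.rowLen p ≤ n ∧ (∀ i < p, lam.rowLen i = a i) ∧
      ∀ j : Fin n, lam.colLen j - p = η j := by
  set b : ℕ → ℕ := fun t => (Finset.univ.filter fun j' => t < η j').card with hbdef
  have hbanti : Antitone b := fun s t hst => Finset.card_le_card fun j hj => by
    simp only [Finset.mem_filter, Finset.mem_univ, true_and] at hj ⊢
    omega
  have hbn : ∀ t, b t ≤ n := fun t => (Finset.card_filter_le _ _).trans (by simp)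
  -- The first row below row `p` has as many boxes as there are nonempty columns, so it fits.
  have hb0 : b 0 ≤ a (p - 1) := by
    by_contra h
    have hlt : a (p - 1) < n := by have := hbn 0; omega
    have := hb ⟨_, hlt⟩ ((lt_card_filter_iff hη 0 ⟨_, hlt⟩).1 (not_le.1 h))
    exact lt_irrefl _ this
  -- The rows below row `p` are those of the conjugate of `η`.
  set r : ℕ → ℕ := fun i => if i < p then a i else b (i - p) with hrdef
  have hr : Antitone r := by
    intro i i' h
    simp only [hrdef]
    split_ifs with h1 h2 h2
    · exact ha h2 h1 h
    · omega
    · exact ((hbanti (Nat.zero_le _)).trans hb0).trans (ha h2 (by simp; omega) (by omega))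
    · exact hbanti (by omega)
  have hrN : r (p + ∑ j, η j) = 0 := by
    simp only [hrdef]
    rw [if_neg (by omega), hbdef]
    simp only [Finset.card_eq_zero, Finset.filter_eq_empty_iff, Finset.mem_univ, true_implies]
    intro j
    have := Finset.single_le_sum (f := η) (fun _ _ => Nat.zero_le _) (Finset.mem_univ j)
    omega
  obtain ⟨lam, hlam⟩ := exists_youngDiagram hr hrN
  refine ⟨lam, ?_, fun i hi => ?_, fun j => eq_of_forall_lt_iff fun t => ?_⟩
  · rw [hlam]
    simp only [hrdef, lt_irrefl, if_false]
    exact hbn _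
  · rw [hlam]
    simp only [hrdef, if_pos hi]
  · rw [Nat.lt_sub_iff_add_lt, ← YoungDiagram.mem_iff_lt_colLen, YoungDiagram.mem_iff_lt_rowLen,
      hlam, ← lt_card_filter_iff hη t j]
    simp only [hrdef]
    rw [if_neg (by omega), Nat.add_sub_cancel]

end Partitions

/-! ### Stability and images of generated subalgebras -/

section ImagesOfSubalgebras

variable {A A' V : Type*} [Ring A] [Algebra ℂ A] [Ring A'] [Algebra ℂ A'] [AddCommGroup V]
  [Module ℂ V]

theorem isStable_adjoin (ρ : A →ₐ[ℂ] Module.End ℂ V) {G : Set A} {N : Submodule ℂ V}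
    (h : ∀ x ∈ G, ∀ v ∈ N, ρ x v ∈ N) : IsStable ρ (Algebra.adjoin ℂ G) N := by
  intro b hb
  induction hb using Algebra.adjoin_induction with
  | mem x hx => exact h x hx
  | algebraMap c =>
    intro v hv
    rw [AlgHom.commutes, Module.algebraMap_end_apply]
    exact N.smul_mem c hv
  | add x y _ _ hx hy =>
    intro v hv
    rw [map_add, LinearMap.add_apply]
    exact N.add_mem (hx v hv) (hy v hv)
  | mul x y _ _ hx hy =>
    intro v hv
    rw [map_mul, Module.End.mul_apply]
    exact hx _ (hy v hv)

/-- Stability under the second subalgebra is needed for products: the second factor maps `N` to `N`,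
where the first one can be replaced. -/
theorem imageOn_adjoin_le (ρ : A →ₐ[ℂ] Module.End ℂ V) (ρ' : A' →ₐ[ℂ] Module.End ℂ V) {G : Set A}
    {B' : Subalgebra ℂ A'} {N : Submodule ℂ V} (hB' : IsStable ρ' B' N)
    (h : ∀ x ∈ G, ∃ b ∈ B', ∀ v ∈ N, ρ x v = ρ' b v) :
    imageOn ρ (Algebra.adjoin ℂ G) N ≤ imageOn ρ' B' N := by
  rintro f ⟨b, hb, hf⟩
  have key : ∃ b' ∈ B', ∀ v ∈ N, ρ b v = ρ' b' v := by
    clear hf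
    induction hb using Algebra.adjoin_induction with
    | mem x hx => exact h x hx
    | algebraMap c =>
      refine ⟨algebraMap ℂ A' c, B'.algebraMap_mem c, fun v _ => ?_⟩
      rw [AlgHom.commutes, AlgHom.commutes]
    | add x y _ _ hx hy =>
      obtain ⟨x', hx', hx⟩ := hx
      obtain ⟨y', hy', hy⟩ := hy
      refine ⟨x' + y', B'.add_mem hx' hy', fun v hv => ?_⟩
      rw [map_add, map_add, LinearMap.add_apply, LinearMap.add_apply, hx v hv, hy v hv]
    | mul x y _ _ hx hy =>
      obtain ⟨x', hx', hx⟩ := hx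
      obtain ⟨y', hy', hy⟩ := hy
      refine ⟨x' * y', B'.mul_mem hx' hy', fun v hv => ?_⟩
      rw [map_mul, map_mul, Module.End.mul_apply, Module.End.mul_apply, hy v hv,
        hx _ (hB' y' hy' v hv)]
  obtain ⟨b', hb', hbb'⟩ := key
  exact ⟨b', hb', fun v => (hf v).trans (hbb' v v.2)⟩

end ImagesOfSubalgebras

/-! ### Singular vectors and truncation -/

section Truncation

variable {m n p k ℓ : ℕ} {M : Fin ℓ → Type*} [∀ a, AddCommGroup (M a)] [∀ a, Module ℂ (M a)]
  (R : ∀ a, PolyModule m n (M a)) (hp : p ≤ m) (hk : k ≤ n)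

theorem natEigenvalues_totalE : NatEigenvalues (totalE R) :=
  fun _ _ _ hv hv0 => totalE_eigenvalue R hv hv0

theorem singSpace_apply {V : Type*} [AddCommGroup V] [Module ℂ V]
    {E : Idx m n → Idx m n → Module.End ℂ V} {σ : Equiv.Perm (Fin (m + n))} {v : V} :
    v ∈ singSpace E σ ↔ ∀ i j, σ (pos i) < σ (pos j) → E i j v = 0 := by
  simp [singSpace, Submodule.mem_iInf]

/-- The vectors whose weight vanishes outside `I_{p|k}`. -/
def innerSpace : Submodule ℂ (PiTensorProduct ℂ M) :=
  ⨅ (j : Idx m n) (_ : j ∉ Set.range (emb hp hk)), LinearMap.ker (totalE R j j)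

variable {R hp hk} in
theorem mem_innerSpace {v : PiTensorProduct ℂ M} :
    v ∈ innerSpace R hp hk ↔ ∀ j ∉ Set.range (emb hp hk), totalE R j j v = 0 := by
  simp only [innerSpace, Submodule.mem_iInf, LinearMap.mem_ker]

variable {R hp hk}

/-- The left ideal of the matrix units with column outside `I_{p|k}` annihilates the vectors whose
weight vanishes outside `I_{p|k}`. -/
theorem tensorAct_outsideIdeal {x : Env m n ℓ} (hx : x ∈ outsideIdeal ℓ hp hk)
    {v : PiTensorProduct ℂ M} (hv : v ∈ innerSpace R hp hk) : tensorAct R x v = 0 := by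
  induction hx using Submodule.span_induction with
  | mem x hx =>
    obtain ⟨a, i, j, hj, rfl⟩ := hx
    rw [tensorAct_gen]
    exact tensorE_apply_eq_zero R (mem_innerSpace.1 hv j hj) a i
  | zero => rw [map_zero, LinearMap.zero_apply]
  | add x y _ _ hx hy => rw [map_add, LinearMap.add_apply, hx, hy, add_zero]
  | smul a x _ hx => rw [smul_eq_mul, map_mul, Module.End.mul_apply, hx, map_zero]

/-- The identity between the Berezinians of `L_{m|n}` and `L_{p|k}` on a vector whose weight
vanishes outside `I_{p|k}`. -/
theorem gaudinBer_apply (z : Fin ℓ → ℂ) {v : PiTensorProduct ℂ M} (hv : v ∈ innerSpace R hp hk) :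
    PDO.apply (tensorAct R) (gaudinBer m n z) v =
      PDO.apply ((tensorAct R).comp (envIncl ℓ hp hk))
        (gaudinBer p k z * PDO.dpow _ (((m - p : ℕ) : ℤ) - ((n - k : ℕ) : ℤ))) v := by
  refine HahnSeries.ext (funext fun x => ?_)
  have h := tensorAct_outsideIdeal (gaudinBer_sub_mem hp hk z (-x.1) (-x.2)) hv
  rw [PDO.sub_coeff, map_sub, LinearMap.sub_apply, sub_eq_zero] at h
  exact h

/-- The permutation `σ` puts `I_{p|k}` first, in the standard order. -/
def PutsFirst (hp : p ≤ m) (hk : k ≤ n) (σ : Equiv.Perm (Fin (m + n))) : Prop :=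
  ∀ i : Idx p k, (σ (pos (emb hp hk i)) : ℕ) = pos i

variable {σ : Equiv.Perm (Fin (m + n))}

/-- The indices that precede an element of `I_{p|k}` belong to `I_{p|k}`. -/
theorem PutsFirst.mem_range (hσ : PutsFirst hp hk σ) {i : Idx m n} {j : Idx p k}
    (h : σ (pos i) < σ (pos (emb hp hk j))) : i ∈ Set.range (emb hp hk) := by
  have hlt : (σ (pos i) : ℕ) < p + k := (Fin.lt_def.1 h).trans (by rw [hσ j]; exact (pos j).isLt)
  refine ⟨idx ⟨_, hlt⟩, ?_⟩
  have h1 := hσ (idx ⟨_, hlt⟩)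
  have h2 : pos (idx ⟨(σ (pos i) : ℕ), hlt⟩ : Idx p k) = ⟨_, hlt⟩ :=
    finSumFinEquiv.apply_symm_apply _
  rw [h2] at h1
  exact finSumFinEquiv.injective (σ.injective (Fin.ext h1))

theorem weightSpace_le_innerSpace {μ : Idx m n → ℂ} (hμ : ∀ j ∉ Set.range (emb hp hk), μ j = 0) :
    weightSpace (totalE R) μ ≤ innerSpace R hp hk := fun v hv =>
  mem_innerSpace.2 fun j hj => by rw [mem_weightSpace.1 hv j, hμ j hj, zero_smul]

/-- A vector whose weight vanishes outside `I_{p|k}` is singular for `gl_{m|n}` if it is singular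
for `gl_{p|k}`: the raising operators `E_ij` with `j` outside kill it, and if `j` is inside, so is
`i`. -/
theorem singWt_eq (hσ : PutsFirst hp hk σ) {μ : Idx m n → ℂ}
    (hμ : ∀ j ∉ Set.range (emb hp hk), μ j = 0) : singWt (totalE R) σ μ =
      weightSpace (totalE R) μ ⊓ singSpace (restrictE (totalE R) hp hk) 1 := by
  apply le_antisymm <;> intro v hv <;>
    refine Submodule.mem_inf.2 ⟨(Submodule.mem_inf.1 hv).1, singSpace_apply.2 fun i j hij => ?_⟩
  · refine singSpace_apply.1 (Submodule.mem_inf.1 hv).2 (emb hp hk i) (emb hp hk j) (Fin.lt_def.2 ?_)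
    rw [hσ, hσ]
    exact hij
  · by_cases hj : j ∈ Set.range (emb hp hk)
    · obtain ⟨j, rfl⟩ := hj
      obtain ⟨i, rfl⟩ := hσ.mem_range hij
      refine singSpace_apply.1 hv.2 i j (Fin.lt_def.2 ?_)
      have := Fin.lt_def.1 hij
      rwa [hσ, hσ] at this
    · rw [totalE, LinearMap.sum_apply]
      exact Finset.sum_eq_zero fun a _ =>
        tensorE_apply_eq_zero R (mem_innerSpace.1 (weightSpace_le_innerSpace hμ hv.1) j hj) a i

/-- The singular vectors of the truncation are those of the tensor product. The weight of a vector
of the truncation vanishes outside `I_{p|k}`, so it is determined by the weight for `gl_{p|k}`. -/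
theorem truncSingWt_eq (hσ : PutsFirst hp hk σ) {μ : Idx m n → ℂ}
    (hμ : ∀ j ∉ Set.range (emb hp hk), μ j = 0) :
    truncSingWt (totalE R) hp hk (μ ∘ emb hp hk) = singWt (totalE R) σ μ := by
  rw [singWt_eq hσ hμ]
  apply le_antisymm <;> intro v hv
  · refine Submodule.mem_inf.2 ⟨?_, hv.2.2⟩
    have hle : truncation (totalE R) hp hk ≤ innerSpace R hp hk :=
      iSup_le fun ν => weightSpace_le_innerSpace fun j hj => by
        rw [Function.extend_apply' _ _ _ hj]; rfl
    rw [mem_weightSpace]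
    intro i
    by_cases hi : i ∈ Set.range (emb hp hk)
    · obtain ⟨i, rfl⟩ := hi
      exact mem_weightSpace.1 hv.2.1 i
    · rw [mem_innerSpace.1 (hle hv.1) i hi, hμ i hi, zero_smul]
  · refine ⟨?_, mem_weightSpace.2 fun i => mem_weightSpace.1 hv.1 (emb hp hk i), hv.2⟩
    by_cases h0 : v = 0
    · rw [h0]; exact zero_mem _
    · have hnat := fun i => totalE_eigenvalue R (mem_weightSpace.1 hv.1 (emb hp hk i)) h0
      choose ν hν using hnat
      refine Submodule.mem_iSup_of_mem ν ?_
      have e : Function.extend (emb hp hk) (fun i => (ν i : ℂ)) 0 = μ := by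
        funext j
        by_cases hj : j ∈ Set.range (emb hp hk)
        · obtain ⟨j, rfl⟩ := hj
          rw [(emb_injective hp hk).extend_apply, hν]
        · rw [Function.extend_apply' _ _ _ hj, hμ j hj]; rfl
      rw [e]
      exact hv.1

theorem envIncl_tot (i j : Idx p k) :
    envIncl ℓ hp hk (tot ℓ i j) = tot ℓ (emb hp hk i) (emb hp hk j) := by
  rw [tot, map_sum, tot]
  exact Finset.sum_congr rfl fun a _ => Env.lift_gen ..

/-- The coefficients with `i < j`, which are not among the generators, vanish. -/
theorem hamiltonian_mem (z : Fin ℓ → ℂ) (i j : ℕ) (s : ℤ) :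
    hamiltonian m n z i j s ∈ gaudinAlgebra m n z := by
  by_cases h : j ≤ i
  · exact Algebra.subset_adjoin ⟨i, j, s, h, rfl⟩
  · rw [hamiltonian_eq_zero z (not_le.1 h)]
    exact zero_mem _

theorem hamiltonian_mem_weightSpace (z : Fin ℓ → ℂ) (i j : ℕ) (s : ℤ) {μ : Idx m n → ℂ}
    {v : PiTensorProduct ℂ M} (hv : v ∈ weightSpace (totalE R) μ) :
    tensorAct R (hamiltonian m n z i j s) v ∈ weightSpace (totalE R) μ := by
  rw [mem_weightSpace] at hv ⊢
  intro x
  have h := congrArg (tensorAct R) (hamiltonian_commute_weight (ℓ := ℓ) z x i j s).eq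
  rw [map_mul, map_mul, tensorAct_tot] at h
  have h' := LinearMap.congr_fun h v
  rwa [Module.End.mul_apply, Module.End.mul_apply, hv x, map_smul] at h'

/-- On the vectors whose weight vanishes outside `I_{p|k}`, the Hamiltonians of `gl_{m|n}` and of
`gl_{p|k}` are combinations of each other. -/
theorem hamiltonian_apply (R : ∀ a, PolyModule m n (M a)) (hp : p ≤ m) (hk : k ≤ n)
    (z : Fin ℓ → ℂ) : ∃ c c' : PowerSeries ℂ, ∀ (i j : ℕ) (s : ℤ),
    ∀ v ∈ innerSpace R hp hk,
      tensorAct R (hamiltonian m n z i j s) v = (tensorAct R).comp (envIncl ℓ hp hk)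
        (∑ x ∈ Finset.HasAntidiagonal.antidiagonal i,
          PowerSeries.coeff x.2 c • hamiltonian p k z x.1 j s) v ∧
      (tensorAct R).comp (envIncl ℓ hp hk) (hamiltonian p k z i j s) v =
        tensorAct R (∑ x ∈ Finset.HasAntidiagonal.antidiagonal i,
          PowerSeries.coeff x.2 c' • hamiltonian m n z x.1 j s) v := by
  obtain ⟨c, c', h⟩ := hamiltonian_relation (ℓ := ℓ) hp hk z
  refine ⟨c, c', fun i j s v hv => ⟨?_, ?_⟩⟩
  · have h1 := tensorAct_outsideIdeal (h i j s).1 hv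
    rw [map_sub, LinearMap.sub_apply, sub_eq_zero] at h1
    rw [h1, AlgHom.comp_apply, map_sum (envIncl ℓ hp hk)]
    simp only [map_smul]
  · have h1 := tensorAct_outsideIdeal (h i j s).2 hv
    rwa [map_sub, LinearMap.sub_apply, sub_eq_zero] at h1

/-- Stability of the sum of the spaces of singular vectors under the two Gaudin algebras, and the
equality of their images. A Hamiltonian of `gl_{p|k}` preserves singular vectors because it commutes
with the raising operators of `gl_{p|k}`, which are the only ones that matter; the Hamiltonians of
`gl_{m|n}` act as combinations of these. -/
theorem isStable_and_imageOn_eq (hσ : PutsFirst hp hk σ) {S : (Idx m n → ℂ) → Prop}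
    (hS : ∀ μ, IsSingularWeight (totalE R) σ μ → S μ → ∀ j ∉ Set.range (emb hp hk), μ j = 0)
    (z : Fin ℓ → ℂ) :
    IsStable (tensorAct R) (gaudinAlgebra m n z) (singSum (totalE R) σ S) ∧
    IsStable ((tensorAct R).comp (envIncl ℓ hp hk)) (gaudinAlgebra p k z)
      (singSum (totalE R) σ S) ∧
    imageOn (tensorAct R) (gaudinAlgebra m n z) (singSum (totalE R) σ S) =
      imageOn ((tensorAct R).comp (envIncl ℓ hp hk)) (gaudinAlgebra p k z)
        (singSum (totalE R) σ S) := by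
  obtain ⟨c, c', hH⟩ := hamiltonian_apply R hp hk z
  have hN : singSum (totalE R) σ S ≤ innerSpace R hp hk :=
    iSup₂_le fun μ hμ => inf_le_left.trans (weightSpace_le_innerSpace (hS μ hμ.1 hμ.2))
  have hmem : ∀ i j s, ∑ x ∈ Finset.HasAntidiagonal.antidiagonal i,
      PowerSeries.coeff x.2 c • hamiltonian p k z x.1 j s ∈ gaudinAlgebra p k z := fun i j s =>
    sum_mem fun x _ => Subalgebra.smul_mem _ (hamiltonian_mem z _ _ _) _
  have hmem' : ∀ i j s, ∑ x ∈ Finset.HasAntidiagonal.antidiagonal i,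
      PowerSeries.coeff x.2 c' • hamiltonian m n z x.1 j s ∈ gaudinAlgebra m n z := fun i j s =>
    sum_mem fun x _ => Subalgebra.smul_mem _ (hamiltonian_mem z _ _ _) _
  -- The Hamiltonians of `gl_{p|k}` preserve the weight for `gl_{m|n}`, being combinations of those
  -- of `gl_{m|n}`, and they commute with the raising operators of `gl_{p|k}`.
  have hstab' : ∀ i j s μ, IsSingularWeight (totalE R) σ μ → S μ → ∀ v ∈ singWt (totalE R) σ μ,
      (tensorAct R).comp (envIncl ℓ hp hk) (hamiltonian p k z i j s) v ∈
        singWt (totalE R) σ μ := by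
    intro i j s μ hμ hSμ v hv
    have h0 := hS μ hμ hSμ
    rw [singWt_eq hσ h0] at hv ⊢
    refine ⟨?_, singSpace_apply.2 fun x y hxy => ?_⟩
    · rw [(hH i j s v (weightSpace_le_innerSpace h0 hv.1)).2, map_sum, LinearMap.sum_apply]
      refine sum_mem fun x _ => ?_
      rw [map_smul, LinearMap.smul_apply]
      exact Submodule.smul_mem _ _ (hamiltonian_mem_weightSpace z _ _ _ hv.1)
    · have h := congrArg ((tensorAct R).comp (envIncl ℓ hp hk))
        (hamiltonian_commute_raising (ℓ := ℓ) z hxy i j s).eq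
      rw [map_mul, map_mul] at h
      have h' := LinearMap.congr_fun h v
      have e : (tensorAct R).comp (envIncl ℓ hp hk) (tot ℓ x y) =
          restrictE (totalE R) hp hk x y := by
        rw [AlgHom.comp_apply, envIncl_tot, tensorAct_tot]; rfl
      rwa [e, Module.End.mul_apply, Module.End.mul_apply, singSpace_apply.1 hv.2 x y hxy,
        map_zero] at h'
  have st' : IsStable ((tensorAct R).comp (envIncl ℓ hp hk)) (gaudinAlgebra p k z)
      (singSum (totalE R) σ S) := by
    refine isStable_adjoin _ ?_
    rintro _ ⟨i, j, s, -, rfl⟩ v hv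
    have hle : singSum (totalE R) σ S ≤ (singSum (totalE R) σ S).comap
        ((tensorAct R).comp (envIncl ℓ hp hk) (hamiltonian p k z i j s)) :=
      iSup₂_le fun μ hμ v hv => Submodule.mem_iSup_of_mem μ
        (Submodule.mem_iSup_of_mem hμ (hstab' i j s μ hμ.1 hμ.2 v hv))
    exact hle hv
  have st : IsStable (tensorAct R) (gaudinAlgebra m n z) (singSum (totalE R) σ S) := by
    refine isStable_adjoin _ ?_
    rintro _ ⟨i, j, s, -, rfl⟩ v hv
    rw [(hH i j s v (hN hv)).1]
    exact st' _ (hmem i j s) v hv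
  refine ⟨st, st', le_antisymm (imageOn_adjoin_le _ _ st' ?_) (imageOn_adjoin_le _ _ st ?_)⟩
  · rintro _ ⟨i, j, s, -, rfl⟩
    exact ⟨_, hmem i j s, fun v hv => (hH i j s v (hN hv)).1⟩
  · rintro _ ⟨i, j, s, -, rfl⟩
    exact ⟨_, hmem' i j s, fun v hv => (hH i j s v (hN hv)).2⟩

end Truncation

/-! ### Singular weights and partitions -/

section SingularWeights

variable {m n ℓ : ℕ} {M : Fin ℓ → Type*} [∀ a, AddCommGroup (M a)] [∀ a, Module ℂ (M a)]
  (R : ∀ a, PolyModule m n (M a))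

theorem pos_inl (i : Fin m) : ((pos (Sum.inl i : Idx m n)) : ℕ) = i := by
  simp [pos]

theorem pos_inr (j : Fin n) : ((pos (Sum.inr j : Idx m n)) : ℕ) = m + j := by
  simp [pos]

theorem sigmaP_val {p : ℕ} (hp : p ≤ m) (r : Fin (m + n)) : (sigmaP n hp r : ℕ) =
    if (r : ℕ) < p then (r : ℕ) else if (r : ℕ) < m then r + n else r - (m - p) := rfl

theorem putsFirst_sigmaP {p : ℕ} (hp : p ≤ m) : PutsFirst hp (le_refl n) (sigmaP n hp) := by
  rintro (i | j)
  · have h : ((pos (emb hp (le_refl n) (Sum.inl i))) : ℕ) = i := pos_inl _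
    rw [sigmaP_val, h, if_pos i.isLt, pos_inl]
  · have h : ((pos (emb hp (le_refl n) (Sum.inr j))) : ℕ) = m + j := pos_inr _
    rw [sigmaP_val, h, if_neg (by omega), if_neg (by omega), pos_inr]
    omega

theorem putsFirst_one {k : ℕ} (hk : k ≤ n) : PutsFirst (le_refl m) hk 1 := by
  rintro (i | j)
  · exact (pos_inl (n := n) _).trans (pos_inl _).symm
  · exact (pos_inr (m := m) _).trans (pos_inr _).symm

theorem inr_mem_range {p k : ℕ} (hp : p ≤ m) (hk : k ≤ n) {j : Fin n} (hj : (j : ℕ) < k) :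
    (Sum.inr j : Idx m n) ∈ Set.range (emb hp hk) := ⟨Sum.inr ⟨j, hj⟩, rfl⟩

theorem inl_mem_range {p k : ℕ} (hp : p ≤ m) (hk : k ≤ n) {i : Fin m} (hi : (i : ℕ) < p) :
    (Sum.inl i : Idx m n) ∈ Set.range (emb hp hk) := ⟨Sum.inl ⟨i, hi⟩, rfl⟩

theorem VanishesAfter.eq_zero {p : ℕ} (hp : p ≤ m) {μ : Idx m n → ℂ} (h : VanishesAfter p μ) :
    ∀ j ∉ Set.range (emb hp (le_refl n)), μ j = 0 := by
  rintro (i | j) hj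
  · by_cases hi : (i : ℕ) < p
    · exact absurd (inl_mem_range hp le_rfl hi) hj
    · exact h i (not_lt.1 hi)
  · exact absurd (inr_mem_range hp le_rfl j.isLt) hj

variable {R}

/-- The weight of a singular vector is weakly decreasing along the indices of the same parity. -/
theorem IsSingularWeight.dominant {σ : Equiv.Perm (Fin (m + n))} {μ : Idx m n → ℂ}
    (hμ : IsSingularWeight (totalE R) σ μ) {f : Idx m n → ℕ} (hf : ∀ i, μ i = f i)
    {i j : Idx m n} (hpar : par i = par j) (hij : σ (pos i) < σ (pos j)) : f j ≤ f i := by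
  obtain ⟨v, hv, hv0⟩ := Submodule.exists_mem_ne_zero_of_ne_bot hμ
  obtain ⟨d, hd⟩ := exists_nat_of_raising (isGLAction_totalE R) (natEigenvalues_totalE R)
    (fun h => by rw [h] at hij; exact lt_irrefl _ hij) hpar (mem_weightSpace.1 hv.1 i)
    (mem_weightSpace.1 hv.1 j) (singSpace_apply.1 hv.2 i j hij) hv0
  rw [hf, hf] at hd
  norm_cast at hd
  omega

/-- The values of a singular weight are natural numbers. -/
theorem IsSingularWeight.exists_nat {σ : Equiv.Perm (Fin (m + n))} {μ : Idx m n → ℂ}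
    (hμ : IsSingularWeight (totalE R) σ μ) : ∃ f : Idx m n → ℕ, ∀ i, μ i = f i := by
  obtain ⟨v, hv, hv0⟩ := Submodule.exists_mem_ne_zero_of_ne_bot hμ
  choose f hf using fun i => totalE_eigenvalue R (mem_weightSpace.1 hv.1 i) hv0
  exact ⟨f, hf⟩

/-- The weight of a singular vector decreases along the odd indices, so it vanishes from an odd
index on if it vanishes there. -/
theorem VanishesAtOdd.eq_zero {k : ℕ} (hk : k ≤ n) {μ : Idx m n → ℂ}
    (hμ : IsSingularWeight (totalE R) 1 μ) (h : VanishesAtOdd k μ) :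
    ∀ j ∉ Set.range (emb (le_refl m) hk), μ j = 0 := by
  rintro (i | j) hj
  · exact absurd (inl_mem_range le_rfl hk i.isLt) hj
  · obtain ⟨f, hf⟩ := hμ.exists_nat
    have hkj : k ≤ j := by
      by_contra hlt
      exact hj (inr_mem_range le_rfl hk (not_le.1 hlt))
    have hkn : k < n := hkj.trans_lt j.isLt
    have h0 := h hkn
    rcases hkj.eq_or_lt with e | hlt
    · rwa [show (⟨k, hkn⟩ : Fin n) = j from Fin.ext e] at h0
    · have hle := hμ.dominant hf (i := Sum.inr ⟨k, hkn⟩) (j := Sum.inr j) rfl (Fin.lt_def.2 (by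
        rw [Equiv.Perm.one_apply, Equiv.Perm.one_apply, pos_inr, pos_inr]
        simpa using hlt))
      rw [hf, Nat.cast_eq_zero] at h0
      rw [hf, Nat.cast_eq_zero]
      omega

/-- The singular weights that vanish at the even indices after `p` are given by partitions: the
weights at the even indices up to `p` are the first `p` rows, and those at the odd indices are the
columns below them. -/
theorem vanishesAfter_iff {p : ℕ} (hp0 : 0 < p) (hp : p ≤ m) {μ : Idx m n → ℂ}
    (hμ : IsSingularWeight (totalE R) (sigmaP n hp) μ) :
    VanishesAfter p μ ↔ ∃ lam : YoungDiagram, IsHook p n lam ∧ μ = sigmaWeight m n p lam := by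
  constructor
  · intro h
    obtain ⟨f, hf⟩ := hμ.exists_nat
    have hσl : ∀ i : Fin m, (i : ℕ) < p → (sigmaP n hp (pos (Sum.inl i)) : ℕ) = i := fun i hi => by
      rw [sigmaP_val, pos_inl, if_pos hi]
    have hσr : ∀ j : Fin n, (sigmaP n hp (pos (Sum.inr j)) : ℕ) = p + j := fun j => by
      rw [sigmaP_val, pos_inr, if_neg (by omega), if_neg (by omega)]
      omega
    have ha : AntitoneOn (fun i => if hi : i < m then f (Sum.inl ⟨i, hi⟩) else 0) (Set.Iio p) := by
      intro i hi i' hi' hii'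
      rw [Set.mem_Iio] at hi hi'
      simp only [dif_pos (hi.trans_le hp), dif_pos (hi'.trans_le hp)]
      rcases hii'.eq_or_lt with rfl | hlt
      · exact le_rfl
      · refine hμ.dominant hf rfl (Fin.lt_def.2 ?_)
        rwa [hσl _ hi, hσl _ hi']
    have hη : Antitone fun j => f (Sum.inr j) := by
      intro j j' hjj'
      rcases hjj'.eq_or_lt with rfl | hlt
      · exact le_rfl
      · refine hμ.dominant hf rfl (Fin.lt_def.2 ?_)
        rw [hσr, hσr]
        have := Fin.lt_def.1 hlt
        omega
    obtain ⟨v, hv, hv0⟩ := Submodule.exists_mem_ne_zero_of_ne_bot hμ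
    -- If the weight at the odd index `j` is positive, so are those before it, and `j + 1` odd lowering
    -- operators from the even index `p - 1` (counted from `0`) give a nonzero vector.
    have hb : ∀ j : Fin n, 0 < f (Sum.inr j) →
        (j : ℕ) < if hi : p - 1 < m then f (Sum.inl ⟨p - 1, hi⟩) else 0 := by
      intro j hj
      have hpm : p - 1 < m := by omega
      rw [dif_pos hpm]
      obtain ⟨w, hw0, hw, -⟩ := exists_chain (isGLAction_totalE R) (natEigenvalues_totalE R)
        ⟨p - 1, hpm⟩ (η := fun j => f (Sum.inr j)) hv0 (mem_weightSpace.1 hv.1 _)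
        (fun r => by rw [mem_weightSpace.1 hv.1, hf])
        (fun r => singSpace_apply.1 hv.2 _ _ (Fin.lt_def.2 (by
          rw [hσl _ (by simp only; omega), hσr]; simp only; omega)))
        (fun r r' hr => singSpace_apply.1 hv.2 _ _ (Fin.lt_def.2 (by
          rw [hσr, hσr]; have := Fin.lt_def.1 hr; omega))) (j + 1)
        (fun r hr => hj.trans_le (hη (Fin.le_def.2 (by omega)))) (by omega)
      obtain ⟨d, hd⟩ := totalE_eigenvalue R hw hw0
      rw [hf, sub_eq_iff_eq_add] at hd
      norm_cast at hd
      omega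
    obtain ⟨lam, h1, h2, h3⟩ := exists_hook hp0 ha hη hb
    refine ⟨lam, h1, funext fun i => ?_⟩
    rcases i with i | j
    · simp only [sigmaWeight]
      split_ifs with hi
      · rw [h2 i hi, dif_pos i.isLt, hf]
      · have h4 := (lam.rowLen_anti p i (not_lt.1 hi)).trans h1
        rw [h i (not_lt.1 hi), Nat.sub_eq_zero_of_le h4, Nat.cast_zero]
    · simp only [sigmaWeight]
      rw [h3, hf]
  · rintro ⟨lam, h1, rfl⟩ i hi
    simp only [sigmaWeight, if_neg (not_lt.2 hi)]
    rw [Nat.sub_eq_zero_of_le ((lam.rowLen_anti p i hi).trans h1), Nat.cast_zero]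

end SingularWeights

end Gaudin
end

theorem mainTheorem7 {m n ℓ : ℕ} (hℓ : 0 < ℓ) (z : Fin ℓ → ℂ) (hz : Function.Injective z)
    {M : Fin ℓ → Type*} [∀ a, AddCommGroup (M a)] [∀ a, Module ℂ (M a)]
    (R : ∀ a, PolyModule m n (M a)) (p k : ℕ) (hp0 : 0 < p) (hp : p ≤ m) (hk : k ≤ n) :
    -- all the Berezinians below are well defined
    ((SufficientlyInvertible (gaudinL m n z) ∧ SufficientlyInvertible (gaudinLu m n z)) ∧
      (SufficientlyInvertible (gaudinL p n z) ∧ SufficientlyInvertible (gaudinLu p n z)) ∧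
      (SufficientlyInvertible (gaudinL m k z) ∧ SufficientlyInvertible (gaudinLu m k z))) ∧
    -- part (i)
    ((∀ μ : Idx m n → ℂ, IsSingularWeight (totalE R) (sigmaP n hp) μ →
        (VanishesAfter p μ ↔ ∃ lam : YoungDiagram, IsHook p n lam ∧ μ = sigmaWeight m n p lam)) ∧
      (∀ μ : Idx m n → ℂ, IsSingularWeight (totalE R) (sigmaP n hp) μ → VanishesAfter p μ →
        (∀ v ∈ singWt (totalE R) (sigmaP n hp) μ,
          PDO.apply (tensorAct R) (gaudinBer m n z) v =
            PDO.apply ((tensorAct R).comp (envIncl ℓ hp le_rfl))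
              (gaudinBer p n z * PDO.dpow (Env p n ℓ) ((m : ℤ) - p)) v) ∧
        truncSingWt (totalE R) hp le_rfl (μ ∘ emb hp le_rfl) =
          singWt (totalE R) (sigmaP n hp) μ) ∧
      IsStable (tensorAct R) (gaudinAlgebra m n z)
        (singSum (totalE R) (sigmaP n hp) (VanishesAfter p)) ∧
      IsStable ((tensorAct R).comp (envIncl ℓ hp le_rfl)) (gaudinAlgebra p n z)
        (singSum (totalE R) (sigmaP n hp) (VanishesAfter p)) ∧
      imageOn (tensorAct R) (gaudinAlgebra m n z)
          (singSum (totalE R) (sigmaP n hp) (VanishesAfter p)) =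
        imageOn ((tensorAct R).comp (envIncl ℓ hp le_rfl)) (gaudinAlgebra p n z)
          (singSum (totalE R) (sigmaP n hp) (VanishesAfter p))) ∧
    -- part (ii)
    ((∀ μ : Idx m n → ℂ, IsSingularWeight (totalE R) 1 μ → VanishesAtOdd k μ →
        (∀ v ∈ singWt (totalE R) 1 μ,
          PDO.apply (tensorAct R) (gaudinBer m n z) v =
            PDO.apply ((tensorAct R).comp (envIncl ℓ le_rfl hk))
              (gaudinBer m k z * PDO.dpow (Env m k ℓ) ((k : ℤ) - n)) v) ∧
        truncSingWt (totalE R) le_rfl hk (μ ∘ emb le_rfl hk) = singWt (totalE R) 1 μ) ∧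
      IsStable (tensorAct R) (gaudinAlgebra m n z) (singSum (totalE R) 1 (VanishesAtOdd k)) ∧
      IsStable ((tensorAct R).comp (envIncl ℓ le_rfl hk)) (gaudinAlgebra m k z)
        (singSum (totalE R) 1 (VanishesAtOdd k)) ∧
      imageOn (tensorAct R) (gaudinAlgebra m n z) (singSum (totalE R) 1 (VanishesAtOdd k)) =
        imageOn ((tensorAct R).comp (envIncl ℓ le_rfl hk)) (gaudinAlgebra m k z)
          (singSum (totalE R) 1 (VanishesAtOdd k))) := by
  have h0 : ∀ v : PiTensorProduct ℂ M, ∀ {q t : ℕ} (hq : q ≤ m) (ht : t ≤ n) (r : ℤ),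
      ((m - q : ℕ) : ℤ) - ((n - t : ℕ) : ℤ) = r → v ∈ innerSpace R hq ht →
      PDO.apply (tensorAct R) (gaudinBer m n z) v =
        PDO.apply ((tensorAct R).comp (envIncl ℓ hq ht))
          (gaudinBer q t z * PDO.dpow (Env q t ℓ) r) v := by
    rintro v q t hq ht r rfl hv
    exact gaudinBer_apply z hv
  refine ⟨⟨⟨(gaudinL_ber z).1, (gaudinLu_ber z).1⟩, ⟨(gaudinL_ber z).1, (gaudinLu_ber z).1⟩,
    (gaudinL_ber z).1, (gaudinLu_ber z).1⟩, ⟨fun μ hμ => vanishesAfter_iff hp0 hp hμ,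
    fun μ _ hv => ⟨fun v hvs => ?_, ?_⟩, ?_⟩, fun μ hμ hv => ⟨fun v hvs => ?_, ?_⟩, ?_⟩
  · exact h0 v hp le_rfl _ (by rw [Nat.sub_self, Nat.cast_sub hp]; simp)
      (weightSpace_le_innerSpace (hv.eq_zero hp) hvs.1)
  · exact truncSingWt_eq (putsFirst_sigmaP hp) (hv.eq_zero hp)
  · exact isStable_and_imageOn_eq (putsFirst_sigmaP hp) (fun μ _ hv => hv.eq_zero hp) z
  · exact h0 v le_rfl hk _ (by rw [Nat.sub_self, Nat.cast_sub hk]; simp)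
      (weightSpace_le_innerSpace (hv.eq_zero hk hμ) hvs.1)
  · exact truncSingWt_eq (putsFirst_one hk) (hv.eq_zero hk hμ)
  · exact isStable_and_imageOn_eq (putsFirst_one hk) (fun μ hμ hv => hv.eq_zero hk hμ) z
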